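/- Notation. For $\tau\in\mathbb H=\{\operatorname{Im}\tau>0\}$ let $\Lambda_\tau=\mathbb Z+\mathbb Z\tau$, $(\omega_0,\omega_1,\omega_2,\omega_3)=(0,1,\tau,1+\tau)$, let $\wp(z|\tau)$, $\zeta(z|\tau)$ be the Weierstrass functions of $\Lambda_\tau$, with $\wp'^2=4\wp^3-g_2(\tau)\wp-g_3(\tau)$, $e_k(\tau)=\wp(\tfrac{\omega_k}{2}|\tau)$ for $k=1,2,3$, $\eta_1(\tau)=\zeta(z+1|\tau)-\zeta(z|\tau)$, $\eta_2(\tau)=\zeta(z+\tau|\tau)-\zeta(z|\tau)$. For $(r,s)\in\mathbb C^2\setminus\tfrac12\mathbb Z^2$ put $Z=Z_{r,s}(\tau)=\zeta(r+s\tau|\tau)-r\eta_1(\tau)-s\eta_2(\tau)$, $\wp=\wp(r+s\tau|\tau)$, $\wp'=\wp'(r+s\tau|\tau)$, $$Z^{(3)}_{r,s}(\tau)=Z^6-15\wp Z^4-20\wp' Z^3+\left(\tfrac{27}{4}g_2-45\wp^2\right)Z^2-12\wp\wp' Z-\tfrac54(\wp')^2,$$ $$\Xi^{(2)}(Z)=28\wp'Z^6+(288\wp^2-24g_2)Z^5+300\wp\wp'Z^4+(640\wp^3-88g_2\wp-52g_3)Z^3+(180\wp^2-3g_2)\wp'Z^2+24\wp(\wp')^2Z+(\wp')^3.$$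 The function $p^{(2)}_{r,s}$. The Hamiltonian system of Painlevé VI with parameter $\theta=(\theta_0,\dots,\theta_4)$, $2\theta_0+\theta_1+\theta_2+\theta_3+\theta_4=1$, is $\frac{d\lambda}{dt}=\frac{\partial K}{\partial\mu}$, $\frac{d\mu}{dt}=-\frac{\partial K}{\partial\lambda}$ with $$K=\tfrac{1}{t(t-1)}\big\{\lambda(\lambda-1)(\lambda-t)\mu^2+\theta_0(\theta_0+\theta_4)(\lambda-t)-[\theta_1(\lambda-1)(\lambda-t)+\theta_2\lambda(\lambda-t)+(\theta_3-1)\lambda(\lambda-1)]\mu\big\}.$$ The Okamoto transformations act on $(\theta;\lambda,\mu)$, with $t$ fixed, by $\kappa_0:(-\theta_0,\theta_1+\theta_0,\theta_2+\theta_0,\theta_3+\theta_0,\theta_4+\theta_0;\ \lambda+\theta_0/\mu,\ \mu)$; for $j=1,2,3$, $\kappa_j$ replaces $\theta_0,\theta_j,\mu$ by $\theta_0+\theta_j,\,-\theta_j,\,\mu-\theta_j/(\lambda-c_j)$ with $(c_1,c_2,c_3)=(0,1,t)$; $\kappa_4$ replaces $\theta_0,\theta_4$ by $\theta_0+\theta_4,\,-\theta_4$.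 Put $\kappa_5=\kappa_0(\kappa_3\kappa_2\kappa_1\kappa_0)^2\kappa_4$ (composition, $\kappa_4$ applied first). Let $t=t(\tau)=\frac{e_3-e_1}{e_2-e_1}$, let $\lambda^{(0)}_{r,s}(t)=\frac{1}{e_2-e_1}\left(\wp+\frac{\wp'}{2Z}-e_1\right)$ be Hitchin's solution, let $\mu^{(0)}_{r,s}$ be determined from it by the first Hamiltonian equation with $\theta^0=(-\tfrac12,\tfrac12,\tfrac12,\tfrac12,\tfrac12)$, and let $\lambda^{(2)}_{r,s}$ be the $\lambda$-component of $\kappa_5$ applied to $(\theta^0;\lambda^{(0)}_{r,s},\mu^{(0)}_{r,s})$, a meromorphic function of $\tau\in\mathbb H$. Then $p^{(2)}_{r,s}(\tau)$ denotes any holomorphic function on an open set $U\subseteq\mathbb H$ with $p^{(2)}_{r,s}(\tau)\notin\tfrac12\Lambda_\tau$ and $\wp(p^{(2)}_{r,s}(\tau)|\tau)=e_1+(e_2-e_1)\lambda^{(2)}_{r,s}(t(\tau))$ on $U$ (as meromorphic functions). Theorem. Let $(r,s)\in\mathbb C^2\setminus\tfrac12\mathbb Z^2$. (1) Outside a discrete,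 relatively closed subset of $\mathbb H$ one has $r+s\tau\notin\Lambda_\tau$, $Z\neq0$ and $Z^{(3)}_{r,s}(\tau)\ne0$; and, outside such a subset, every point of $\mathbb H$ has a neighbourhood on which a function $p^{(2)}_{r,s}$ exists. (2) For every such $p^{(2)}_{r,s}$ on $U$, $$\wp(p^{(2)}_{r,s}(\tau)|\tau)=\wp+\frac{\Xi^{(2)}(Z)}{8\,Z\,Z^{(3)}_{r,s}(\tau)}$$ for all $\tau\in U$ with $r+s\tau\notin\Lambda_\tau$, $Z\ne0$, $Z^{(3)}_{r,s}(\tau)\neq0$. (3) The formula gives solutions of EPVI$(\tfrac{25}8,\tfrac18,\tfrac18,\tfrac18)$: if $p$ is holomorphic on an open set $U\subseteq\mathbb H$, $p(\tau)\notin\tfrac12\Lambda_\tau$ on $U$, and $\wp(p(\tau)|\tau)=\wp+\frac{\Xi^{(2)}(Z)}{8ZZ^{(3)}_{r,s}(\tau)}$ on $U$ (as meromorphic functions), then for all $\tau\in U$ $$p''(\tau)=-\frac1{4\pi^2}\left[\tfrac{25}8\wp'(p(\tau)|\tau)+\tfrac18\sum_{k=1}^3\wp'\left(p(\tau)+\tfrac{\omega_k}2\Big|\tau\right)\right].$$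 -/

import Mathlib

open Filter

noncomputable section

namespace LamePVI

/-! ### Weierstrass functions of the lattice `Λ_τ = ℤ + ℤ τ` -/

theorem linearIndependent_one_tau (τ : UpperHalfPlane) :
    LinearIndependent ℝ ![(1 : ℂ), (τ : ℂ)] := by
  rw [LinearIndependent.pair_iff]
  intro a b h
  have h2 := congrArg Complex.im h
  have h1 := congrArg Complex.re h
  simp only [Complex.real_smul, mul_one, Complex.add_im, Complex.ofReal_im, Complex.mul_im,
    Complex.ofReal_re, zero_mul, add_zero, zero_add, Complex.zero_im] at h2
  have hb : b = 0 := (mul_eq_zero.mp h2).resolve_right τ.im_ne_zero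
  subst hb
  simp at h1
  exact ⟨h1, rfl⟩

/-- The pair of periods `(1, τ)`, for `τ` in the upper half plane. (For `τ : ℂ` outside the upper
half plane this is a junk value.) -/
def per (τ : ℂ) : PeriodPair where
  ω₁ := 1
  ω₂ := (UpperHalfPlane.ofComplex τ : ℂ)
  indep := linearIndependent_one_tau _

/-- `℘(z|τ)`. -/
def wp (z τ : ℂ) : ℂ := (per τ).weierstrassP z

/-- `℘'(z|τ)`, the derivative in `z`. -/
def wp' (z τ : ℂ) : ℂ := (per τ).derivWeierstrassP z

/-- `g₂(τ)`. -/
def g2 (τ : ℂ) : ℂ := (per τ).g₂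

/-- `g₃(τ)`. -/
def g3 (τ : ℂ) : ℂ := (per τ).g₃

/-- The Weierstrass zeta function
`ζ(z|τ) = 1/z + ∑_{ω ≠ 0} (1/(z-ω) + 1/ω + z/ω²)`.
The term of the sum below at `ω = 0` is `1/z`, since `1/0 = 0` in Lean. -/
def zeta (z τ : ℂ) : ℂ :=
  ∑' ω : (per τ).lattice, (1 / (z - (ω : ℂ)) + 1 / (ω : ℂ) + z / (ω : ℂ) ^ 2)

/-- The quasi-period `η₁(τ) = ζ(z+1|τ) - ζ(z|τ)` (independent of `z`, taken at `z = -1/2`). -/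
def eta1 (τ : ℂ) : ℂ := zeta (1 / 2) τ - zeta (-(1 / 2)) τ

/-- The quasi-period `η₂(τ) = ζ(z+τ|τ) - ζ(z|τ)` (independent of `z`, taken at `z = -τ/2`). -/
def eta2 (τ : ℂ) : ℂ := zeta (τ / 2) τ - zeta (-(τ / 2)) τ

/-- The half periods `ω_k/2`, where `(ω₀, ω₁, ω₂, ω₃) = (0, 1, τ, 1 + τ)`. -/
def halfPeriod (k : Fin 4) (τ : ℂ) : ℂ := ![0, 1, τ, 1 + τ] k / 2

/-- `e_k(τ) = ℘(ω_k/2|τ)`, used for `k = 1, 2, 3`. -/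
def e (k : Fin 4) (τ : ℂ) : ℂ := wp (halfPeriod k τ) τ

/-! ### The pre-modular forms -/

/-- `Z_{r,s}(τ) = ζ(r+sτ|τ) - r η₁(τ) - s η₂(τ)`. -/
def Z (r s τ : ℂ) : ℂ := zeta (r + s * τ) τ - r * eta1 τ - s * eta2 τ

/-- `Z^{(3)}_{r,s}(τ)`. -/
def Z3 (r s τ : ℂ) : ℂ :=
  let X := Z r s τ
  let P := wp (r + s * τ) τ
  let P' := wp' (r + s * τ) τ
  X ^ 6 - 15 * P * X ^ 4 - 20 * P' * X ^ 3 + (27 / 4 * g2 τ - 45 * P ^ 2) * X ^ 2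
    - 12 * P * P' * X - 5 / 4 * P' ^ 2

/-- `Ξ^{(2)}(X)`, a polynomial in `X` with coefficients depending on `r, s, τ`. -/
def Xi2 (r s τ X : ℂ) : ℂ :=
  let P := wp (r + s * τ) τ
  let P' := wp' (r + s * τ) τ
  28 * P' * X ^ 6 + (288 * P ^ 2 - 24 * g2 τ) * X ^ 5 + 300 * P * P' * X ^ 4
    + (640 * P ^ 3 - 88 * g2 τ * P - 52 * g3 τ) * X ^ 3
    + (180 * P ^ 2 - 3 * g2 τ) * P' * X ^ 2 + 24 * P * P' ^ 2 * X + P' ^ 3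

/-- The right-hand side `℘ + Ξ^{(2)}(Z) / (8 Z Z^{(3)}_{r,s}(τ))`. -/
def rhs2 (r s τ : ℂ) : ℂ :=
  wp (r + s * τ) τ + Xi2 r s τ (Z r s τ) / (8 * Z r s τ * Z3 r s τ)

/-- The points of the upper half plane at which no denominator of `rhs2` vanishes and
`℘(r+sτ|τ)` is finite. -/
def rhs2Domain (r s : ℂ) : Set ℂ :=
  {τ | 0 < τ.im ∧ r + s * τ ∉ (per τ).lattice ∧ Z r s τ ≠ 0 ∧ Z3 r s τ ≠ 0}

/-! ### The Hamiltonian system of Painlevé VI and the Okamoto transformations -/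

/-- The Hamiltonian `K(λ, μ, t)` of Painlevé VI with parameters `θ = (θ₀, …, θ₄)`,
`2θ₀ + θ₁ + θ₂ + θ₃ + θ₄ = 1`; the system is `dλ/dt = ∂K/∂μ`, `dμ/dt = -∂K/∂λ`. -/
def hamK (θ : Fin 5 → ℂ) (l m t : ℂ) : ℂ :=
  1 / (t * (t - 1)) *
    (l * (l - 1) * (l - t) * m ^ 2 + θ 0 * (θ 0 + θ 4) * (l - t)
      - (θ 1 * (l - 1) * (l - t) + θ 2 * l * (l - t) + (θ 3 - 1) * l * (l - 1)) * m)

/-- The value of `μ` determined by the first Hamiltonian equation `dλ/dt = ∂K/∂μ` from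
`λ = l` and `dλ/dt = dl` (see `hasDerivAt_hamK`). -/
def muOf (θ : Fin 5 → ℂ) (l dl t : ℂ) : ℂ :=
  (t * (t - 1) * dl
      + (θ 1 * (l - 1) * (l - t) + θ 2 * l * (l - t) + (θ 3 - 1) * l * (l - 1)))
    / (2 * l * (l - 1) * (l - t))

theorem hasDerivAt_hamK (θ : Fin 5 → ℂ) (l dl t : ℂ) (ht0 : t ≠ 0) (ht1 : t ≠ 1)
    (hl0 : l ≠ 0) (hl1 : l ≠ 1) (hlt : l ≠ t) :
    HasDerivAt (fun m => hamK θ l m t) dl (muOf θ l dl t) := by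
  have h1 : t - 1 ≠ 0 := sub_ne_zero.mpr ht1
  have h2 : l - 1 ≠ 0 := sub_ne_zero.mpr hl1
  have h3 : l - t ≠ 0 := sub_ne_zero.mpr hlt
  have hx := hasDerivAt_id (muOf θ l dl t)
  have key := ((((hx.pow 2).const_mul (l * (l - 1) * (l - t))).add_const
    (θ 0 * (θ 0 + θ 4) * (l - t))).sub
    (hx.const_mul (θ 1 * (l - 1) * (l - t) + θ 2 * l * (l - t)
      + (θ 3 - 1) * l * (l - 1)))).const_mul (1 / (t * (t - 1)))
  refine key.congr_deriv ?_
  have hd : 2 * l * (l - 1) * (l - t) ≠ 0 :=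
    mul_ne_zero (mul_ne_zero (mul_ne_zero two_ne_zero hl0) h2) h3
  have hmu : muOf θ l dl t * (2 * l * (l - 1) * (l - t)) = _ := div_mul_cancel₀ _ hd
  generalize muOf θ l dl t = m at hmu
  have ht : t * (t - 1) ≠ 0 := mul_ne_zero ht0 h1
  rw [one_div, inv_mul_eq_iff_eq_mul₀ ht]
  simp only [id_eq]
  push_cast
  linear_combination hmu

/-- A parameter `θ = (θ₀, …, θ₄)` with values of `λ` and `μ` at a given point `t`. -/
structure HamState where
  θ : Fin 5 → ℂ
  l : ℂ
  m : ℂ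

/-- The Okamoto transformation `κ₀`. -/
def kappa0 (x : HamState) : HamState where
  θ := ![-x.θ 0, x.θ 1 + x.θ 0, x.θ 2 + x.θ 0, x.θ 3 + x.θ 0, x.θ 4 + x.θ 0]
  l := x.l + x.θ 0 / x.m
  m := x.m

/-- The Okamoto transformation `κ₁`. -/
def kappa1 (x : HamState) : HamState where
  θ := ![x.θ 0 + x.θ 1, -x.θ 1, x.θ 2, x.θ 3, x.θ 4]
  l := x.l
  m := x.m - x.θ 1 / x.l

/-- The Okamoto transformation `κ₂`. -/
def kappa2 (x : HamState) : HamState where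
  θ := ![x.θ 0 + x.θ 2, x.θ 1, -x.θ 2, x.θ 3, x.θ 4]
  l := x.l
  m := x.m - x.θ 2 / (x.l - 1)

/-- The Okamoto transformation `κ₃`. -/
def kappa3 (t : ℂ) (x : HamState) : HamState where
  θ := ![x.θ 0 + x.θ 3, x.θ 1, x.θ 2, -x.θ 3, x.θ 4]
  l := x.l
  m := x.m - x.θ 3 / (x.l - t)

/-- The Okamoto transformation `κ₄`. -/
def kappa4 (x : HamState) : HamState where
  θ := ![x.θ 0 + x.θ 4, x.θ 1, x.θ 2, x.θ 3, -x.θ 4]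
  l := x.l
  m := x.m

/-- `κ₅ = κ₀ (κ₃ κ₂ κ₁ κ₀)² κ₄`, which maps parameters `θ` to
`(θ₀ - 1, θ₁, θ₂, θ₃, θ₄ + 2)`. -/
def kappa5 (t : ℂ) : HamState → HamState :=
  kappa0 ∘ (kappa3 t ∘ kappa2 ∘ kappa1 ∘ kappa0)^[2] ∘ kappa4

/-- The parameter `θ⁰ = (-1/2, 1/2, 1/2, 1/2, 1/2)`, which belongs to
PVI(1/8, -1/8, 1/8, 3/8). -/
def theta0 : Fin 5 → ℂ := ![-(1 / 2), 1 / 2, 1 / 2, 1 / 2, 1 / 2]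

/-- `t(τ) = (e₃(τ) - e₁(τ)) / (e₂(τ) - e₁(τ))`. -/
def tOf (τ : ℂ) : ℂ := (e 3 τ - e 1 τ) / (e 2 τ - e 1 τ)

/-- Hitchin's `λ^{(0)}_{r,s}(t(τ)) = (℘(p^{(0)}_{r,s}(τ)|τ) - e₁(τ)) / (e₂(τ) - e₁(τ))`, where
`℘(p^{(0)}_{r,s}(τ)|τ) = ℘(r+sτ|τ) + ℘'(r+sτ|τ) / (2 Z_{r,s}(τ))`. -/
def lam0 (r s τ : ℂ) : ℂ :=
  (wp (r + s * τ) τ + wp' (r + s * τ) τ / (2 * Z r s τ) - e 1 τ) / (e 2 τ - e 1 τ)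

/-- `μ^{(0)}_{r,s}(t(τ))`, given by the first Hamiltonian equation; the derivative
`dλ^{(0)}/dt` is expressed through the variable `τ` by the chain rule. -/
def mu0 (r s τ : ℂ) : ℂ :=
  muOf theta0 (lam0 r s τ) (deriv (lam0 r s) τ / deriv tOf τ) (tOf τ)

/-- `λ^{(2)}_{r,s}(t(τ)) = κ₅(λ^{(0)}_{r,s})(t(τ))`. -/
def lam2 (r s τ : ℂ) : ℂ :=
  (kappa5 (tOf τ) ⟨theta0, lam0 r s τ, mu0 r s τ⟩).l

/-- The function `e₁ + (e₂ - e₁) λ^{(2)}_{r,s}(t(τ))`, which is `℘(p^{(2)}_{r,s}(τ)|τ)`. -/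
def wpP2 (r s τ : ℂ) : ℂ := e 1 τ + (e 2 τ - e 1 τ) * lam2 r s τ

/-! ### The elliptic form of Painlevé VI -/

/-- `p` is a holomorphic function on the open subset `U` of the upper half plane, avoiding the
points of `E_τ[2] = {z | 2z ∈ Λ_τ}`, such that `℘(p(τ)|τ) = F(τ)` on `U` as meromorphic
functions, that is, outside a discrete relatively closed subset of `U`. -/
structure IsWpLift (F : ℂ → ℂ) (U : Set ℂ) (p : ℂ → ℂ) : Prop where
  isOpen : IsOpen U
  subset : U ⊆ {τ | 0 < τ.im}
  holo : DifferentiableOn ℂ p U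
  avoid : ∀ τ ∈ U, 2 * p τ ∉ (per τ).lattice
  wp_eq : ∀ᶠ τ in codiscreteWithin U, wp (p τ) τ = F τ

/-- `p` is one of the functions denoted `p^{(2)}_{r,s}` on `U`. -/
def IsP2 (r s : ℂ) (U : Set ℂ) (p : ℂ → ℂ) : Prop := IsWpLift (wpP2 r s) U p

/-- `p` solves EPVI(α₀, α₁, α₂, α₃) on the open set `U` (the right-hand side being finite there):
`p''(τ) = -1/(4π²) ∑ₖ αₖ ℘'(p(τ) + ωₖ/2|τ)`. -/
def SolvesEPVI (α : Fin 4 → ℂ) (U : Set ℂ) (p : ℂ → ℂ) : Prop :=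
  DifferentiableOn ℂ p U ∧ (∀ τ ∈ U, 2 * p τ ∉ (per τ).lattice) ∧ ∀ τ ∈ U,
    deriv (deriv p) τ =
      -1 / (4 * (Real.pi : ℂ) ^ 2) * ∑ k : Fin 4, α k * wp' (p τ + halfPeriod k τ) τ

end LamePVI

end

noncomputable section

open Filter Topology
open scoped ContDiff

namespace LamePVI

/-! Write c = i/(4π) (`heatC`) and ψ(z|τ) = ζ(z|τ) - η₁(τ)z. All derivatives in τ come from one
heat-type equation, ψ_τ = c(2ψ(℘ + η₁) + ℘') (`dt_psi`): the difference of the two sides is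
elliptic, by the Legendre relation, has no poles, and is odd, so Liouville's theorem makes it zero.
Differentiating in z gives ℘_τ and ℘'_τ; differentiating the Weierstrass equation in τ gives
Ramanujan's formulas for η₁', g₂', g₃' (`ramanujan`). Along z = r + sτ one has Z = ψ + 2πis, and Z,
℘, ℘' satisfy a closed differential system.

In the coordinates W = e₁ + (e₂ - e₁)λ and M = μ/(e₂ - e₁), with θ₁ = θ₂ = θ₃ = θ, Painlevé VI
depends on the lattice only through η₁, g₂, g₃ (`SolvesHam`). Picard's pair W = ℘, M = Z/℘' solves
it with θ = 0 (`solvesHam_picard`), and κ₀ carries it to Hitchin's solution with the same M. Let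
f(W) = 4W³ - g₂W - g₃. Then κ₅ alternates the two moves M ↦ M - θ f'(W)/f(W) and W ↦ W + θ₀/M, both
of which preserve the system (`SolvesHam.kappa123`, `SolvesHam.kappa0`). Carrying them out on
rational functions of Z, ℘, ℘' produces the stated formula (`chain_first`, `chain_second`). The
divisors cannot vanish identically: at a zero of M its derivative is cρ, at a zero of f(W) the
derivative of f(W) is cθf'(W)², and these are nonzero wherever they are needed. `exists_solvesHam`
collects the outcome.

The final W has θ = 1/2 and ρ = -6. For a lift p with ℘(p) = W, the first Hamiltonian equation is a
first-order equation for p (`deriv_lift`); differentiating it and inserting the second equation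
eliminates M (`deriv_deriv_lift`). The half-period translation formulas identify what remains with
the right-hand side of EPVI (`sum_epvi`). Lifts exist because ℘ is onto and ℘' ≠ 0 off the half
periods. Identities hold first on punctured neighbourhoods and then everywhere by continuity. -/

/-! ### Series of holomorphic functions of several variables -/

/-- Cauchy estimate for the Fréchet derivative of a holomorphic function on a normed space. -/
theorem norm_fderiv_le_of_forall_mem_ball {E F : Type*} [NormedAddCommGroup E] [NormedSpace ℂ E]
    [NormedAddCommGroup F] [NormedSpace ℂ F] {f : E → F} {y : E} {r C : ℝ} (hr : 0 < r)
    (hf : DifferentiableOn ℂ f (Metric.ball y (2 * r)))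
    (hC : ∀ x ∈ Metric.ball y (2 * r), ‖f x‖ ≤ C) : ‖fderiv ℂ f y‖ ≤ C / r := by
  have hC0 : 0 ≤ C := (norm_nonneg _).trans (hC y (by simp [hr]))
  refine ContinuousLinearMap.opNorm_le_bound _ (by positivity) fun v => ?_
  rcases eq_or_ne v 0 with rfl | hv
  · simp
  have hv' : 0 < ‖v‖ := norm_pos_iff.mpr hv
  -- The estimate is the one-variable Cauchy inequality on the complex line through y in direction
  -- v. The radius r/‖v‖ keeps the closed disc strictly inside the ball of radius 2r.
  have hline : ∀ t : ℂ, ‖t‖ ≤ r / ‖v‖ → y + t • v ∈ Metric.ball y (2 * r) := by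
    intro t ht
    rw [le_div_iff₀ hv'] at ht
    simp only [Metric.mem_ball, dist_self_add_left, norm_smul]
    linarith
  have hfd : ∀ x ∈ Metric.ball y (2 * r), HasFDerivAt f (fderiv ℂ f x) x := fun x hx =>
    (hf.differentiableAt (Metric.isOpen_ball.mem_nhds hx)).hasFDerivAt
  have hlin : ∀ t : ℂ, HasDerivAt (fun t : ℂ => y + t • v) v t := fun t => by
    simpa using ((hasDerivAt_id t).smul_const v).const_add y
  have hg : ∀ t : ℂ, ‖t‖ ≤ r / ‖v‖ →
      HasDerivAt (fun t : ℂ => f (y + t • v)) (fderiv ℂ f (y + t • v) v) t := fun t ht =>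
    (hfd _ (hline t ht)).comp_hasDerivAt t (hlin t)
  have h0 : ‖(0 : ℂ)‖ ≤ r / ‖v‖ := by rw [norm_zero]; positivity
  have hd : DiffContOnCl ℂ (fun t : ℂ => f (y + t • v)) (Metric.ball 0 (r / ‖v‖)) := by
    refine DifferentiableOn.diffContOnCl fun t ht => ?_
    have ht' : ‖t‖ ≤ r / ‖v‖ := by
      simpa using Metric.closure_ball_subset_closedBall ht
    exact (hg t ht').differentiableAt.differentiableWithinAt
  have key := Complex.norm_deriv_le_of_forall_mem_sphere_norm_le (C := C) (by positivity) hd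
    (fun t ht => hC _ (hline t (by simpa using (mem_sphere_iff_norm.mp ht).le)))
  rw [(hg 0 h0).deriv] at key
  simp only [zero_smul, add_zero] at key
  calc _ ≤ C / (r / ‖v‖) := key
    _ = C / r * ‖v‖ := by field_simp

/-- A family of functions is locally bounded by summable families on `V`. -/
def LocallySummablyBounded {ι E F : Type*} [TopologicalSpace E] [NormedAddCommGroup F]
    (f : ι → E → F) (V : Set E) : Prop :=
  ∀ x ∈ V, ∃ u : ι → ℝ, Summable u ∧ ∀ᶠ y in 𝓝 x, ∀ i, ‖f i y‖ ≤ u i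

/-- By Cauchy's estimate on balls of radius R/2 about points of the half-size ball, the derivatives
are bounded by 4u/R. The single majorant u(1 + 4/R) therefore serves both the functions and their
derivatives. -/
theorem LocallySummablyBounded.exists_ball {ι E F : Type*} [NormedAddCommGroup E]
    [NormedSpace ℂ E] [NormedAddCommGroup F] [NormedSpace ℂ F] {f : ι → E → F} {V : Set E}
    (hV : IsOpen V) (hb : LocallySummablyBounded f V) (hf : ∀ i, DifferentiableOn ℂ (f i) V)
    {x : E} (hx : x ∈ V) :
    ∃ u : ι → ℝ, ∃ r > 0, Summable u ∧ Metric.ball x r ⊆ V ∧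
      (∀ y ∈ Metric.ball x r, ∀ i, ‖f i y‖ ≤ u i) ∧
      ∀ y ∈ Metric.ball x r, ∀ i, ‖fderiv ℂ (f i) y‖ ≤ u i := by
  obtain ⟨u, hu, hev⟩ := hb x hx
  obtain ⟨R, hR, hball⟩ := Metric.eventually_nhds_iff_ball.mp (hev.and (hV.mem_nhds hx))
  have hu0 : ∀ i, 0 ≤ u i := fun i =>
    (norm_nonneg _).trans ((hball x (by simp [hR])).1 i)
  refine ⟨fun i => u i * (1 + 4 / R), R / 2, by positivity, hu.mul_right _, ?_, ?_, ?_⟩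
  · exact fun y hy => (hball y (Metric.ball_subset_ball (by linarith) hy)).2
  · intro y hy i
    refine ((hball y (Metric.ball_subset_ball (by linarith) hy)).1 i).trans ?_
    have : 0 ≤ u i * (4 / R) := mul_nonneg (hu0 i) (by positivity)
    linarith [mul_add (u i) 1 (4 / R)]
  · intro y hy i
    have hsub : Metric.ball y (2 * (R / 4)) ⊆ Metric.ball x R := by
      refine Metric.ball_subset_ball' ?_
      have := Metric.mem_ball.mp hy
      linarith
    have := norm_fderiv_le_of_forall_mem_ball (C := u i) (by positivity : 0 < R / 4)
      ((hf i).mono fun z hz => (hball z (hsub hz)).2) fun z hz => (hball z (hsub hz)).1 i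
    refine this.trans ?_
    have h2 : u i / (R / 4) = u i * (4 / R) := by field_simp
    rw [h2]
    linarith [mul_add (u i) 1 (4 / R), hu0 i]

theorem LocallySummablyBounded.hasFDerivAt_tsum {ι E F : Type*} [NormedAddCommGroup E]
    [NormedSpace ℂ E] [NormedAddCommGroup F] [NormedSpace ℂ F] [CompleteSpace F]
    {f : ι → E → F} {V : Set E}
    (hV : IsOpen V) (hb : LocallySummablyBounded f V) (hf : ∀ i, DifferentiableOn ℂ (f i) V)
    {x : E} (hx : x ∈ V) :
    HasFDerivAt (fun y => ∑' i, f i y) (∑' i, fderiv ℂ (f i) x) x := by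
  obtain ⟨u, r, hr, hu, hsub, h1, h2⟩ := hb.exists_ball hV hf hx
  have hxb : x ∈ Metric.ball x r := by simp [hr]
  let _ : NormedSpace ℝ E := NormedSpace.restrictScalars ℝ ℂ E
  refine hasFDerivAt_tsum_of_isPreconnected hu Metric.isOpen_ball
    (convex_ball x r).isPreconnected (fun i y hy => ?_) (fun i y hy => h2 y hy i) hxb
    (Summable.of_norm_bounded hu fun i => h1 x hxb i) hxb
  exact ((hf i).differentiableAt (hV.mem_nhds (hsub hy))).hasFDerivAt

/-- A series of smooth holomorphic functions that converges locally normally is smooth. -/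
theorem LocallySummablyBounded.contDiffOn_tsum {ι : Type*} {E : Type} [NormedAddCommGroup E]
    [NormedSpace ℂ E] {V : Set E} (hV : IsOpen V) (n : ℕ) :
    ∀ {F : Type} [NormedAddCommGroup F] [NormedSpace ℂ F] [CompleteSpace F] {f : ι → E → F},
      LocallySummablyBounded f V → (∀ i, ContDiffOn ℂ (⊤ : ℕ∞) (f i) V) →
      ContDiffOn ℂ n (fun y => ∑' i, f i y) V := by
  induction n with
  | zero =>
    intro F _ _ _ f hb hf
    have hd : ∀ i, DifferentiableOn ℂ (f i) V := fun i => (hf i).differentiableOn (by simp)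
    rw [Nat.cast_zero, contDiffOn_zero]
    exact fun x hx => (hb.hasFDerivAt_tsum hV hd hx).continuousAt.continuousWithinAt
  | succ n ih =>
    intro F _ _ _ f hb hf
    have hd : ∀ i, DifferentiableOn ℂ (f i) V := fun i => (hf i).differentiableOn (by simp)
    -- The differentiated series satisfies the same hypothesis with values in E →L[ℂ] F, so the
    -- induction must quantify over the target space.
    have hb' : LocallySummablyBounded (fun i => fderiv ℂ (f i)) V := by
      intro x hx
      obtain ⟨u, r, hr, hu, -, -, h2⟩ := hb.exists_ball hV hd hx
      exact ⟨u, hu, Filter.eventually_of_mem (Metric.ball_mem_nhds x hr) h2⟩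
    rw [Nat.cast_succ, contDiffOn_succ_iff_fderiv_of_isOpen hV]
    refine ⟨fun x hx => (hb.hasFDerivAt_tsum hV hd hx).differentiableAt.differentiableWithinAt,
      by simp, ?_⟩
    refine (ih hb' fun i => ?_).congr fun x hx => (hb.hasFDerivAt_tsum hV hd hx).fderiv
    exact (hf i).fderiv_of_isOpen hV (by norm_cast)

/-! ### The Weierstrass zeta function as a holomorphic function of two variables -/

/-- The lattice point `x₀ τ + x₁`. -/
def latPt (x : Fin 2 → ℤ) (τ : ℂ) : ℂ := x 0 * τ + x 1

theorem per_omega1 (τ : ℂ) : (per τ).ω₁ = 1 := rfl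

theorem per_omega2 {τ : ℂ} (hτ : 0 < τ.im) : (per τ).ω₂ = τ := by
  simp [per, UpperHalfPlane.ofComplex_apply_of_im_pos hτ]

theorem mem_lattice_iff {τ z : ℂ} (hτ : 0 < τ.im) :
    z ∈ (per τ).lattice ↔ ∃ m n : ℤ, (m : ℂ) + n * τ = z := by
  simp [PeriodPair.mem_lattice, per_omega1, per_omega2 hτ]

/-- The parametrization of the lattice by pairs of integers. -/
def latEquiv (τ : ℂ) : (Fin 2 → ℤ) ≃ (per τ).lattice :=
  ((finTwoArrowEquiv ℤ).trans (Equiv.prodComm ℤ ℤ)).trans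
    (per τ).latticeEquivProd.symm.toEquiv

theorem coe_latEquiv {τ : ℂ} (hτ : 0 < τ.im) (x : Fin 2 → ℤ) :
    ((latEquiv τ x : (per τ).lattice) : ℂ) = latPt x τ := by
  have := (per τ).latticeEquiv_symm_apply (x 1, x 0)
  simp only [per_omega1, per_omega2 hτ] at this
  simp only [latPt]
  rw [add_comm, ← mul_one (x 1 : ℂ)]
  exact this

theorem latPt_mem {τ : ℂ} (hτ : 0 < τ.im) (x : Fin 2 → ℤ) : latPt x τ ∈ (per τ).lattice :=
  (mem_lattice_iff hτ).mpr ⟨x 1, x 0, add_comm _ _⟩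

theorem mem_lattice_iff_latPt {τ z : ℂ} (hτ : 0 < τ.im) :
    z ∈ (per τ).lattice ↔ ∃ x, latPt x τ = z := by
  refine ⟨fun h => ?_, fun ⟨x, hx⟩ => hx ▸ latPt_mem hτ x⟩
  obtain ⟨m, n, rfl⟩ := (mem_lattice_iff hτ).mp h
  exact ⟨![n, m], by simp [latPt, add_comm]⟩

theorem latPt_zero (τ : ℂ) : latPt 0 τ = 0 := by simp [latPt]

theorem latPt_eq_zero_iff {τ : ℂ} (hτ : 0 < τ.im) {x : Fin 2 → ℤ} : latPt x τ = 0 ↔ x = 0 := by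
  refine ⟨fun h => ?_, fun h => h ▸ latPt_zero τ⟩
  rw [← coe_latEquiv hτ] at h
  have h0 : ((latEquiv τ 0 : (per τ).lattice) : ℂ) = 0 := by rw [coe_latEquiv hτ, latPt_zero]
  exact (latEquiv τ).injective (Subtype.ext (h.trans h0.symm))

/-- The pairs `(z, τ)` for which `z` is not a nonzero lattice point. -/
def nearDomain : Set (ℂ × ℂ) := {p | 0 < p.2.im ∧ ∀ x : Fin 2 → ℤ, x ≠ 0 → p.1 ≠ latPt x p.2}

/-- The pairs `(z, τ)` for which `z` is not a lattice point. -/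
def wpDomain : Set (ℂ × ℂ) := {p | 0 < p.2.im ∧ p.1 ∉ (per p.2).lattice}

theorem wpDomain_eq : wpDomain = nearDomain ∩ {p | p.1 ≠ 0} := by
  ext ⟨z, τ⟩
  simp only [wpDomain, nearDomain, Set.mem_ofPred_eq, Set.mem_inter_iff, and_assoc]
  refine and_congr_right fun hτ => ?_
  rw [mem_lattice_iff_latPt hτ]
  constructor
  · exact fun h => ⟨fun x _ hx => h ⟨x, hx.symm⟩, fun h0 => h ⟨0, by rw [latPt_zero, h0]⟩⟩
  · rintro ⟨h1, h0⟩ ⟨x, hx⟩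
    rcases eq_or_ne x 0 with rfl | hx0
    · exact h0 (by rw [← hx, latPt_zero])
    · exact h1 x hx0 hx.symm

theorem wpDomain_subset : wpDomain ⊆ nearDomain := by
  rw [wpDomain_eq]; exact Set.inter_subset_left

theorem zero_mem_nearDomain {τ : ℂ} (hτ : 0 < τ.im) : ((0 : ℂ), τ) ∈ nearDomain :=
  ⟨hτ, fun _ hx h => hx ((latPt_eq_zero_iff hτ).mp h.symm)⟩

/-- The Eisenstein series bound controls lattice points uniformly for τ in a vertical strip. Lattice
points with ‖x‖ > 2R/κ are more than twice as large as z; the finitely many others stay away from z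
by continuity. This drives the convergence of the zeta series jointly in (z, τ). -/
theorem eventually_lower_bound {p : ℂ × ℂ} (hp : p ∈ nearDomain) :
    ∃ δ > 0, ∀ᶠ q in 𝓝 p, 0 < q.2.im ∧ ∀ x : Fin 2 → ℤ, x ≠ 0 →
      δ * ‖x‖ ≤ ‖latPt x q.2‖ ∧ δ * ‖x‖ ≤ ‖q.1 - latPt x q.2‖ := by
  obtain ⟨z₀, τ₀⟩ := p
  obtain ⟨hτ₀, hz₀⟩ := hp
  simp only at hτ₀ hz₀
  have hB : 0 < τ₀.im / 2 := by positivity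
  set κ := EisensteinSeries.r ⟨⟨|τ₀.re| + 1, τ₀.im / 2⟩, hB⟩ with hκ
  have hκ0 : 0 < κ := EisensteinSeries.r_pos _
  have hlow : ∀ᶠ q : ℂ × ℂ in 𝓝 (z₀, τ₀), 0 < q.2.im ∧ ∀ x : Fin 2 → ℤ, x ≠ 0 →
      κ * ‖x‖ ≤ ‖latPt x q.2‖ := by
    have h1 : ∀ᶠ q : ℂ × ℂ in 𝓝 (z₀, τ₀), |q.2.re| < |τ₀.re| + 1 :=
      (by fun_prop : Continuous fun q : ℂ × ℂ => |q.2.re|).continuousAt.eventually_lt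
        continuousAt_const (by simp)
    have h2 : ∀ᶠ q : ℂ × ℂ in 𝓝 (z₀, τ₀), τ₀.im / 2 < q.2.im :=
      continuousAt_const.eventually_lt
        (by fun_prop : Continuous fun q : ℂ × ℂ => q.2.im).continuousAt (by simp [hτ₀])
    filter_upwards [h1, h2] with q hq1 hq2
    have hq : 0 < q.2.im := hB.trans hq2
    refine ⟨hq, fun x hx => ?_⟩
    have := EisensteinSeries.r_mul_max_le (⟨q.2, hq⟩ : UpperHalfPlane) hx
    refine le_trans ?_ this
    gcongr
    exact EisensteinSeries.r_lower_bound_on_verticalStrip _ hB ⟨hq1.le, hq2.le⟩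
  have hR : ∀ᶠ q : ℂ × ℂ in 𝓝 (z₀, τ₀), ‖q.1‖ < ‖z₀‖ + 1 :=
    (by fun_prop : Continuous fun q : ℂ × ℂ => ‖q.1‖).continuousAt.eventually_lt
      continuousAt_const (by simp)
  set R := ‖z₀‖ + 1 with hRdef
  have hfin : {x : Fin 2 → ℤ | ‖x‖ ≤ 2 * R / κ}.Finite := by
    have := (isCompact_closedBall (0 : Fin 2 → ℤ) (2 * R / κ)).finite_of_discrete
    refine this.subset fun x hx => ?_
    simpa using hx
  have hδ : ∀ᶠ δ : ℝ in 𝓝[>] 0, ∀ x ∈ {x : Fin 2 → ℤ | ‖x‖ ≤ 2 * R / κ}, x ≠ 0 →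
      δ * ‖x‖ < ‖z₀ - latPt x τ₀‖ := by
    rw [Filter.eventually_all_finite hfin]
    intro x _
    by_cases hx : x = 0
    · simp [hx]
    have h0 : (0 : ℝ) * ‖x‖ < ‖z₀ - latPt x τ₀‖ := by
      rw [zero_mul, norm_pos_iff]; exact sub_ne_zero.mpr (hz₀ x hx)
    have hc : ContinuousAt (fun δ : ℝ => δ * ‖x‖) 0 := by fun_prop
    filter_upwards [nhdsWithin_le_nhds (hc.eventually_lt continuousAt_const h0)] with δ hδ _
    exact hδ
  obtain ⟨δ, hδ, hδ0⟩ := (hδ.and self_mem_nhdsWithin).exists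
  have hδ0 : 0 < δ := hδ0
  have hnear : ∀ᶠ q : ℂ × ℂ in 𝓝 (z₀, τ₀), ∀ x ∈ {x : Fin 2 → ℤ | ‖x‖ ≤ 2 * R / κ}, x ≠ 0 →
      δ * ‖x‖ < ‖q.1 - latPt x q.2‖ := by
    rw [Filter.eventually_all_finite hfin]
    intro x hx
    by_cases hx0 : x = 0
    · simp [hx0]
    have hc : ContinuousAt (fun q : ℂ × ℂ => ‖q.1 - latPt x q.2‖) (z₀, τ₀) := by
      unfold latPt; fun_prop
    filter_upwards [continuousAt_const.eventually_lt hc (hδ x hx hx0)] with q hq _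
    exact hq
  refine ⟨min δ (κ / 2), by positivity, ?_⟩
  filter_upwards [hlow, hR, hnear] with q hq1 hq2 hq3
  refine ⟨hq1.1, fun x hx => ⟨?_, ?_⟩⟩
  · refine le_trans ?_ (hq1.2 x hx)
    have : min δ (κ / 2) ≤ κ := (min_le_right _ _).trans (by linarith)
    gcongr
  · by_cases hxR : ‖x‖ ≤ 2 * R / κ
    · refine le_trans ?_ (hq3 x hxR hx).le
      gcongr
      exact min_le_left _ _
    · have h1 : min δ (κ / 2) * ‖x‖ ≤ κ / 2 * ‖x‖ := by
        gcongr; exact min_le_right _ _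
      have h2 := hq1.2 x hx
      have h3 : ‖latPt x q.2‖ - ‖q.1‖ ≤ ‖q.1 - latPt x q.2‖ := by
        rw [norm_sub_rev]; exact norm_sub_norm_le _ _
      have h4 : 2 * R < ‖x‖ * κ := (div_lt_iff₀ hκ0).mp (not_le.mp hxR)
      linarith

theorem isOpen_nearDomain : IsOpen nearDomain := by
  rw [isOpen_iff_mem_nhds]
  intro p hp
  obtain ⟨δ, hδ, hev⟩ := eventually_lower_bound hp
  filter_upwards [hev] with q hq
  refine ⟨hq.1, fun x hx h => ?_⟩
  have := (hq.2 x hx).2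
  rw [h, sub_self, norm_zero] at this
  have : 0 < δ * ‖x‖ := mul_pos hδ (norm_pos_iff.mpr hx)
  linarith

theorem isOpen_wpDomain : IsOpen wpDomain := by
  rw [wpDomain_eq]
  exact isOpen_nearDomain.inter (isOpen_ne_fun continuous_fst continuous_const)

/-- The terms of the series `ζ(z|τ) - 1/z`. -/
def zetaTerm (x : Fin 2 → ℤ) (p : ℂ × ℂ) : ℂ :=
  p.1 ^ 2 / (latPt x p.2 ^ 2 * (p.1 - latPt x p.2))

/-- The function `ζ(z|τ) - 1/z`, which is holomorphic at `z = 0`. -/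
def zetaReg (p : ℂ × ℂ) : ℂ := ∑' x : Fin 2 → ℤ, zetaTerm x p

/-- The lattice point 0 gives a division by zero, so its term is 0: the pole 1/z is automatically
left out of `zetaReg`. -/
theorem zetaTerm_zero : zetaTerm 0 = 0 := by
  ext p; simp [zetaTerm, latPt_zero]

theorem zetaTerm_eq {x : Fin 2 → ℤ} {p : ℂ × ℂ} (h0 : latPt x p.2 ≠ 0)
    (h1 : p.1 ≠ latPt x p.2) :
    zetaTerm x p = 1 / (p.1 - latPt x p.2) + 1 / latPt x p.2 + p.1 / latPt x p.2 ^ 2 := by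
  have : p.1 - latPt x p.2 ≠ 0 := sub_ne_zero.mpr h1
  rw [zetaTerm]
  field_simp
  ring

theorem contDiffOn_zetaTerm (x : Fin 2 → ℤ) : ContDiffOn ℂ ∞ (zetaTerm x) nearDomain := by
  rcases eq_or_ne x 0 with rfl | hx
  · rw [zetaTerm_zero]; exact contDiffOn_const
  · intro p hp
    have h0 : latPt x p.2 ≠ 0 := fun h => hx ((latPt_eq_zero_iff hp.1).mp h)
    have h1 : p.1 - latPt x p.2 ≠ 0 := sub_ne_zero.mpr (hp.2 x hx)
    refine ContDiffWithinAt.div (by fun_prop) ?_ (mul_ne_zero (pow_ne_zero 2 h0) h1)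
    unfold latPt
    fun_prop

/-- In the combined fraction the denominator has three factors of size at least δ‖x‖, and the
exponent 3 exceeds the lattice rank 2. -/
theorem locallySummablyBounded_zetaTerm : LocallySummablyBounded zetaTerm nearDomain := by
  intro p hp
  obtain ⟨δ, hδ, hev⟩ := eventually_lower_bound hp
  have hR : ∀ᶠ q : ℂ × ℂ in 𝓝 p, ‖q.1‖ < ‖p.1‖ + 1 :=
    (by fun_prop : Continuous fun q : ℂ × ℂ => ‖q.1‖).continuousAt.eventually_lt
      continuousAt_const (by simp)
  refine ⟨fun x => (‖p.1‖ + 1) ^ 2 / δ ^ 3 * ‖x‖ ^ (-(3 : ℝ)),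
    (EisensteinSeries.summable_one_div_norm_rpow (by norm_num)).mul_left _, ?_⟩
  filter_upwards [hev, hR] with q hq hqR x
  rcases eq_or_ne x 0 with rfl | hx
  · rw [zetaTerm_zero]; simp only [Pi.zero_apply, norm_zero]; positivity
  have hx0 : 0 < ‖x‖ := norm_pos_iff.mpr hx
  obtain ⟨h1, h2⟩ := hq.2 x hx
  rw [zetaTerm, norm_div, norm_mul, norm_pow, norm_pow, Real.rpow_neg hx0.le]
  have h3 : (‖p.1‖ + 1) ^ 2 / δ ^ 3 * (‖x‖ ^ (3 : ℝ))⁻¹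
      = (‖p.1‖ + 1) ^ 2 / ((δ * ‖x‖) ^ 2 * (δ * ‖x‖)) := by
    rw [show (3 : ℝ) = ((3 : ℕ) : ℝ) by norm_num, Real.rpow_natCast]
    field_simp
  rw [h3]
  gcongr

theorem contDiffOn_zetaReg : ContDiffOn ℂ ∞ zetaReg nearDomain := by
  rw [contDiffOn_infty]
  exact fun n => locallySummablyBounded_zetaTerm.contDiffOn_tsum isOpen_nearDomain n
    contDiffOn_zetaTerm

theorem summable_zetaTerm {p : ℂ × ℂ} (hp : p ∈ nearDomain) : Summable fun x => zetaTerm x p := by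
  obtain ⟨u, hu, h⟩ := locallySummablyBounded_zetaTerm p hp
  exact Summable.of_norm_bounded hu h.self_of_nhds

theorem zeta_eq {z τ : ℂ} (hp : (z, τ) ∈ nearDomain) : zeta z τ = 1 / z + zetaReg (z, τ) := by
  rw [zeta, ← (latEquiv τ).tsum_eq, zetaReg]
  have hterm : ∀ x : Fin 2 → ℤ,
      1 / (z - (latEquiv τ x : ℂ)) + 1 / (latEquiv τ x : ℂ) + z / (latEquiv τ x : ℂ) ^ 2
        = (if x = 0 then 1 / z else 0) + zetaTerm x (z, τ) := by
    intro x
    rw [coe_latEquiv hp.1]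
    rcases eq_or_ne x 0 with rfl | hx
    · simp [latPt_zero, zetaTerm_zero]
    · rw [zetaTerm_eq (fun h => hx ((latPt_eq_zero_iff hp.1).mp h)) (hp.2 x hx)]
      simp [hx]
  simp_rw [hterm]
  rw [Summable.tsum_add (hasSum_ite_eq (0 : Fin 2 → ℤ) (1 / z)).summable (summable_zetaTerm hp),
    tsum_ite_eq]

theorem HasFDerivAt.hasDerivAt_slice {F : ℂ × ℂ → ℂ} {L : ℂ × ℂ →L[ℂ] ℂ} {z τ : ℂ}
    (h : HasFDerivAt F L (z, τ)) : HasDerivAt (fun w => F (w, τ)) (L (1, 0)) z :=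
  h.comp_hasDerivAt z ((hasDerivAt_id z).prodMk (hasDerivAt_const z τ))

theorem fderiv_zetaTerm {x : Fin 2 → ℤ} (hx : x ≠ 0) {z τ : ℂ} (hp : (z, τ) ∈ nearDomain) :
    fderiv ℂ (zetaTerm x) (z, τ) (1, 0) = -(1 / (z - latPt x τ) ^ 2 - 1 / latPt x τ ^ 2) := by
  have h0 : latPt x τ ≠ 0 := fun h => hx ((latPt_eq_zero_iff hp.1).mp h)
  have h1 : z - latPt x τ ≠ 0 := sub_ne_zero.mpr (hp.2 x hx)
  have hA := HasFDerivAt.hasDerivAt_slice (((contDiffOn_zetaTerm x).differentiableOn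
    (by simp)).differentiableAt (isOpen_nearDomain.mem_nhds hp)).hasFDerivAt
  have hB : HasDerivAt (fun w : ℂ => (w - latPt x τ)⁻¹ + 1 / latPt x τ + w / latPt x τ ^ 2)
      (-1 / (z - latPt x τ) ^ 2 + 1 / latPt x τ ^ 2) z :=
    ((((hasDerivAt_id z).sub_const (latPt x τ)).fun_inv h1).add_const
      (1 / latPt x τ)).add ((hasDerivAt_id z).div_const (latPt x τ ^ 2))
  have hAB : (fun w : ℂ => zetaTerm x (w, τ)) =ᶠ[𝓝 z]
      fun w : ℂ => (w - latPt x τ)⁻¹ + 1 / latPt x τ + w / latPt x τ ^ 2 := by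
    have hcont : ContinuousAt (fun w : ℂ => (w, τ)) z := by fun_prop
    filter_upwards [hcont.eventually (isOpen_nearDomain.mem_nhds hp)] with w hw
    rw [zetaTerm_eq h0 (hw.2 x hx), one_div (w - _)]
  rw [hA.unique (hB.congr_of_eventuallyEq hAB)]
  ring

theorem hasDerivAt_zeta {z τ : ℂ} (hp : (z, τ) ∈ wpDomain) :
    HasDerivAt (fun w => zeta w τ) (-wp z τ) z := by
  have hτ := hp.1
  have hp0 := wpDomain_subset hp
  have hz0 : z ≠ 0 := by rw [wpDomain_eq] at hp; exact hp.2
  have hd : ∀ x, DifferentiableOn ℂ (zetaTerm x) nearDomain := fun x =>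
    (contDiffOn_zetaTerm x).differentiableOn (by simp)
  obtain ⟨u, r, hr, hu, -, -, h2⟩ :=
    locallySummablyBounded_zetaTerm.exists_ball isOpen_nearDomain hd hp0
  have hsum : Summable fun x => fderiv ℂ (zetaTerm x) (z, τ) :=
    Summable.of_norm_bounded hu fun x => h2 _ (by simp [hr]) x
  have hreg : HasDerivAt (fun w => zetaReg (w, τ)) _ z :=
    HasFDerivAt.hasDerivAt_slice
      (locallySummablyBounded_zetaTerm.hasFDerivAt_tsum isOpen_nearDomain hd hp0)
  -- The series of ℘ has the summand 1/z² - 1/0² = 1/z² at the lattice point 0, while `zetaTerm 0`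
  -- vanishes; the conditional term compensates.
  have hterm : ∀ x : Fin 2 → ℤ, fderiv ℂ (zetaTerm x) (z, τ) (1, 0)
      = (if x = 0 then 1 / z ^ 2 else 0)
        - (1 / (z - (latEquiv τ x : ℂ)) ^ 2 - 1 / (latEquiv τ x : ℂ) ^ 2) := by
    intro x
    rw [coe_latEquiv hτ]
    rcases eq_or_ne x 0 with rfl | hx
    · rw [zetaTerm_zero]; simp [latPt_zero]
    rw [fderiv_zetaTerm hx hp0, if_neg hx, zero_sub]
  have hval : (∑' x, fderiv ℂ (zetaTerm x) (z, τ)) (1, 0) = 1 / z ^ 2 - wp z τ := by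
    have h3 := hsum.hasSum.mapL (ContinuousLinearMap.apply ℂ ℂ ((1 : ℂ), (0 : ℂ)))
    simp only [ContinuousLinearMap.apply_apply, hterm] at h3
    have h4 := (hasSum_ite_eq (0 : Fin 2 → ℤ) (1 / z ^ 2)).sub
      ((latEquiv τ).hasSum_iff.mpr ((per τ).hasSum_weierstrassP z))
    exact h3.unique h4
  rw [hval] at hreg
  have hinv := (hasDerivAt_inv hz0).add hreg
  refine (hinv.congr_deriv (by ring)).congr_of_eventuallyEq ?_
  have hcont : ContinuousAt (fun w : ℂ => (w, τ)) z := by fun_prop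
  filter_upwards [hcont.eventually (isOpen_nearDomain.mem_nhds hp0)] with w hw
  simp only [Pi.add_apply, ← one_div]
  exact zeta_eq hw

theorem contDiffOn_zeta : ContDiffOn ℂ ∞ (fun p : ℂ × ℂ => zeta p.1 p.2) wpDomain := by
  have : ContDiffOn ℂ ∞ (fun p : ℂ × ℂ => 1 / p.1 + zetaReg p) wpDomain := by
    refine ContDiffOn.add ?_ (contDiffOn_zetaReg.mono wpDomain_subset)
    refine contDiffOn_const.div contDiffOn_fst fun p hp => ?_
    rw [wpDomain_eq] at hp
    exact hp.2
  exact this.congr fun p hp => zeta_eq (wpDomain_subset hp)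

/-- A z-derivative is the Fréchet derivative evaluated at (1, 0). This passes joint smoothness from
ζ to ℘ and then to ℘'. -/
theorem contDiffOn_slice_deriv {F G : ℂ × ℂ → ℂ} (hF : ContDiffOn ℂ ∞ F wpDomain)
    (hG : ∀ z τ, (z, τ) ∈ wpDomain → HasDerivAt (fun w => F (w, τ)) (G (z, τ)) z) :
    ContDiffOn ℂ ∞ G wpDomain := by
  have h1 : ContDiffOn ℂ ∞ (fun p => fderiv ℂ F p (1, 0)) wpDomain :=
    (hF.fderiv_of_isOpen isOpen_wpDomain (by simp)).clm_apply contDiffOn_const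
  refine h1.congr fun p hp => ?_
  have h2 := (hF.differentiableOn (by simp)).differentiableAt (isOpen_wpDomain.mem_nhds hp)
  exact (hG p.1 p.2 hp).unique (HasFDerivAt.hasDerivAt_slice h2.hasFDerivAt)

theorem contDiffOn_wp : ContDiffOn ℂ ∞ (fun p : ℂ × ℂ => wp p.1 p.2) wpDomain := by
  have := contDiffOn_slice_deriv (G := fun p => -wp p.1 p.2) contDiffOn_zeta
    fun z τ hp => hasDerivAt_zeta hp
  exact this.neg.congr fun p _ => (neg_neg _).symm

theorem hasDerivAt_wp {z τ : ℂ} (hp : z ∉ (per τ).lattice) :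
    HasDerivAt (fun w => wp w τ) (wp' z τ) z := by
  have h := (per τ).differentiableOn_weierstrassP.differentiableAt
    ((per τ).isClosed_lattice.isOpen_compl.mem_nhds hp)
  have := h.hasDerivAt
  rwa [PeriodPair.deriv_weierstrassP] at this

theorem contDiffOn_wp' : ContDiffOn ℂ ∞ (fun p : ℂ × ℂ => wp' p.1 p.2) wpDomain :=
  contDiffOn_slice_deriv contDiffOn_wp fun _ _ hp => hasDerivAt_wp hp.2

theorem wp'_sq {z τ : ℂ} (hz : z ∉ (per τ).lattice) :
    wp' z τ ^ 2 = 4 * wp z τ ^ 3 - g2 τ * wp z τ - g3 τ :=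
  (per τ).derivWeierstrassP_sq z hz

theorem wp_neg (z τ : ℂ) : wp (-z) τ = wp z τ := (per τ).weierstrassP_neg z

theorem wp'_neg (z τ : ℂ) : wp' (-z) τ = -wp' z τ := (per τ).derivWeierstrassP_neg z

theorem wp_add {z l τ : ℂ} (hl : l ∈ (per τ).lattice) : wp (z + l) τ = wp z τ :=
  (per τ).weierstrassP_add_coe z ⟨l, hl⟩

theorem wp'_add {z l τ : ℂ} (hl : l ∈ (per τ).lattice) : wp' (z + l) τ = wp' z τ :=
  (per τ).derivWeierstrassP_add_coe z ⟨l, hl⟩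

theorem zeta_neg (z τ : ℂ) : zeta (-z) τ = -zeta z τ := by
  rw [zeta, ← (Equiv.neg (per τ).lattice).tsum_eq, zeta, ← tsum_neg]
  refine tsum_congr fun l => ?_
  simp only [Equiv.neg_apply, Submodule.coe_neg, neg_sq, div_neg]
  rw [show -z - -(l : ℂ) = -(z - l) by ring, div_neg]
  ring

theorem isPreconnected_compl_lattice (τ : ℂ) :
    IsPreconnected ((per τ).lattice : Set ℂ)ᶜ := by
  have hc : ((per τ).lattice : Set ℂ).Countable := by
    have : Countable (per τ).lattice := (latEquiv τ).symm.injective.countable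
    exact Set.to_countable _
  exact (hc.isPathConnected_compl_of_one_lt_rank (by simp)).isConnected.isPreconnected

theorem add_mem_wpDomain {z l τ : ℂ} (hp : (z, τ) ∈ wpDomain) (hl : l ∈ (per τ).lattice) :
    (z + l, τ) ∈ wpDomain :=
  ⟨hp.1, fun h => hp.2 (by simpa using sub_mem h hl)⟩

theorem neg_mem_wpDomain {z τ : ℂ} (hp : (z, τ) ∈ wpDomain) : (-z, τ) ∈ wpDomain :=
  ⟨hp.1, fun h => hp.2 (by simpa using neg_mem h)⟩

/-- The difference has derivative ℘(z) - ℘(z + l) = 0 on the connected complement of the lattice.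
Hence the quasi-periods do not depend on the base point. -/
theorem zeta_add_sub_zeta {z w l τ : ℂ} (hl : l ∈ (per τ).lattice) (hz : (z, τ) ∈ wpDomain)
    (hw : (w, τ) ∈ wpDomain) : zeta (z + l) τ - zeta z τ = zeta (w + l) τ - zeta w τ := by
  have hder : ∀ u ∈ ((per τ).lattice : Set ℂ)ᶜ,
      HasDerivAt (fun u => zeta (u + l) τ - zeta u τ) 0 u := by
    intro u hu
    have h1 := (hasDerivAt_zeta (add_mem_wpDomain (⟨hz.1, hu⟩ : (u, τ) ∈ wpDomain) hl)).comp_add_const u l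
    refine (h1.sub (hasDerivAt_zeta ⟨hz.1, hu⟩)).congr_deriv ?_
    rw [wp_add hl]; ring
  exact (per τ).isClosed_lattice.isOpen_compl.is_const_of_deriv_eq_zero
    (isPreconnected_compl_lattice τ)
    (fun u hu => (hder u hu).differentiableAt.differentiableWithinAt)
    (fun u hu => (hder u hu).deriv) hz.2 hw.2

theorem one_mem_lattice (τ : ℂ) : (1 : ℂ) ∈ (per τ).lattice := (per τ).ω₁_mem_lattice

theorem tau_mem_lattice {τ : ℂ} (hτ : 0 < τ.im) : τ ∈ (per τ).lattice := by
  have := (per τ).ω₂_mem_lattice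
  rwa [per_omega2 hτ] at this

theorem half_mem_wpDomain {τ : ℂ} (hτ : 0 < τ.im) : ((1 / 2 : ℂ), τ) ∈ wpDomain :=
  ⟨hτ, (per τ).ω₁_div_two_notMem_lattice⟩

theorem tau_half_mem_wpDomain {τ : ℂ} (hτ : 0 < τ.im) : (τ / 2, τ) ∈ wpDomain := by
  have := (per τ).ω₂_div_two_notMem_lattice
  rw [per_omega2 hτ] at this
  exact ⟨hτ, this⟩

theorem zeta_add_one {z τ : ℂ} (hz : (z, τ) ∈ wpDomain) : zeta (z + 1) τ = zeta z τ + eta1 τ := by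
  have := zeta_add_sub_zeta (one_mem_lattice τ) hz (neg_mem_wpDomain (half_mem_wpDomain hz.1))
  rw [show -(1 / 2 : ℂ) + 1 = 1 / 2 by norm_num] at this
  rw [eta1]
  linear_combination this

theorem zeta_add_tau {z τ : ℂ} (hz : (z, τ) ∈ wpDomain) : zeta (z + τ) τ = zeta z τ + eta2 τ := by
  have := zeta_add_sub_zeta (tau_mem_lattice hz.1) hz
    (neg_mem_wpDomain (tau_half_mem_wpDomain hz.1))
  rw [show -(τ / 2) + τ = τ / 2 by ring] at this
  rw [eta2]
  linear_combination this

/-! ### The Legendre relation -/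

/-- The `1`-periodic function `ζ(z|τ) - η₁(τ) z`. -/
def psi (z τ : ℂ) : ℂ := zeta z τ - eta1 τ * z

theorem psi_neg (z τ : ℂ) : psi (-z) τ = -psi z τ := by
  rw [psi, psi, zeta_neg]; ring

theorem psi_add_one {z τ : ℂ} (hz : (z, τ) ∈ wpDomain) : psi (z + 1) τ = psi z τ := by
  rw [psi, psi, zeta_add_one hz]; ring

theorem psi_add_tau' {z τ : ℂ} (hz : (z, τ) ∈ wpDomain) :
    psi (z + τ) τ = psi z τ - (eta1 τ * τ - eta2 τ) := by
  rw [psi, psi, zeta_add_tau hz]; ring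

/-- This rectangle is the contour for the Legendre relation; the origin is the only lattice point in
it. -/
theorem mem_nearDomain_of_abs_le {z τ : ℂ} (hτ : 0 < τ.im) (h1 : |z.re| ≤ 1 / 2)
    (h2 : |z.im| ≤ τ.im / 2) : (z, τ) ∈ nearDomain := by
  refine ⟨hτ, fun x hx h => hx ?_⟩
  simp only at h
  subst h
  have him : (latPt x τ).im = x 0 * τ.im := by simp [latPt]
  rw [him, abs_mul, abs_of_pos hτ] at h2
  have h3 : |(x 0 : ℝ)| < 1 := by
    by_contra! hc
    nlinarith
  have h0 : x 0 = 0 := Int.abs_lt_one_iff.mp (by exact_mod_cast h3)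
  have hre : (latPt x τ).re = x 1 := by simp [latPt, h0]
  rw [hre] at h1
  have h4 : |(x 1 : ℝ)| < 1 := by linarith
  have h5 : x 1 = 0 := Int.abs_lt_one_iff.mp (by exact_mod_cast h4)
  ext i
  fin_cases i <;> simp [h0, h5]

theorem mem_wpDomain_of_im_eq {z τ : ℂ} (hτ : 0 < τ.im) (h : z.im = τ.im / 2) :
    (z, τ) ∈ wpDomain := by
  refine ⟨hτ, fun hz => ?_⟩
  obtain ⟨x, rfl⟩ := (mem_lattice_iff_latPt hτ).mp hz
  have him : (latPt x τ).im = x 0 * τ.im := by simp [latPt]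
  rw [him] at h
  have h1 : (x 0 : ℝ) = 1 / 2 := by
    have : ((x 0 : ℝ) - 1 / 2) * τ.im = 0 := by linarith
    linarith [(mul_eq_zero.mp this).resolve_right hτ.ne']
  have h2 : (2 * x 0 : ℝ) = 1 := by linarith
  have h3 : 2 * x 0 = 1 := by exact_mod_cast h2
  omega

theorem mem_wpDomain_of_abs_le {z τ : ℂ} (hτ : 0 < τ.im) (h1 : |z.re| ≤ 1 / 2)
    (h2 : |z.im| ≤ τ.im / 2) (h0 : z ≠ 0) : (z, τ) ∈ wpDomain := by
  rw [wpDomain_eq]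
  exact ⟨mem_nearDomain_of_abs_le hτ h1 h2, h0⟩

/-- The function `ζ(z|τ) - 1/z - η₁(τ) z`. -/
def psiReg (z τ : ℂ) : ℂ := zetaReg (z, τ) - eta1 τ * z

theorem psi_eq {z τ : ℂ} (hp : (z, τ) ∈ nearDomain) : psi z τ = 1 / z + psiReg z τ := by
  rw [psi, psiReg, zeta_eq hp]; ring

theorem zetaReg_neg (z τ : ℂ) : zetaReg (-z, τ) = -zetaReg (z, τ) := by
  rw [zetaReg, ← (Equiv.neg (Fin 2 → ℤ)).tsum_eq, zetaReg, ← tsum_neg]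
  refine tsum_congr fun x => ?_
  have : latPt (-x) τ = -latPt x τ := by simp [latPt]; ring
  simp only [Equiv.neg_apply, zetaTerm, this, neg_sq]
  rw [show -z - -latPt x τ = -(z - latPt x τ) by ring, mul_neg, div_neg]

theorem psiReg_neg (z τ : ℂ) : psiReg (-z) τ = -psiReg z τ := by
  rw [psiReg, psiReg, zetaReg_neg]; ring

theorem differentiableAt_zetaReg {p : ℂ × ℂ} (hp : p ∈ nearDomain) :
    DifferentiableAt ℂ zetaReg p :=
  (contDiffOn_zetaReg.differentiableOn (by simp)).differentiableAt
    (isOpen_nearDomain.mem_nhds hp)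

theorem differentiableAt_psiReg {z τ : ℂ} (hp : (z, τ) ∈ nearDomain) :
    DifferentiableAt ℂ (fun w => psiReg w τ) z :=
  (HasFDerivAt.hasDerivAt_slice (differentiableAt_zetaReg hp).hasFDerivAt).differentiableAt.sub
    (differentiableAt_id.const_mul _)

theorem intervalIntegral_comp_neg_symm (f : ℝ → ℂ) (a : ℝ) :
    ∫ x in (-a)..a, f (-x) = ∫ x in (-a)..a, f x := by
  rw [intervalIntegral.integral_comp_neg, neg_neg]

/-- The **Legendre relation** `η₁(τ) τ - η₂(τ) = 2πi`. -/
theorem legendre {τ : ℂ} (hτ : 0 < τ.im) :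
    eta1 τ * τ - eta2 τ = 2 * Real.pi * Complex.I := by
  set h : ℝ := τ.im / 2 with hh
  have hpos : 0 < h := by positivity
  -- Removing 1/z leaves a function holomorphic on a rectangle of width 1 and height Im τ. A
  -- rectangle may replace the period parallelogram because ψ is 1-periodic.
  have hCauchy := Complex.integral_boundary_rect_eq_zero_of_differentiableOn
    (fun z => psiReg z τ) (-(1 / 2 : ℝ) - h * Complex.I) ((1 / 2 : ℝ) + h * Complex.I) (by
      intro z hz
      refine (differentiableAt_psiReg (mem_nearDomain_of_abs_le hτ ?_ ?_)).differentiableWithinAt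
      · have := hz.1
        simp only [Set.mem_preimage] at this
        rw [Set.uIcc_of_le (by simp)] at this
        simp at this
        rw [abs_le]; constructor <;> linarith [this.1, this.2]
      · have := hz.2
        simp only [Set.mem_preimage] at this
        rw [Set.uIcc_of_le (by simp; linarith)] at this
        simp at this
        rw [abs_le]; constructor <;> linarith [this.1, this.2])
  simp only [Complex.sub_re, Complex.neg_re, Complex.ofReal_re, Complex.mul_re, Complex.I_re,
    mul_zero, Complex.ofReal_im, Complex.I_im, mul_one, sub_self, sub_zero, Complex.add_re,
    add_zero, Complex.sub_im, Complex.neg_im, neg_zero, zero_sub, Complex.mul_im, zero_add,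
    Complex.add_im, smul_eq_mul] at hCauchy
  -- the bottom and left edges are opposite to the top and right edges
  have hbottom : ∫ x : ℝ in (-(1 / 2))..(1 / 2), psiReg (x + ((-h : ℝ) : ℂ) * Complex.I) τ
      = -∫ x : ℝ in (-(1 / 2))..(1 / 2), psiReg (x + h * Complex.I) τ := by
    rw [← intervalIntegral_comp_neg_symm, ← intervalIntegral.integral_neg]
    refine intervalIntegral.integral_congr fun x _ => ?_
    rw [← psiReg_neg]; congr 1; push_cast; ring
  have hleft : ∫ y : ℝ in (-h)..h, psiReg (((-(1 / 2) : ℝ) : ℂ) + y * Complex.I) τ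
      = -∫ y : ℝ in (-h)..h, psiReg (((1 / 2 : ℝ) : ℂ) + y * Complex.I) τ := by
    rw [← intervalIntegral_comp_neg_symm, ← intervalIntegral.integral_neg]
    refine intervalIntegral.integral_congr fun x _ => ?_
    rw [← psiReg_neg]; congr 1; push_cast; ring
  rw [hbottom, hleft] at hCauchy
  have hneg : ∀ z : ℂ, (z, τ) ∈ wpDomain → (-z, τ) ∈ wpDomain := fun z => neg_mem_wpDomain
  have hline : ∀ x : ℝ, ((x : ℂ) + h * Complex.I, τ) ∈ wpDomain := fun x =>
    mem_wpDomain_of_im_eq hτ (by simp [hh])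
  have hmem : ∀ x : ℝ, |x| ≤ h → (((1 / 2 : ℝ) : ℂ) + x * Complex.I, τ) ∈ wpDomain := fun x hx =>
    mem_wpDomain_of_abs_le hτ (by simp [abs_of_pos]) (by simpa using hx)
      (fun h0 => by simpa using congrArg Complex.re h0)
  have hcont : ∀ z : ℂ, (z, τ) ∈ wpDomain → ContinuousAt (fun w => psi w τ) z := fun z hz =>
    ((hasDerivAt_zeta hz).continuousAt).sub (by fun_prop)
  -- the integral of `ψ` over the top edge
  have hper : Function.Periodic (fun x : ℝ => psi (x + h * Complex.I) τ) 1 := by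
    intro x
    simp only
    rw [← psi_add_one (hline x)]; congr 1; push_cast; ring
  have htop : ∫ x : ℝ in (-(1 / 2))..(1 / 2), psi (x + h * Complex.I) τ
      = -(eta1 τ * τ - eta2 τ) / 2 := by
    -- The reflection z ↦ τ - z preserves the line Im z = Im τ/2. Oddness and the τ-shift then
    -- express the integral of ψ through its own negative.
    have h1 : ∀ x : ℝ, psi (x + h * Complex.I) τ
        = -psi (((τ.re - x : ℝ) : ℂ) + h * Complex.I) τ - (eta1 τ * τ - eta2 τ) := by
      intro x
      rw [← psi_neg, ← psi_add_tau' (hneg _ (hline _))]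
      congr 1
      have hre : (τ.re : ℂ) + τ.im * Complex.I = τ := Complex.re_add_im τ
      push_cast [hh]
      linear_combination hre
    have h2 : ∫ x : ℝ in (-(1 / 2))..(1 / 2), psi (((τ.re - x : ℝ) : ℂ) + h * Complex.I) τ
        = ∫ x : ℝ in (-(1 / 2))..(1 / 2), psi (x + h * Complex.I) τ := by
      -- The substitution moves the interval to one of length 1 centred at Re τ, which the period 1
      -- moves back.
      rw [intervalIntegral.integral_comp_sub_left (fun x : ℝ => psi (x + h * Complex.I) τ) τ.re]
      have := hper.intervalIntegral_add_eq (τ.re - 1 / 2) (-(1 / 2))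
      rw [show τ.re - 1 / 2 + 1 = τ.re - -(1 / 2) by ring,
        show -(1 / 2 : ℝ) + 1 = 1 / 2 by ring] at this
      exact this
    have hci : Continuous fun x : ℝ => psi (((τ.re - x : ℝ) : ℂ) + h * Complex.I) τ :=
      continuous_iff_continuousAt.mpr fun x =>
        ContinuousAt.comp (f := fun x : ℝ => ((τ.re - x : ℝ) : ℂ) + h * Complex.I)
          (hcont _ (hline (τ.re - x))) (by fun_prop)
    have h3 : ∫ x : ℝ in (-(1 / 2))..(1 / 2), psi (x + h * Complex.I) τ
        = -(∫ x : ℝ in (-(1 / 2))..(1 / 2), psi (x + h * Complex.I) τ)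
          - (eta1 τ * τ - eta2 τ) := by
      conv_lhs => rw [intervalIntegral.integral_congr (g := fun x : ℝ =>
        -psi (((τ.re - x : ℝ) : ℂ) + h * Complex.I) τ - (eta1 τ * τ - eta2 τ)) fun x _ => h1 x]
      rw [intervalIntegral.integral_sub (Continuous.intervalIntegrable (by fun_prop) _ _)
        (by simp), intervalIntegral.integral_neg, h2, intervalIntegral.integral_const]
      norm_num
    linear_combination h3 / 2
  -- the integral of `ψ` over the right edge
  have hright : ∫ y : ℝ in (-h)..h, psi (((1 / 2 : ℝ) : ℂ) + y * Complex.I) τ = 0 := by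
    have h1 : ∫ y : ℝ in (-h)..h, psi (((1 / 2 : ℝ) : ℂ) + y * Complex.I) τ
        = -∫ y : ℝ in (-h)..h, psi (((1 / 2 : ℝ) : ℂ) + y * Complex.I) τ := by
      conv_lhs => rw [← intervalIntegral_comp_neg_symm]
      rw [← intervalIntegral.integral_neg]
      refine intervalIntegral.integral_congr fun y hy => ?_
      rw [Set.uIcc_of_le (by linarith)] at hy
      rw [← psi_neg, ← psi_add_one (hneg _ (hmem y (abs_le.mpr hy)))]
      congr 1; push_cast; ring
    linear_combination h1 / 2
  -- the integrals of `1/z`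
  have hslit1 : ∀ x : ℝ, (x : ℂ) + h * Complex.I ∈ Complex.slitPlane := fun x => by
    rw [Complex.mem_slitPlane_iff]; right; simp [hpos.ne']
  have hslit2 : ∀ y : ℝ, ((1 / 2 : ℝ) : ℂ) + y * Complex.I ∈ Complex.slitPlane := fun y => by
    rw [Complex.mem_slitPlane_iff]; left; simp
  have hint1 : Continuous fun x : ℝ => 1 / ((x : ℂ) + h * Complex.I) :=
    continuous_const.div (by fun_prop) fun x => Complex.slitPlane_ne_zero (hslit1 x)
  have hint2 : Continuous fun y : ℝ => 1 / (((1 / 2 : ℝ) : ℂ) + y * Complex.I) :=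
    continuous_const.div (by fun_prop) fun y => Complex.slitPlane_ne_zero (hslit2 y)
  have hlog1 : ∫ x : ℝ in (-(1 / 2))..(1 / 2), 1 / ((x : ℂ) + h * Complex.I)
      = Complex.log (((1 / 2 : ℝ) : ℂ) + h * Complex.I)
        - Complex.log (((-(1 / 2) : ℝ) : ℂ) + h * Complex.I) := by
    refine intervalIntegral.integral_eq_sub_of_hasDerivAt (f := fun x : ℝ =>
      Complex.log ((x : ℂ) + h * Complex.I)) (fun x _ => ?_) (hint1.intervalIntegrable _ _)
    exact ((Complex.ofRealCLM.hasDerivAt (x := x)).add_const _).clog_real (hslit1 x)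
  have hlog2 : Complex.I * ∫ y : ℝ in (-h)..h, 1 / (((1 / 2 : ℝ) : ℂ) + y * Complex.I)
      = Complex.log (((1 / 2 : ℝ) : ℂ) + h * Complex.I)
        - Complex.log (((1 / 2 : ℝ) : ℂ) + ((-h : ℝ) : ℂ) * Complex.I) := by
    rw [← intervalIntegral.integral_const_mul]
    refine intervalIntegral.integral_eq_sub_of_hasDerivAt (f := fun y : ℝ =>
      Complex.log (((1 / 2 : ℝ) : ℂ) + y * Complex.I)) (fun y _ => ?_)
      ((continuous_const.mul hint2).intervalIntegrable _ _)
    have hd : HasDerivAt (fun y : ℝ => ((1 / 2 : ℝ) : ℂ) + y * Complex.I) Complex.I y := by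
      simpa using ((Complex.ofRealCLM.hasDerivAt (x := y)).mul_const Complex.I).const_add
        ((1 / 2 : ℝ) : ℂ)
    exact (hd.clog_real (hslit2 y)).congr_deriv (by ring)
  -- The corners -1/2 + ih and 1/2 - ih are opposite points, so their principal logarithms differ by
  -- πi. Doubling this gives the 2πi.
  have hpi : Complex.log (((-(1 / 2) : ℝ) : ℂ) + h * Complex.I)
      = Complex.log (((1 / 2 : ℝ) : ℂ) + ((-h : ℝ) : ℂ) * Complex.I) + Real.pi * Complex.I := by
    have hw : ((-(1 / 2) : ℝ) : ℂ) + h * Complex.I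
        = -(((1 / 2 : ℝ) : ℂ) + ((-h : ℝ) : ℂ) * Complex.I) := by push_cast; ring
    rw [hw, Complex.log, Complex.log, norm_neg, Complex.arg_neg_eq_arg_add_pi_of_im_neg
      (by simp [hpos])]
    push_cast; ring
  have hcont' : ∀ z : ℂ, (z, τ) ∈ nearDomain → ContinuousAt (fun w => psiReg w τ) z := fun z hz =>
    (differentiableAt_psiReg hz).continuousAt
  have hT : ∫ x : ℝ in (-(1 / 2))..(1 / 2), psiReg (x + h * Complex.I) τ
      = (∫ x : ℝ in (-(1 / 2))..(1 / 2), psi (x + h * Complex.I) τ)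
        - ∫ x : ℝ in (-(1 / 2))..(1 / 2), 1 / ((x : ℂ) + h * Complex.I) := by
    have hci : Continuous fun x : ℝ => psi ((x : ℂ) + h * Complex.I) τ :=
      continuous_iff_continuousAt.mpr fun x =>
        ContinuousAt.comp (f := fun x : ℝ => (x : ℂ) + h * Complex.I)
          (hcont _ (hline x)) (by fun_prop)
    rw [← intervalIntegral.integral_sub (hci.intervalIntegrable _ _)
      (hint1.intervalIntegrable _ _)]
    refine intervalIntegral.integral_congr fun x _ => ?_
    rw [psi_eq (wpDomain_subset (hline x))]; ring
  have hS : ∫ y : ℝ in (-h)..h, psiReg (((1 / 2 : ℝ) : ℂ) + y * Complex.I) τ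
      = (∫ y : ℝ in (-h)..h, psi (((1 / 2 : ℝ) : ℂ) + y * Complex.I) τ)
        - ∫ y : ℝ in (-h)..h, 1 / (((1 / 2 : ℝ) : ℂ) + y * Complex.I) := by
    have hci : ContinuousOn (fun y : ℝ => psi (((1 / 2 : ℝ) : ℂ) + y * Complex.I) τ)
        (Set.uIcc (-h) h) := by
      intro y hy
      rw [Set.uIcc_of_le (by linarith)] at hy
      exact (ContinuousAt.comp (f := fun y : ℝ => ((1 / 2 : ℝ) : ℂ) + y * Complex.I)
          (hcont _ (hmem y (abs_le.mpr hy))) (by fun_prop)).continuousWithinAt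
    rw [← intervalIntegral.integral_sub hci.intervalIntegrable (hint2.intervalIntegrable _ _)]
    refine intervalIntegral.integral_congr fun y hy => ?_
    rw [Set.uIcc_of_le (by linarith)] at hy
    rw [psi_eq (wpDomain_subset (hmem y (abs_le.mpr hy)))]; ring
  rw [hT, hS, htop, hright, hlog1] at hCauchy
  rw [hpi] at hCauchy
  linear_combination hCauchy + 2 * hlog2

theorem psi_add_tau {z τ : ℂ} (hz : (z, τ) ∈ wpDomain) :
    psi (z + τ) τ = psi z τ - 2 * Real.pi * Complex.I := by
  rw [psi_add_tau' hz, legendre hz.1]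

/-! ### Liouville's theorem for elliptic functions -/

/-- An elliptic function without poles is constant. -/
theorem elliptic_eq_const {τ : ℂ} (hτ : 0 < τ.im) {f : ℂ → ℂ}
    (hd : ∀ z ∉ (per τ).lattice, DifferentiableAt ℂ f z)
    (h1 : ∀ z ∉ (per τ).lattice, f (z + 1) = f z)
    (h2 : ∀ z ∉ (per τ).lattice, f (z + τ) = f z)
    (h0 : ∃ c, Tendsto f (𝓝[≠] 0) (𝓝 c)) :
    ∃ c, ∀ z ∉ (per τ).lattice, f z = c := by
  classical
  obtain ⟨c, hc⟩ := h0
  have hadd : ∀ {z l : ℂ}, l ∈ (per τ).lattice → z ∉ (per τ).lattice →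
      z + l ∉ (per τ).lattice := fun hl hz h => hz (by simpa using sub_mem h hl)
  have hzper : ∀ w ∈ (per τ).lattice, (∀ z ∉ (per τ).lattice, f (z + w) = f z) →
      ∀ n : ℤ, ∀ z ∉ (per τ).lattice, f (z + n * w) = f z := by
    intro w hw hf n
    have hmem : ∀ n : ℤ, (n : ℂ) * w ∈ (per τ).lattice := fun n => by
      simpa using (per τ).lattice.smul_mem n hw
    induction n using Int.induction_on with
    | zero => intro z _; simp
    | succ n ih =>
      intro z hz
      rw [← ih z hz, ← hf _ (hadd (hmem n) hz)]
      congr 1; push_cast; ring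
    | pred n ih =>
      intro z hz
      rw [← ih z hz, ← hf _ (hadd (hmem (-n - 1)) hz)]
      congr 1; push_cast; ring
  have hper : ∀ z l, l ∈ (per τ).lattice → z ∉ (per τ).lattice → f (z + l) = f z := by
    intro z l hl hz
    obtain ⟨m, n, rfl⟩ := (mem_lattice_iff hτ).mp hl
    have e1 := hzper 1 (one_mem_lattice τ) h1 m z hz
    have hm : z + (m : ℂ) * 1 ∉ (per τ).lattice :=
      hadd (by simpa using (per τ).lattice.smul_mem m (one_mem_lattice τ)) hz
    have e2 := hzper τ (tau_mem_lattice hτ) h2 n _ hm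
    rw [← e1, ← e2]; congr 1; ring
  -- F fills the removable singularities with the limit c. It is entire and periodic, hence has
  -- compact range, and Liouville's theorem applies.
  let F : ℂ → ℂ := fun z => if z ∈ (per τ).lattice then c else f z
  have hFper : ∀ z l, l ∈ (per τ).lattice → F (z + l) = F z := by
    intro z l hl
    by_cases hz : z ∈ (per τ).lattice
    · simp [F, hz, add_mem hz hl]
    · simp only [F, hz, hadd hl hz, if_false, hper z l hl hz]
  have hFoff : ∀ z ∉ (per τ).lattice, F =ᶠ[𝓝 z] f := fun z hz => by
    filter_upwards [(per τ).isClosed_lattice.isOpen_compl.mem_nhds hz] with w hw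
    exact if_neg hw
  have hpunct : ∀ᶠ z in 𝓝[≠] (0 : ℂ), z ∉ (per τ).lattice := by
    have := (per τ).compl_lattice_sdiff_singleton_mem_nhds 0
    filter_upwards [nhdsWithin_le_nhds this, self_mem_nhdsWithin] with z hz hz0 hzl
    exact hz ⟨hzl, hz0⟩
  have hF0 : DifferentiableAt ℂ F 0 := by
    refine (Complex.analyticAt_of_differentiable_on_punctured_nhds_of_continuousAt ?_
      ?_).differentiableAt
    · filter_upwards [hpunct] with z hz
      exact (hd z hz).congr_of_eventuallyEq (hFoff z hz)
    · rw [continuousAt_iff_punctured_nhds]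
      have : F 0 = c := if_pos (zero_mem _)
      rw [this]
      refine hc.congr' ?_
      filter_upwards [hpunct] with z hz
      exact (if_neg hz).symm
  have hF : Differentiable ℂ F := by
    intro z
    by_cases hz : z ∈ (per τ).lattice
    · have h3 : F = fun w => F (w - z) := by
        funext w
        rw [sub_eq_add_neg, hFper _ _ (neg_mem hz)]
      rw [h3]
      have h4 : DifferentiableAt ℂ F (z - z) := by rwa [sub_self]
      exact DifferentiableAt.comp (f := fun w => w - z) (g := F) z h4 (by fun_prop)
    · exact (hd z hz).congr_of_eventuallyEq (hFoff z hz)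
  refine ⟨c, fun z hz => ?_⟩
  have := hF.apply_eq_apply_of_bounded (IsZLattice.isCompact_range_of_periodic (per τ).lattice F
    hF.continuous hFper).isBounded z 0
  simpa [F, hz] using this

/-! ### Partial derivatives -/

/-- The partial derivative in the first variable. -/
def dz (F : ℂ × ℂ → ℂ) (p : ℂ × ℂ) : ℂ := fderiv ℂ F p (1, 0)

/-- The partial derivative in the second variable. -/
def dt (F : ℂ × ℂ → ℂ) (p : ℂ × ℂ) : ℂ := fderiv ℂ F p (0, 1)

section Partial

variable {F G : ℂ × ℂ → ℂ} {V : Set (ℂ × ℂ)} {p : ℂ × ℂ}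

theorem contDiffOn_dz (hV : IsOpen V) (hF : ContDiffOn ℂ ∞ F V) : ContDiffOn ℂ ∞ (dz F) V :=
  (hF.fderiv_of_isOpen hV (by simp)).clm_apply contDiffOn_const

theorem contDiffOn_dt (hV : IsOpen V) (hF : ContDiffOn ℂ ∞ F V) : ContDiffOn ℂ ∞ (dt F) V :=
  (hF.fderiv_of_isOpen hV (by simp)).clm_apply contDiffOn_const

theorem ContDiffOn.diffAt (hV : IsOpen V) (hF : ContDiffOn ℂ ∞ F V) (hp : p ∈ V) :
    DifferentiableAt ℂ F p :=
  (hF.differentiableOn (by simp)).differentiableAt (hV.mem_nhds hp)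

theorem dz_congr (hV : IsOpen V) (h : Set.EqOn F G V) (hp : p ∈ V) : dz F p = dz G p := by
  rw [dz, dz, (h.eventuallyEq_of_mem (hV.mem_nhds hp)).fderiv_eq]

theorem dt_congr (hV : IsOpen V) (h : Set.EqOn F G V) (hp : p ∈ V) : dt F p = dt G p := by
  rw [dt, dt, (h.eventuallyEq_of_mem (hV.mem_nhds hp)).fderiv_eq]

theorem dt_dz_comm (hV : IsOpen V) (hF : ContDiffOn ℂ ∞ F V) (hp : p ∈ V) :
    dt (dz F) p = dz (dt F) p := by
  have hs : IsSymmSndFDerivAt ℂ F p :=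
    (hF.contDiffAt (hV.mem_nhds hp)).isSymmSndFDerivAt
      (by rw [minSmoothness_of_isRCLikeNormedField]; exact WithTop.coe_le_coe.mpr (le_top : (2 : ℕ∞) ≤ ⊤))
  have hd : DifferentiableAt ℂ (fderiv ℂ F) p :=
    ((hF.fderiv_of_isOpen hV (m := ∞) (by simp)).differentiableOn (by simp)).differentiableAt
      (hV.mem_nhds hp)
  have key : ∀ u v : ℂ × ℂ, fderiv ℂ (fun q => fderiv ℂ F q u) p v
      = fderiv ℂ (fderiv ℂ F) p v u := by
    intro u v
    rw [fderiv_clm_apply hd (differentiableAt_const u)]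
    simp
  change fderiv ℂ (fun q => fderiv ℂ F q (1, 0)) p (0, 1)
    = fderiv ℂ (fun q => fderiv ℂ F q (0, 1)) p (1, 0)
  rw [key, key]
  exact hs _ _

theorem hasDerivAt_dz {z τ : ℂ} (h : DifferentiableAt ℂ F (z, τ)) :
    HasDerivAt (fun w => F (w, τ)) (dz F (z, τ)) z :=
  HasFDerivAt.hasDerivAt_slice h.hasFDerivAt

theorem hasDerivAt_curve {a : ℂ → ℂ} {a' τ : ℂ} (h : DifferentiableAt ℂ F (a τ, τ))
    (ha : HasDerivAt a a' τ) :
    HasDerivAt (fun t => F (a t, t)) (a' * dz F (a τ, τ) + dt F (a τ, τ)) τ := by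
  have h1 := HasFDerivAt.comp_hasDerivAt (l := F) (f := fun t => (a t, t)) τ h.hasFDerivAt
    (ha.prodMk (hasDerivAt_id τ))
  refine h1.congr_deriv ?_
  have : ((a', 1) : ℂ × ℂ) = a' • ((1 : ℂ), (0 : ℂ)) + ((0 : ℂ), (1 : ℂ)) := by simp
  rw [this, map_add, map_smul, smul_eq_mul]
  rfl

theorem hasDerivAt_dt {z τ : ℂ} (h : DifferentiableAt ℂ F (z, τ)) :
    HasDerivAt (fun t => F (z, t)) (dt F (z, τ)) τ := by
  simpa using hasDerivAt_curve (a := fun _ => z) h (hasDerivAt_const τ z)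

end Partial

/-! ### The second derivative of `℘` -/

theorem punctured_notMem_lattice (τ : ℂ) : ∀ᶠ z in 𝓝[≠] (0 : ℂ), z ∉ (per τ).lattice := by
  have := (per τ).compl_lattice_sdiff_singleton_mem_nhds 0
  filter_upwards [nhdsWithin_le_nhds this, self_mem_nhdsWithin] with z hz hz0 hzl
  exact hz ⟨hzl, hz0⟩

theorem eventually_mem_nearDomain {τ : ℂ} (hτ : 0 < τ.im) :
    ∀ᶠ z in 𝓝 (0 : ℂ), (z, τ) ∈ nearDomain :=
  (by fun_prop : Continuous fun z : ℂ => (z, τ)).continuousAt.eventually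
    (isOpen_nearDomain.mem_nhds (zero_mem_nearDomain hτ))

theorem eventually_mem_wpDomain {τ : ℂ} (hτ : 0 < τ.im) :
    ∀ᶠ z in 𝓝[≠] (0 : ℂ), (z, τ) ∈ wpDomain := by
  filter_upwards [punctured_notMem_lattice τ] with z hz using ⟨hτ, hz⟩

theorem wp_eq_near {z τ : ℂ} (hp : (z, τ) ∈ wpDomain) :
    wp z τ = 1 / z ^ 2 - dz zetaReg (z, τ) := by
  have hz0 : z ≠ 0 := by rw [wpDomain_eq] at hp; exact hp.2
  have h1 := hasDerivAt_zeta hp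
  have h2 := (hasDerivAt_inv hz0).add
    (hasDerivAt_dz (differentiableAt_zetaReg (wpDomain_subset hp)))
  have h3 : (fun w => zeta w τ) =ᶠ[𝓝 z] (fun w => w⁻¹) + fun w => zetaReg (w, τ) := by
    have hcont : ContinuousAt (fun w : ℂ => (w, τ)) z := by fun_prop
    filter_upwards [hcont.eventually (isOpen_wpDomain.mem_nhds hp)] with w hw
    simp only [Pi.add_apply, ← one_div]
    exact zeta_eq (wpDomain_subset hw)
  have := h1.unique (h2.congr_of_eventuallyEq h3)
  linear_combination -this

theorem wp'_eq_near {z τ : ℂ} (hp : (z, τ) ∈ wpDomain) :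
    wp' z τ = -2 / z ^ 3 - dz (dz zetaReg) (z, τ) := by
  have hz0 : z ≠ 0 := by rw [wpDomain_eq] at hp; exact hp.2
  have h1 := hasDerivAt_wp hp.2
  have h2 := ((hasDerivAt_pow 2 z).fun_inv (pow_ne_zero 2 hz0)).sub
    (hasDerivAt_dz (ContDiffOn.diffAt isOpen_nearDomain
      (contDiffOn_dz isOpen_nearDomain contDiffOn_zetaReg) (wpDomain_subset hp)))
  have h3 : (fun w => wp w τ) =ᶠ[𝓝 z] (fun w => (w ^ 2)⁻¹) - fun w => dz zetaReg (w, τ) := by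
    have hcont : ContinuousAt (fun w : ℂ => (w, τ)) z := by fun_prop
    filter_upwards [hcont.eventually (isOpen_wpDomain.mem_nhds hp)] with w hw
    simp only [Pi.sub_apply, ← one_div]
    exact wp_eq_near hw
  rw [h1.unique (h2.congr_of_eventuallyEq h3)]
  field_simp
  push_cast
  ring

theorem tendsto_sq_mul_wp {τ : ℂ} (hτ : 0 < τ.im) :
    Tendsto (fun z => z ^ 2 * wp z τ) (𝓝[≠] 0) (𝓝 1) := by
  have hc : ContinuousAt (fun z : ℂ => dz zetaReg (z, τ)) 0 :=
    ContinuousAt.comp (f := fun z : ℂ => (z, τ)) (g := dz zetaReg)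
      (ContDiffOn.diffAt isOpen_nearDomain (contDiffOn_dz isOpen_nearDomain contDiffOn_zetaReg)
        (zero_mem_nearDomain hτ)).continuousAt (by fun_prop)
  have h1 : ContinuousAt (fun z : ℂ => 1 - z ^ 2 * dz zetaReg (z, τ)) 0 := by fun_prop
  have h2 := h1.tendsto.mono_left (nhdsWithin_le_nhds (s := {0}ᶜ))
  simp only [ne_eq, OfNat.ofNat_ne_zero, not_false_eq_true, zero_pow, zero_mul, sub_zero] at h2
  refine h2.congr' ?_
  filter_upwards [eventually_mem_wpDomain hτ, self_mem_nhdsWithin] with z hz hz0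
  have : z ≠ 0 := hz0
  rw [wp_eq_near hz]
  field_simp

/-- `℘` takes values of arbitrarily large absolute value. -/
theorem exists_norm_wp_gt {τ : ℂ} (hτ : 0 < τ.im) (R : ℝ) :
    ∃ z ∉ (per τ).lattice, R < ‖wp z τ‖ := by
  have h1 : ∀ᶠ z in 𝓝[≠] (0 : ℂ), 1 / 2 < ‖z ^ 2 * wp z τ‖ :=
    (tendsto_sq_mul_wp hτ).norm.eventually_const_lt (by norm_num)
  have h2 : ∀ᶠ z in 𝓝[≠] (0 : ℂ), ‖z‖ ^ 2 * (2 * (|R| + 1)) < 1 := by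
    have : ContinuousAt (fun z : ℂ => ‖z‖ ^ 2 * (2 * (|R| + 1))) 0 := by fun_prop
    exact nhdsWithin_le_nhds (this.eventually_lt continuousAt_const (by simp))
  obtain ⟨z, ⟨hz1, hz2⟩, hz3⟩ := ((h1.and h2).and (punctured_notMem_lattice τ)).exists
  refine ⟨z, hz3, ?_⟩
  by_contra! hc
  rw [norm_mul, norm_pow] at hz1
  have h4 : ‖z‖ ^ 2 * ‖wp z τ‖ ≤ ‖z‖ ^ 2 * (|R| + 1) := by
    gcongr
    linarith [le_abs_self R]
  linarith

/-- If ℘' vanished identically, ℘ would be constant on a connected set, yet it is unbounded. -/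
theorem exists_wp'_ne_zero {τ : ℂ} (hτ : 0 < τ.im) : ∃ z ∉ (per τ).lattice, wp' z τ ≠ 0 := by
  by_contra! h
  obtain ⟨z, hz, hgt⟩ := exists_norm_wp_gt hτ ‖wp (1 / 2) τ‖
  have := (per τ).isClosed_lattice.isOpen_compl.is_const_of_deriv_eq_zero
    (isPreconnected_compl_lattice τ)
    (fun u hu => (hasDerivAt_wp (τ := τ) hu).differentiableAt.differentiableWithinAt)
    (fun u hu => (hasDerivAt_wp hu).deriv.trans (h u hu)) hz (half_mem_wpDomain hτ).2
  simp only at this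
  rw [this] at hgt
  exact lt_irrefl _ hgt

/-- `℘'' = 6 ℘² - g₂ / 2`. -/
theorem hasDerivAt_wp' {z τ : ℂ} (hp : (z, τ) ∈ wpDomain) :
    HasDerivAt (fun w => wp' w τ) (6 * wp z τ ^ 2 - g2 τ / 2) z := by
  have hτ := hp.1
  have han : ∀ {f : ℂ → ℂ}, (∀ w ∈ ((per τ).lattice : Set ℂ)ᶜ, DifferentiableAt ℂ f w) →
      AnalyticOnNhd ℂ f ((per τ).lattice : Set ℂ)ᶜ := fun hf =>
    DifferentiableOn.analyticOnNhd (fun w hw => (hf w hw).differentiableWithinAt)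
      (per τ).isClosed_lattice.isOpen_compl
  have han1 : AnalyticOnNhd ℂ (fun w => wp w τ) ((per τ).lattice : Set ℂ)ᶜ :=
    han fun w hw => (hasDerivAt_wp hw).differentiableAt
  have hd' : ∀ w ∈ ((per τ).lattice : Set ℂ)ᶜ, DifferentiableAt ℂ (fun w => wp' w τ) w :=
    fun w hw => (hasDerivAt_dz (F := fun p => wp' p.1 p.2) (z := w) (τ := τ)
      (ContDiffOn.diffAt isOpen_wpDomain contDiffOn_wp' ⟨hτ, hw⟩)).differentiableAt
  have hD : AnalyticOnNhd ℂ (fun w => deriv (fun w => wp' w τ) w - (6 * wp w τ ^ 2 - g2 τ / 2))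
      ((per τ).lattice : Set ℂ)ᶜ := by
    have h1 := (han hd').deriv
    intro w hw
    have h2 := han1 w hw
    have h3 := h1 w hw
    fun_prop
  obtain ⟨z₁, hz₁, hne⟩ := exists_wp'_ne_zero hτ
  -- Differentiating the Weierstrass equation gives 2℘'(℘'' - 6℘² + g₂/2) = 0. One divides by ℘'
  -- near z₁ and spreads the result by the identity theorem.
  have hzero : (fun w => deriv (fun w => wp' w τ) w - (6 * wp w τ ^ 2 - g2 τ / 2))
      =ᶠ[𝓝 z₁] 0 := by
    have hopen := (per τ).isClosed_lattice.isOpen_compl.mem_nhds hz₁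
    filter_upwards [hopen, (hd' z₁ hz₁).continuousAt.eventually_ne hne] with w hw hwne
    have h1 := ((hd' w hw).hasDerivAt.pow 2)
    have h2 : HasDerivAt (fun w => 4 * wp w τ ^ 3 - g2 τ * wp w τ - g3 τ)
        (4 * (3 * wp w τ ^ 2 * wp' w τ) - g2 τ * wp' w τ) w := by
      have h := hasDerivAt_wp hw
      simpa using (((h.fun_pow 3).const_mul 4).sub (h.const_mul (g2 τ))).sub_const (g3 τ)
    have h3 : (fun w => wp' w τ) ^ 2 =ᶠ[𝓝 w]
        fun w => 4 * wp w τ ^ 3 - g2 τ * wp w τ - g3 τ := by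
      filter_upwards [(per τ).isClosed_lattice.isOpen_compl.mem_nhds hw] with u hu
      exact wp'_sq hu
    have h4 := h1.unique (h2.congr_of_eventuallyEq h3)
    simp only [Nat.cast_ofNat, Nat.add_one_sub_one, pow_one] at h4
    have h5 : 2 * wp' w τ * (deriv (fun w => wp' w τ) w - (6 * wp w τ ^ 2 - g2 τ / 2)) = 0 := by
      linear_combination h4
    exact (mul_eq_zero.mp h5).resolve_left (mul_ne_zero two_ne_zero hwne)
  have hEq := hD.eqOn_zero_of_preconnected_of_eventuallyEq_zero
    (isPreconnected_compl_lattice τ) hz₁ hzero hp.2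
  have h6 : deriv (fun w => wp' w τ) z = 6 * wp z τ ^ 2 - g2 τ / 2 := sub_eq_zero.mp hEq
  rw [← h6]
  exact (hd' z hp.2).hasDerivAt

/-! ### Derivatives with respect to `τ` -/

/-- The constant `i / (4π)` of the heat equation. -/
def heatC : ℂ := Complex.I / (4 * Real.pi)

theorem heatC_mul : 4 * Real.pi * Complex.I * heatC = -1 := by
  have : (Real.pi : ℂ) ≠ 0 := by exact_mod_cast Real.pi_ne_zero
  rw [heatC]
  field_simp
  exact Complex.I_sq

theorem heatC_ne_zero : heatC ≠ 0 := fun h => by simpa [h] using heatC_mul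

theorem heatC_sq : heatC ^ 2 = -1 / (16 * (Real.pi : ℂ) ^ 2) := by
  rw [heatC, div_pow, Complex.I_sq]; ring

theorem contDiffOn_comp_snd_wpDomain {F : ℂ × ℂ → ℂ} {z : ℂ → ℂ} (hF : ContDiffOn ℂ ∞ F wpDomain)
    (hz : ContDiff ℂ ∞ z) (hmem : ∀ τ : ℂ, 0 < τ.im → (z τ, τ) ∈ wpDomain) :
    ContDiffOn ℂ ∞ (fun p : ℂ × ℂ => F (z p.2, p.2)) {p | 0 < p.2.im} :=
  hF.comp (t := wpDomain) (f := fun p : ℂ × ℂ => (z p.2, p.2))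
    (((hz.comp contDiff_snd).prodMk contDiff_snd).contDiffOn) fun p hp => hmem p.2 hp

theorem wpDomain_subset_im : wpDomain ⊆ {p : ℂ × ℂ | 0 < p.2.im} := fun _ hp => hp.1

theorem nearDomain_subset_im : nearDomain ⊆ {p : ℂ × ℂ | 0 < p.2.im} := fun _ hp => hp.1

theorem isOpen_im : IsOpen {p : ℂ × ℂ | 0 < p.2.im} :=
  isOpen_lt continuous_const (by fun_prop)

theorem contDiffOn_eta1 : ContDiffOn ℂ ∞ (fun p : ℂ × ℂ => eta1 p.2) {p | 0 < p.2.im} := by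
  have h1 := contDiffOn_comp_snd_wpDomain contDiffOn_zeta (contDiff_const (c := 1 / 2))
    fun _ hτ => half_mem_wpDomain hτ
  have h2 := contDiffOn_comp_snd_wpDomain contDiffOn_zeta (contDiff_const (c := -(1 / 2)))
    fun _ hτ => neg_mem_wpDomain (half_mem_wpDomain hτ)
  exact h1.sub h2

theorem dz_wp {p : ℂ × ℂ} (hp : p ∈ wpDomain) : dz (fun p => wp p.1 p.2) p = wp' p.1 p.2 :=
  (hasDerivAt_dz (z := p.1) (τ := p.2) (ContDiffOn.diffAt isOpen_wpDomain contDiffOn_wp hp)).unique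
    (hasDerivAt_wp hp.2)

theorem dz_wp' {p : ℂ × ℂ} (hp : p ∈ wpDomain) :
    dz (fun p => wp' p.1 p.2) p = 6 * wp p.1 p.2 ^ 2 - g2 p.2 / 2 :=
  (hasDerivAt_dz (z := p.1) (τ := p.2) (ContDiffOn.diffAt isOpen_wpDomain contDiffOn_wp' hp)).unique
    (hasDerivAt_wp' hp)

/-- Solving ℘'' = 6℘² - g₂/2 for g₂ at z = 1/2, which is never a lattice point, reduces smoothness
in τ to that of ℘. -/
theorem contDiffOn_g2 : ContDiffOn ℂ ∞ (fun p : ℂ × ℂ => g2 p.2) {p | 0 < p.2.im} := by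
  have h1 := contDiffOn_comp_snd_wpDomain contDiffOn_wp (contDiff_const (c := 1 / 2))
    fun _ hτ => half_mem_wpDomain hτ
  have h2 := contDiffOn_comp_snd_wpDomain (contDiffOn_dz isOpen_wpDomain contDiffOn_wp')
    (contDiff_const (c := 1 / 2)) fun _ hτ => half_mem_wpDomain hτ
  refine ((contDiffOn_const (c := 12)).mul (h1.pow 2) |>.sub
    ((contDiffOn_const (c := 2)).mul h2)).congr fun p hp => ?_
  simp only
  rw [dz_wp' (half_mem_wpDomain hp)]
  ring

theorem contDiffOn_g3 : ContDiffOn ℂ ∞ (fun p : ℂ × ℂ => g3 p.2) {p | 0 < p.2.im} := by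
  have h1 := contDiffOn_comp_snd_wpDomain contDiffOn_wp (contDiff_const (c := 1 / 2))
    fun _ hτ => half_mem_wpDomain hτ
  have h2 := contDiffOn_comp_snd_wpDomain contDiffOn_wp'
    (contDiff_const (c := 1 / 2)) fun _ hτ => half_mem_wpDomain hτ
  refine ((contDiffOn_const (c := 4)).mul (h1.pow 3) |>.sub (contDiffOn_g2.mul h1) |>.sub
    (h2.pow 2)).congr fun p hp => ?_
  simp only
  rw [wp'_sq (half_mem_wpDomain hp).2]
  ring

theorem contDiffOn_psi : ContDiffOn ℂ ∞ (fun p : ℂ × ℂ => psi p.1 p.2) wpDomain :=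
  contDiffOn_zeta.sub ((contDiffOn_eta1.mono wpDomain_subset_im).mul contDiffOn_fst)

theorem contDiffOn_psiReg : ContDiffOn ℂ ∞ (fun p : ℂ × ℂ => psiReg p.1 p.2) nearDomain :=
  contDiffOn_zetaReg.sub ((contDiffOn_eta1.mono nearDomain_subset_im).mul contDiffOn_fst)

theorem diffAt_psi {p : ℂ × ℂ} (hp : p ∈ wpDomain) :
    DifferentiableAt ℂ (fun p : ℂ × ℂ => psi p.1 p.2) p :=
  ContDiffOn.diffAt isOpen_wpDomain contDiffOn_psi hp

theorem diffAt_wp {p : ℂ × ℂ} (hp : p ∈ wpDomain) :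
    DifferentiableAt ℂ (fun p : ℂ × ℂ => wp p.1 p.2) p :=
  ContDiffOn.diffAt isOpen_wpDomain contDiffOn_wp hp

theorem diffAt_wp' {p : ℂ × ℂ} (hp : p ∈ wpDomain) :
    DifferentiableAt ℂ (fun p : ℂ × ℂ => wp' p.1 p.2) p :=
  ContDiffOn.diffAt isOpen_wpDomain contDiffOn_wp' hp

theorem dz_psi {p : ℂ × ℂ} (hp : p ∈ wpDomain) :
    dz (fun p => psi p.1 p.2) p = -(wp p.1 p.2 + eta1 p.2) := by
  have h := (hasDerivAt_zeta (z := p.1) (τ := p.2) hp).sub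
    ((hasDerivAt_id p.1).const_mul (eta1 p.2))
  refine (hasDerivAt_dz (z := p.1) (τ := p.2) (diffAt_psi hp)).unique
    (h.congr_deriv (by ring))

theorem eventually_curve_mem {a : ℂ → ℂ} {τ : ℂ} {V : Set (ℂ × ℂ)} (hV : IsOpen V)
    (ha : ContinuousAt a τ) (h : (a τ, τ) ∈ V) : ∀ᶠ t in 𝓝 τ, (a t, t) ∈ V :=
  (ha.prodMk continuousAt_id).eventually (hV.mem_nhds h)

/-- The function `ψ_τ - c (2ψ(℘ + η₁) + ℘')`, shown to vanish below. -/
def heatDefect (z τ : ℂ) : ℂ :=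
  dt (fun p => psi p.1 p.2) (z, τ)
    - heatC * (2 * psi z τ * (wp z τ + eta1 τ) + wp' z τ)

theorem heatDefect_add_one {z τ : ℂ} (hp : (z, τ) ∈ wpDomain) :
    heatDefect (z + 1) τ = heatDefect z τ := by
  have hp1 := add_mem_wpDomain hp (one_mem_lattice τ)
  have h1 := hasDerivAt_dt (F := fun p => psi p.1 p.2) (diffAt_psi hp)
  have h2 := hasDerivAt_dt (F := fun p => psi p.1 p.2) (diffAt_psi hp1)
  have h3 : (fun t => psi (z + 1) t) =ᶠ[𝓝 τ] fun t => psi z t := by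
    filter_upwards [eventually_curve_mem (a := fun _ => z) isOpen_wpDomain
      continuousAt_const hp] with t ht
    exact psi_add_one ht
  have h4 := (h1.congr_of_eventuallyEq h3).unique h2
  rw [heatDefect, heatDefect, ← h4, psi_add_one hp, wp_add (one_mem_lattice τ),
    wp'_add (one_mem_lattice τ)]

/-- Differentiating ψ(z + τ|τ) = ψ(z|τ) - 2πi in τ adds ℘ + η₁ to ψ_τ, and the shift by -2πi in the
product cancels it exactly when 4πic = -1. This fixes the value of c. -/
theorem heatDefect_add_tau {z τ : ℂ} (hp : (z, τ) ∈ wpDomain) :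
    heatDefect (z + τ) τ = heatDefect z τ := by
  have hl := tau_mem_lattice hp.1
  have hp1 := add_mem_wpDomain hp hl
  have h1 := (hasDerivAt_dt (F := fun p => psi p.1 p.2) (diffAt_psi hp)).sub_const
    (2 * Real.pi * Complex.I)
  have h2 := hasDerivAt_curve (F := fun p => psi p.1 p.2) (a := fun t => z + t) (diffAt_psi hp1)
    ((hasDerivAt_id τ).const_add z)
  have h3 : (fun t => psi (z + t) t) =ᶠ[𝓝 τ] fun t => psi z t - 2 * Real.pi * Complex.I := by
    filter_upwards [eventually_curve_mem (a := fun _ => z) isOpen_wpDomain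
      continuousAt_const hp] with t ht
    exact psi_add_tau ht
  have h4 := (h1.congr_of_eventuallyEq h3).unique h2
  rw [dz_psi hp1, wp_add hl] at h4
  rw [heatDefect, heatDefect, psi_add_tau hp, wp_add hl, wp'_add hl]
  linear_combination -h4 + (wp z τ + eta1 τ) * heatC_mul

theorem dt_psi_near {z τ : ℂ} (hp : (z, τ) ∈ wpDomain) :
    dt (fun p => psi p.1 p.2) (z, τ) = dt (fun p => psiReg p.1 p.2) (z, τ) := by
  have h1 := hasDerivAt_dt (F := fun p => psi p.1 p.2) (diffAt_psi hp)
  have h2 := (hasDerivAt_dt (F := fun p => psiReg p.1 p.2) (z := z) (τ := τ)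
    (ContDiffOn.diffAt isOpen_nearDomain contDiffOn_psiReg (wpDomain_subset hp))).const_add (1 / z)
  refine h1.unique (h2.congr_of_eventuallyEq ?_)
  filter_upwards [eventually_curve_mem (a := fun _ => z) isOpen_wpDomain
      continuousAt_const hp] with t ht
  exact psi_eq (wpDomain_subset ht)

/-- Put u = ψ - 1/z, which is holomorphic and odd. Since 1/z does not involve τ, ψ_τ has no pole. As
℘ + η₁ = -ψ', one finds 2ψ(℘ + η₁) + ℘' = -2ψψ' - ψ'' = -2(u/z)' - 2uu' - u'', and u/z is
holomorphic because u(0) = 0. -/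
theorem tendsto_heatDefect {τ : ℂ} (hτ : 0 < τ.im) :
    ∃ c, Tendsto (fun z => heatDefect z τ) (𝓝[≠] 0) (𝓝 c) := by
  have hmem0 := zero_mem_nearDomain hτ
  have hnear := eventually_mem_nearDomain hτ
  set u : ℂ → ℂ := fun z => psiReg z τ with hu
  have hslice : ∀ z, (z, τ) ∈ nearDomain → DifferentiableAt ℂ u z := fun z hz =>
    differentiableAt_psiReg hz
  have han : AnalyticAt ℂ u 0 :=
    Complex.analyticAt_iff_eventually_differentiableAt.mpr (hnear.mono hslice)
  have hu0 : u 0 = 0 := by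
    have := psiReg_neg 0 τ
    rw [neg_zero] at this
    simp only [hu]
    linear_combination this / 2
  obtain ⟨s, hs⟩ := han
  have hw : AnalyticAt ℂ (dslope u 0) 0 := ⟨_, hs.has_fpower_series_dslope_fslope⟩
  have han : AnalyticAt ℂ u 0 := ⟨s, hs⟩
  have hB : ContinuousAt (fun z : ℂ => dt (fun p => psiReg p.1 p.2) (z, τ)) 0 :=
    ContinuousAt.comp (f := fun z : ℂ => (z, τ)) (g := dt fun p => psiReg p.1 p.2)
      (ContDiffOn.diffAt isOpen_nearDomain (contDiffOn_dt isOpen_nearDomain contDiffOn_psiReg)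
        hmem0).continuousAt (by fun_prop)
  have hcont : ContinuousAt (fun z => dt (fun p => psiReg p.1 p.2) (z, τ)
      - heatC * (-2 * deriv (dslope u 0) z - 2 * u z * deriv u z - deriv (deriv u) z)) 0 := by
    have c1 := hw.deriv.continuousAt
    have c2 := han.continuousAt
    have c3 := han.deriv.continuousAt
    have c4 := han.deriv.deriv.continuousAt
    fun_prop
  refine ⟨_, (hcont.tendsto.mono_left (nhdsWithin_le_nhds (s := {0}ᶜ))).congr' ?_⟩
  filter_upwards [eventually_mem_wpDomain hτ, self_mem_nhdsWithin] with z hz hz0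
  have hz0 : z ≠ 0 := hz0
  have hzn := wpDomain_subset hz
  have hdreg : ∀ w, (w, τ) ∈ nearDomain → deriv u w = dz zetaReg (w, τ) - eta1 τ := fun w hw => by
    have := (hasDerivAt_dz (differentiableAt_zetaReg hw)).sub
      ((hasDerivAt_id w).const_mul (eta1 τ))
    exact (this.congr_deriv (by ring)).deriv
  have hdreg2 : deriv (deriv u) z = dz (dz zetaReg) (z, τ) := by
    have h1 := (hasDerivAt_dz (F := dz zetaReg) (ContDiffOn.diffAt isOpen_nearDomain
      (contDiffOn_dz isOpen_nearDomain contDiffOn_zetaReg) hzn)).sub_const (eta1 τ)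
    refine (h1.congr_of_eventuallyEq ?_).deriv
    filter_upwards [(by fun_prop : Continuous fun z : ℂ => (z, τ)).continuousAt.eventually
      (isOpen_nearDomain.mem_nhds hzn)] with w hw using hdreg w hw
  have hdw : deriv (dslope u 0) z = deriv u z / z - u z / z ^ 2 := by
    have h1 := (hslice z hzn).hasDerivAt.div (hasDerivAt_id z) hz0
    have h2 : dslope u 0 =ᶠ[𝓝 z] u / id := by
      filter_upwards [isOpen_ne.mem_nhds hz0] with w hw
      rw [dslope_of_ne _ hw, slope_def_field, hu0]
      simp
    rw [(h1.congr_of_eventuallyEq h2).deriv]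
    simp only [id_eq]
    field_simp
  rw [heatDefect, dt_psi_near hz, psi_eq hzn, wp_eq_near hz, wp'_eq_near hz, hdw, hdreg2,
    hdreg z hzn]
  simp only [hu]
  field_simp
  ring

theorem heatDefect_neg {z τ : ℂ} (hp : (z, τ) ∈ wpDomain) :
    heatDefect (-z) τ = -heatDefect z τ := by
  have h1 := hasDerivAt_dt (F := fun p => psi p.1 p.2) (diffAt_psi hp)
  have h2 := hasDerivAt_dt (F := fun p => psi p.1 p.2) (diffAt_psi (neg_mem_wpDomain hp))
  have h3 : (fun t => psi (-z) t) = -fun t => psi z t := by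
    funext t; exact psi_neg z t
  have h4 := h2.unique (h3 ▸ h1.neg)
  rw [heatDefect, heatDefect, h4, psi_neg, wp_neg, wp'_neg]
  ring

/-- The heat equation, in terms of `ψ(z|τ) = ζ(z|τ) - η₁(τ) z`. -/
theorem dt_psi {p : ℂ × ℂ} (hp : p ∈ wpDomain) : dt (fun p => psi p.1 p.2) p
    = heatC * (2 * psi p.1 p.2 * (wp p.1 p.2 + eta1 p.2) + wp' p.1 p.2) := by
  obtain ⟨z, τ⟩ := p
  have hτ := hp.1
  obtain ⟨c, hc⟩ := elliptic_eq_const hτ (f := fun z => heatDefect z τ) (fun w hw => by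
      have hw : (w, τ) ∈ wpDomain := ⟨hτ, hw⟩
      have d1 := (hasDerivAt_dz (z := w) (τ := τ) (ContDiffOn.diffAt isOpen_wpDomain
        (contDiffOn_dt isOpen_wpDomain contDiffOn_psi) hw)).differentiableAt
      have d2 := (hasDerivAt_dz (F := fun p => psi p.1 p.2) (diffAt_psi hw)).differentiableAt
      have d3 := (hasDerivAt_wp hw.2).differentiableAt
      have d4 := (hasDerivAt_wp' hw).differentiableAt
      simp only at d2 d3 d4
      unfold heatDefect
      exact d1.sub (((d2.const_mul 2).mul (d3.add_const _)).add d4 |>.const_mul _))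
    (fun w hw => heatDefect_add_one ⟨hτ, hw⟩) (fun w hw => heatDefect_add_tau ⟨hτ, hw⟩)
    (tendsto_heatDefect hτ)
  -- The defect is odd, so comparing its values at 1/2 and -1/2 shows that the constant is zero.
  have h1 := hc _ (half_mem_wpDomain hτ).2
  have h2 := hc _ (neg_mem_wpDomain (half_mem_wpDomain hτ)).2
  have h3 := heatDefect_neg (half_mem_wpDomain hτ)
  have h4 : heatDefect z τ = 0 := by
    have := hc z hp.2
    simp only at h1 h2 h3 this
    linear_combination this + (h3 - h2 - h1) / 2
  exact sub_eq_zero.mp h4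

/-! ### Ramanujan's identities and derivatives along curves -/

theorem differentiableAt_of_contDiffOn_snd {f : ℂ → ℂ}
    (hf : ContDiffOn ℂ ∞ (fun p : ℂ × ℂ => f p.2) {p | 0 < p.2.im}) {τ : ℂ} (hτ : 0 < τ.im) :
    DifferentiableAt ℂ f τ :=
  (hasDerivAt_dt (F := fun p => f p.2) (z := 0) (τ := τ)
    (ContDiffOn.diffAt isOpen_im hf hτ)).differentiableAt

theorem differentiableAt_eta1 {τ : ℂ} (hτ : 0 < τ.im) : DifferentiableAt ℂ eta1 τ :=
  differentiableAt_of_contDiffOn_snd contDiffOn_eta1 hτ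

theorem differentiableAt_g2 {τ : ℂ} (hτ : 0 < τ.im) : DifferentiableAt ℂ g2 τ :=
  differentiableAt_of_contDiffOn_snd contDiffOn_g2 hτ

theorem differentiableAt_g3 {τ : ℂ} (hτ : 0 < τ.im) : DifferentiableAt ℂ g3 τ :=
  differentiableAt_of_contDiffOn_snd contDiffOn_g3 hτ

theorem hasDerivAt_psi_slice {z τ : ℂ} (hp : (z, τ) ∈ wpDomain) :
    HasDerivAt (fun w => psi w τ) (-(wp z τ + eta1 τ)) z :=
  (hasDerivAt_dz (F := fun p => psi p.1 p.2) (diffAt_psi hp)).congr_deriv (dz_psi hp)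

/-- Since ℘ = -ψ_z - η₁, this is the heat equation differentiated in z, with the partial derivatives
exchanged. The term η₁' is still unknown; `ramanujan` removes it. -/
theorem dt_wp_aux {p : ℂ × ℂ} (hp : p ∈ wpDomain) :
    dt (fun p => wp p.1 p.2) p = -deriv eta1 p.2 + heatC * (2 * (wp p.1 p.2 + eta1 p.2) ^ 2
      - 2 * psi p.1 p.2 * wp' p.1 p.2 - (6 * wp p.1 p.2 ^ 2 - g2 p.2 / 2)) := by
  obtain ⟨z, τ⟩ := p
  have h1 : dz (dt fun p => psi p.1 p.2) (z, τ)
      = heatC * (-2 * (wp z τ + eta1 τ) ^ 2 + 2 * psi z τ * wp' z τ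
        + (6 * wp z τ ^ 2 - g2 τ / 2)) := by
    rw [dz_congr isOpen_wpDomain (fun q hq => dt_psi hq) hp]
    have hd : DifferentiableAt ℂ (fun p : ℂ × ℂ =>
        heatC * (2 * psi p.1 p.2 * (wp p.1 p.2 + eta1 p.2) + wp' p.1 p.2)) (z, τ) :=
      ((((diffAt_psi hp).const_mul 2).mul ((diffAt_wp hp).add
        (ContDiffOn.diffAt isOpen_im contDiffOn_eta1 hp.1))).add (diffAt_wp' hp)).const_mul _
    refine (hasDerivAt_dz hd).unique ?_
    exact (((((hasDerivAt_psi_slice hp).const_mul 2).mul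
      ((hasDerivAt_wp hp.2).add_const (eta1 τ))).add (hasDerivAt_wp' hp)).const_mul
      heatC).congr_deriv (by ring)
  have h2 := hasDerivAt_dt (F := dz fun p => psi p.1 p.2) (ContDiffOn.diffAt isOpen_wpDomain
    (contDiffOn_dz isOpen_wpDomain contDiffOn_psi) hp)
  rw [dt_dz_comm isOpen_wpDomain contDiffOn_psi hp, h1] at h2
  have h3 := h2.neg.sub (differentiableAt_eta1 hp.1).hasDerivAt
  have h4 : (fun t => wp z t)
      =ᶠ[𝓝 τ] (-fun t => dz (fun p => psi p.1 p.2) (z, t)) - eta1 := by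
    filter_upwards [eventually_curve_mem (a := fun _ => z) isOpen_wpDomain
      continuousAt_const hp] with t ht
    simp only [Pi.sub_apply, Pi.neg_apply]
    rw [dz_psi ht]
    ring
  rw [(hasDerivAt_dt (F := fun p => wp p.1 p.2) (diffAt_wp hp)).unique
    (h3.congr_of_eventuallyEq h4)]
  ring

/-- A further z-derivative kills η₁', so this formula is available before Ramanujan's identities and
can be used to prove them. -/
theorem dt_wp' {p : ℂ × ℂ} (hp : p ∈ wpDomain) :
    dt (fun p => wp' p.1 p.2) p = heatC * (6 * (eta1 p.2 - wp p.1 p.2) * wp' p.1 p.2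
      - 2 * psi p.1 p.2 * (6 * wp p.1 p.2 ^ 2 - g2 p.2 / 2)) := by
  obtain ⟨z, τ⟩ := p
  rw [dt_congr isOpen_wpDomain (fun q hq => (dz_wp hq).symm) hp,
    dt_dz_comm isOpen_wpDomain contDiffOn_wp hp]
  refine (hasDerivAt_dz (ContDiffOn.diffAt isOpen_wpDomain
    (contDiffOn_dt isOpen_wpDomain contDiffOn_wp) hp)).unique ?_
  have hW := hasDerivAt_wp hp.2
  have h1 := ((((((hW.add_const (eta1 τ)).fun_pow 2).const_mul 2).sub
    (((hasDerivAt_psi_slice hp).const_mul 2).mul (hasDerivAt_wp' hp))).sub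
    (((hW.fun_pow 2).const_mul 6).sub_const (g2 τ / 2))).const_mul heatC).const_add
    (-deriv eta1 τ)
  refine (h1.congr_of_eventuallyEq ?_).congr_deriv ?_
  · filter_upwards [(by fun_prop : Continuous fun z : ℂ => (z, τ)).continuousAt.eventually
      (isOpen_wpDomain.mem_nhds hp)] with w hw
    exact dt_wp_aux hw
  · simp only
    push_cast
    ring

theorem quadratic_eq_zero {a b d x y w : ℂ} (hxy : x ≠ y) (hxw : x ≠ w) (hyw : y ≠ w)
    (hx : a * x ^ 2 + b * x + d = 0) (hy : a * y ^ 2 + b * y + d = 0)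
    (hw : a * w ^ 2 + b * w + d = 0) : a = 0 ∧ b = 0 ∧ d = 0 := by
  have h1 : a * (x + y) + b = 0 := by
    have : (x - y) * (a * (x + y) + b) = 0 := by linear_combination hx - hy
    exact (mul_eq_zero.mp this).resolve_left (sub_ne_zero.mpr hxy)
  have h2 : a * (x + w) + b = 0 := by
    have : (x - w) * (a * (x + w) + b) = 0 := by linear_combination hx - hw
    exact (mul_eq_zero.mp this).resolve_left (sub_ne_zero.mpr hxw)
  have ha : a = 0 := by
    have : (y - w) * a = 0 := by linear_combination h1 - h2
    exact (mul_eq_zero.mp this).resolve_left (sub_ne_zero.mpr hyw)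
  subst ha
  have hb : b = 0 := by linear_combination h1
  subst hb
  exact ⟨rfl, rfl, by linear_combination hx⟩

/-- The τ-derivative of the Weierstrass equation reduces to a quadratic polynomial in ℘ whose
coefficients depend only on τ. As ℘ takes three distinct values, all coefficients vanish, which
gives the three identities. -/
theorem ramanujan {τ : ℂ} (hτ : 0 < τ.im) :
    deriv eta1 τ = heatC * (2 * eta1 τ ^ 2 - g2 τ / 6) ∧
    deriv g2 τ = heatC * (8 * eta1 τ * g2 τ - 12 * g3 τ) ∧
    deriv g3 τ = heatC * (12 * eta1 τ * g3 τ - 2 / 3 * g2 τ ^ 2) := by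
  have key : ∀ z ∉ (per τ).lattice,
      (12 * deriv eta1 τ - heatC * (24 * eta1 τ ^ 2 - 2 * g2 τ)) * wp z τ ^ 2
      + (deriv g2 τ - heatC * (8 * eta1 τ * g2 τ - 12 * g3 τ)) * wp z τ
      + (deriv g3 τ - 12 * heatC * eta1 τ * g3 τ
          - g2 τ * (deriv eta1 τ - heatC * (2 * eta1 τ ^ 2 + g2 τ / 2))) = 0 := by
    intro z hz
    have hp : (z, τ) ∈ wpDomain := ⟨hτ, hz⟩
    have hP := hasDerivAt_dt (F := fun p => wp p.1 p.2) (diffAt_wp hp)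
    have hQ := hasDerivAt_dt (F := fun p => wp' p.1 p.2) (diffAt_wp' hp)
    rw [dt_wp_aux hp] at hP
    rw [dt_wp' hp] at hQ
    simp only at hP hQ
    have h1 := hQ.fun_pow 2
    have h2 := (((hP.fun_pow 3).const_mul 4).sub
      ((differentiableAt_g2 hτ).hasDerivAt.mul hP)).sub (differentiableAt_g3 hτ).hasDerivAt
    have h3 := h1.unique (h2.congr_of_eventuallyEq (by
      filter_upwards [eventually_curve_mem (a := fun _ => z) isOpen_wpDomain
        continuousAt_const hp] with t ht
      exact wp'_sq ht.2))
    push_cast at h3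
    have hsq := wp'_sq hz
    linear_combination h3 - (12 * heatC * (eta1 τ - wp z τ)) * hsq
  -- Unboundedness of ℘ supplies three points with strictly increasing |℘|.
  obtain ⟨z₁, hz₁, -⟩ := exists_norm_wp_gt hτ 0
  obtain ⟨z₂, hz₂, h12⟩ := exists_norm_wp_gt hτ ‖wp z₁ τ‖
  obtain ⟨z₃, hz₃, h23⟩ := exists_norm_wp_gt hτ ‖wp z₂ τ‖
  obtain ⟨ha, hb, hd⟩ := quadratic_eq_zero (x := wp z₁ τ) (y := wp z₂ τ) (w := wp z₃ τ)
    (fun h => by rw [h] at h12; exact lt_irrefl _ h12)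
    (fun h => by rw [h] at h12; exact lt_irrefl _ (h12.trans h23))
    (fun h => by rw [h] at h23; exact lt_irrefl _ h23) (key _ hz₁) (key _ hz₂) (key _ hz₃)
  refine ⟨by linear_combination ha / 12, by linear_combination hb, ?_⟩
  linear_combination hd + g2 τ * ha / 12

theorem hasDerivAt_g2 {τ : ℂ} (hτ : 0 < τ.im) :
    HasDerivAt g2 (heatC * (8 * eta1 τ * g2 τ - 12 * g3 τ)) τ :=
  (differentiableAt_g2 hτ).hasDerivAt.congr_deriv (ramanujan hτ).2.1

theorem hasDerivAt_g3 {τ : ℂ} (hτ : 0 < τ.im) :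
    HasDerivAt g3 (heatC * (12 * eta1 τ * g3 τ - 2 / 3 * g2 τ ^ 2)) τ :=
  (differentiableAt_g3 hτ).hasDerivAt.congr_deriv (ramanujan hτ).2.2

theorem dt_wp {p : ℂ × ℂ} (hp : p ∈ wpDomain) :
    dt (fun p => wp p.1 p.2) p = heatC * (-4 * wp p.1 p.2 ^ 2 + 4 * wp p.1 p.2 * eta1 p.2
      - 2 * psi p.1 p.2 * wp' p.1 p.2 + 2 / 3 * g2 p.2) := by
  rw [dt_wp_aux hp, (ramanujan hp.1).1]; ring

section Curve

variable {a : ℂ → ℂ} {a' τ : ℂ}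

theorem hasDerivAt_psi_curve (hp : (a τ, τ) ∈ wpDomain) (ha : HasDerivAt a a' τ) :
    HasDerivAt (fun t => psi (a t) t) (-(wp (a τ) τ + eta1 τ) * a'
      + heatC * (2 * psi (a τ) τ * (wp (a τ) τ + eta1 τ) + wp' (a τ) τ)) τ := by
  refine (hasDerivAt_curve (F := fun p => psi p.1 p.2) (diffAt_psi hp) ha).congr_deriv ?_
  rw [dz_psi hp, dt_psi hp]; ring

/-- The velocity of the curve enters only through a' - 2cψ. For a = r + sτ this is -2cZ; for a lift
p it is the quantity that the Hamiltonian equation determines. -/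
theorem hasDerivAt_wp_curve (hp : (a τ, τ) ∈ wpDomain) (ha : HasDerivAt a a' τ) :
    HasDerivAt (fun t => wp (a t) t) (wp' (a τ) τ * (a' - 2 * heatC * psi (a τ) τ)
      + heatC * (-4 * wp (a τ) τ ^ 2 + 4 * eta1 τ * wp (a τ) τ + 2 / 3 * g2 τ)) τ := by
  refine (hasDerivAt_curve (F := fun p => wp p.1 p.2) (diffAt_wp hp) ha).congr_deriv ?_
  rw [dz_wp hp, dt_wp hp]; ring

theorem hasDerivAt_wp'_curve (hp : (a τ, τ) ∈ wpDomain) (ha : HasDerivAt a a' τ) :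
    HasDerivAt (fun t => wp' (a t) t)
      ((6 * wp (a τ) τ ^ 2 - g2 τ / 2) * (a' - 2 * heatC * psi (a τ) τ)
      + heatC * (6 * (eta1 τ - wp (a τ) τ) * wp' (a τ) τ)) τ := by
  refine (hasDerivAt_curve (F := fun p => wp' p.1 p.2) (diffAt_wp' hp) ha).congr_deriv ?_
  rw [dz_wp' hp, dt_wp' hp]; ring

end Curve

/-! ### Half periods -/

theorem tendsto_nhdsNE_of_continuousAt {f : ℂ → ℂ} {a b : ℂ} (hf : ContinuousAt f a)
    (hb : f a = b) : Tendsto f (𝓝[≠] a) (𝓝 b) :=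
  hb ▸ hf.tendsto.mono_left nhdsWithin_le_nhds

theorem tendsto_sub_nhdsNE (z : ℂ) : Tendsto (fun w => w - z) (𝓝[≠] z) (𝓝[≠] 0) := by
  refine tendsto_nhdsWithin_iff.mpr
    ⟨tendsto_nhdsNE_of_continuousAt (by fun_prop) (sub_self z), ?_⟩
  filter_upwards [self_mem_nhdsWithin] with w hw
  exact sub_ne_zero.mpr hw

section HalfPeriod

variable {τ h : ℂ}

theorem wp'_half (h2 : 2 * h ∈ (per τ).lattice) : wp' h τ = 0 := by
  have h1 : wp' (-h + 2 * h) τ = wp' (-h) τ := wp'_add h2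
  rw [wp'_neg, show -h + 2 * h = h by ring] at h1
  linear_combination h1 / 2

/-- As ℘'(h) = 0, the function u has a double zero at 0 that cancels the double pole of ℘. The limit
is u''(0)/2, read off from the second divided slope, which is u/z². -/
theorem tendsto_wp_add_half (hτ : 0 < τ.im) (h1 : h ∉ (per τ).lattice)
    (h2 : 2 * h ∈ (per τ).lattice) :
    Tendsto (fun z => (wp (z + h) τ - wp h τ) * (wp z τ - wp h τ)) (𝓝[≠] 0)
      (𝓝 (3 * wp h τ ^ 2 - g2 τ / 4)) := by
  set u : ℂ → ℂ := fun z => wp (z + h) τ - wp h τ with hu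
  have hp : (h, τ) ∈ wpDomain := ⟨hτ, h1⟩
  have hopen : ∀ᶠ z in 𝓝 (0 : ℂ), z + h ∉ (per τ).lattice :=
    ((per τ).isClosed_lattice.isOpen_compl.preimage
      (by fun_prop : Continuous fun w : ℂ => w + h)).mem_nhds (by simpa using h1)
  have hderiv : ∀ z, z + h ∉ (per τ).lattice → HasDerivAt u (wp' (z + h) τ) z := fun z hz =>
    ((hasDerivAt_wp hz).comp_add_const z h).sub_const _
  have hderiv2 : HasDerivAt (fun z => wp' (z + h) τ) (6 * wp h τ ^ 2 - g2 τ / 2) 0 := by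
    have := hasDerivAt_wp' (z := 0 + h) (τ := τ) (by rwa [zero_add])
    have := this.comp_add_const 0 h
    rwa [zero_add] at this
  have han : AnalyticAt ℂ u 0 := Complex.analyticAt_iff_eventually_differentiableAt.mpr
    (hopen.mono fun z hz => (hderiv z hz).differentiableAt)
  have hu0 : u 0 = 0 := by simp [hu]
  obtain ⟨s, hs⟩ := han
  have hs1 := hs.has_fpower_series_dslope_fslope
  have hs2 := hs1.has_fpower_series_dslope_fslope
  have hc2 : ContinuousAt (dslope (dslope u 0) 0) 0 := AnalyticAt.continuousAt ⟨_, hs2⟩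
  have hv0 : dslope u 0 0 = 0 := by
    rw [dslope_same, (hderiv 0 (by rwa [zero_add])).deriv, zero_add, wp'_half h2]
  have hfac : ∀ z, u z = z ^ 2 * dslope (dslope u 0) 0 z := by
    intro z
    have e1 := sub_smul_dslope u 0 z
    have e2 := sub_smul_dslope (dslope u 0) 0 z
    simp only [sub_zero, smul_eq_mul, hu0, hv0] at e1 e2
    rw [← e1, ← e2]; ring
  have hval : dslope (dslope u 0) 0 0 = 3 * wp h τ ^ 2 - g2 τ / 4 := by
    have hw := hs2.analyticAt
    have hd1 : HasDerivAt u (2 * 0 * dslope (dslope u 0) 0 0 + 0 ^ 2 * deriv (dslope (dslope u 0) 0) 0) 0 := by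
      have := (hasDerivAt_pow 2 (0 : ℂ)).mul hw.differentiableAt.hasDerivAt
      refine (this.congr_deriv (by simp)).congr_of_eventuallyEq (Eventually.of_forall hfac)
    have hd : (fun z => wp' (z + h) τ) =ᶠ[𝓝 0]
        fun z => 2 * z * dslope (dslope u 0) 0 z + z ^ 2 * deriv (dslope (dslope u 0) 0) z := by
      filter_upwards [hopen, hw.eventually_analyticAt] with z hz hz2
      have := (hasDerivAt_pow 2 z).mul hz2.differentiableAt.hasDerivAt
      refine (hderiv z hz).unique ((this.congr_deriv ?_).congr_of_eventuallyEq
        (Eventually.of_forall hfac))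
      simp
    have h3 : HasDerivAt (fun z => 2 * z * dslope (dslope u 0) 0 z
        + z ^ 2 * deriv (dslope (dslope u 0) 0) z) (2 * dslope (dslope u 0) 0 0) 0 := by
      have := (((hasDerivAt_id (0 : ℂ)).const_mul 2).mul hw.differentiableAt.hasDerivAt).add
        ((hasDerivAt_pow 2 (0 : ℂ)).mul hw.deriv.differentiableAt.hasDerivAt)
      exact this.congr_deriv (by simp)
    have h4 := hderiv2.unique (h3.congr_of_eventuallyEq hd)
    linear_combination -h4 / 2
  have hlim : Tendsto (fun z => dslope (dslope u 0) 0 z * (z ^ 2 * wp z τ - z ^ 2 * wp h τ))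
      (𝓝[≠] 0) (𝓝 ((3 * wp h τ ^ 2 - g2 τ / 4) * (1 - 0))) := by
    refine Tendsto.mul ?_ ((tendsto_sq_mul_wp hτ).sub ?_)
    · rw [← hval]; exact hc2.tendsto.mono_left nhdsWithin_le_nhds
    · exact tendsto_nhdsNE_of_continuousAt (by fun_prop) (by simp)
  rw [sub_zero, mul_one] at hlim
  refine hlim.congr fun z => ?_
  change _ = u z * _
  rw [hfac z]; ring

/-- The product is elliptic: at lattice points its singularity is removable by
`tendsto_wp_add_half`, and the symmetry z ↦ z + h transfers this to the points of -h + Λ.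
Liouville's theorem makes it constant, and the value filled in at -h is the constant. -/
theorem wp_add_half (hτ : 0 < τ.im) (h1 : h ∉ (per τ).lattice) (h2 : 2 * h ∈ (per τ).lattice)
    {z : ℂ} (hz : z ∉ (per τ).lattice) (hzh : z + h ∉ (per τ).lattice) :
    (wp (z + h) τ - wp h τ) * (wp z τ - wp h τ) = 3 * wp h τ ^ 2 - g2 τ / 4 := by
  classical
  set C := 3 * wp h τ ^ 2 - g2 τ / 4
  set g : ℂ → ℂ := fun z => (wp (z + h) τ - wp h τ) * (wp z τ - wp h τ)
  have hlim : Tendsto g (𝓝[≠] 0) (𝓝 C) := tendsto_wp_add_half hτ h1 h2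
  let f : ℂ → ℂ := fun z => if z + h ∈ (per τ).lattice then C else g z
  have hgper : ∀ z l, l ∈ (per τ).lattice → g (z + l) = g z := by
    intro z l hl
    simp only [g]
    rw [wp_add hl, show z + l + h = z + h + l by ring, wp_add hl]
  have hiff : ∀ z l, l ∈ (per τ).lattice → (z + l + h ∈ (per τ).lattice ↔
      z + h ∈ (per τ).lattice) := by
    intro z l hl
    rw [show z + l + h = z + h + l by ring]
    exact (per τ).lattice.add_mem_iff_left hl
  have hfper : ∀ z l, l ∈ (per τ).lattice → f (z + l) = f z := by
    intro z l hl
    simp only [f, hiff z l hl, hgper z l hl]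
  have hopen : IsOpen {w : ℂ | w + h ∉ (per τ).lattice} :=
    (per τ).isClosed_lattice.isOpen_compl.preimage (by fun_prop : Continuous fun w : ℂ => w + h)
  have hfg : ∀ z, z + h ∉ (per τ).lattice → f =ᶠ[𝓝 z] g := fun z hz => by
    filter_upwards [hopen.mem_nhds hz] with w hw using if_neg hw
  have hgd : ∀ z, z ∉ (per τ).lattice → z + h ∉ (per τ).lattice → DifferentiableAt ℂ g z :=
    fun z hz hzh => ((((hasDerivAt_wp hzh).comp_add_const z h).sub_const _).mul
      ((hasDerivAt_wp hz).sub_const _)).differentiableAt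
  have hsymm : ∀ w, g (w + h) = g w := by
    intro w
    simp only [g]
    rw [show w + h + h = w + 2 * h by ring, wp_add h2, mul_comm]
  have key : ∃ c, ∀ z ∉ (per τ).lattice, f z = c := by
    refine elliptic_eq_const hτ (fun z hz => ?_) (fun z _ => hfper z 1 (one_mem_lattice τ))
      (fun z _ => hfper z τ (tau_mem_lattice hτ)) ⟨C, ?_⟩
    · by_cases hzh : z + h ∈ (per τ).lattice
      · have hpunct : ∀ᶠ w in 𝓝[≠] z, w + h ∉ (per τ).lattice ∧ w ∉ (per τ).lattice := by
          filter_upwards [(tendsto_sub_nhdsNE z).eventually (punctured_notMem_lattice τ),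
            nhdsWithin_le_nhds ((per τ).isClosed_lattice.isOpen_compl.mem_nhds hz)] with w hw hw2
          refine ⟨fun hmem => hw ?_, hw2⟩
          have := sub_mem hmem hzh
          rwa [add_sub_add_right_eq_sub] at this
        refine (Complex.analyticAt_of_differentiable_on_punctured_nhds_of_continuousAt ?_
          ?_).differentiableAt
        · filter_upwards [hpunct] with w hw
          exact (hgd w hw.2 hw.1).congr_of_eventuallyEq (hfg w hw.1)
        · rw [continuousAt_iff_punctured_nhds]
          have hfz : f z = C := if_pos hzh
          rw [hfz]
          refine (hlim.comp (tendsto_sub_nhdsNE z)).congr' ?_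
          filter_upwards [hpunct] with w hw
          have e1 : f w = g w := if_neg hw.1
          rw [e1, Function.comp, ← hsymm (w - z), ← hgper _ (z + h - 2 * h) (sub_mem hzh h2)]
          congr 1; ring
      · exact (hgd z hz hzh).congr_of_eventuallyEq (hfg z hzh)
    · refine hlim.congr' ?_
      have : ∀ᶠ w in 𝓝 (0 : ℂ), w + h ∉ (per τ).lattice :=
        hopen.mem_nhds (by simpa using h1)
      filter_upwards [nhdsWithin_le_nhds this] with w hw
      exact (if_neg hw).symm
  obtain ⟨c, hc⟩ := key
  have hneg : -h ∉ (per τ).lattice := fun hm => h1 (by simpa using neg_mem hm)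
  have e1 := hc (-h) hneg
  have e2 := hc z hz
  simp only [f, neg_add_cancel, zero_mem, if_true, hzh, if_false] at e1 e2
  exact e2.trans e1.symm

/-- If the constant were zero, ℘(w + h) = ℘(h) for w near 0, since ℘(w) is large there; ℘ would then
be constant by the identity theorem. -/
theorem wp_half_double_root (hτ : 0 < τ.im) (h1 : h ∉ (per τ).lattice)
    (h2 : 2 * h ∈ (per τ).lattice) : 3 * wp h τ ^ 2 - g2 τ / 4 ≠ 0 := by
  intro hC
  have han1 : AnalyticOnNhd ℂ (fun w => wp w τ) ((per τ).lattice : Set ℂ)ᶜ :=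
    DifferentiableOn.analyticOnNhd
      (fun w hw => (hasDerivAt_wp hw).differentiableAt.differentiableWithinAt)
      (per τ).isClosed_lattice.isOpen_compl
  have hne : ∀ᶠ w in 𝓝[≠] (0 : ℂ), wp w τ ≠ wp h τ := by
    have t1 := (tendsto_sq_mul_wp hτ)
    have t2 : Tendsto (fun z : ℂ => z ^ 2 * wp h τ) (𝓝[≠] 0) (𝓝 0) :=
      tendsto_nhdsNE_of_continuousAt (by fun_prop) (by simp)
    have t3 := (t1.sub t2).eventually_ne (by norm_num : (1 : ℂ) - 0 ≠ 0)
    filter_upwards [t3] with w hw heq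
    exact hw (by rw [heq, sub_self])
  have hopen : ∀ᶠ w in 𝓝 (0 : ℂ), w + h ∉ (per τ).lattice :=
    ((per τ).isClosed_lattice.isOpen_compl.preimage
      (by fun_prop : Continuous fun w : ℂ => w + h)).mem_nhds (by simpa using h1)
  have hconst : ∀ᶠ w in 𝓝[≠] (0 : ℂ), wp (w + h) τ = wp h τ := by
    filter_upwards [hne, nhdsWithin_le_nhds hopen, punctured_notMem_lattice τ] with w hw1 hw2 hw3
    have := wp_add_half hτ h1 h2 hw3 hw2
    rw [hC] at this
    exact sub_eq_zero.mp ((mul_eq_zero.mp this).resolve_right (sub_ne_zero.mpr hw1))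
  have hconst' : ∀ᶠ w in 𝓝 (0 : ℂ), wp (w + h) τ = wp h τ := by
    rw [← nhdsNE_sup_pure, eventually_sup]
    exact ⟨hconst, by simp⟩
  have hsub : Tendsto (fun w => w - h) (𝓝 h) (𝓝 0) := by
    have : ContinuousAt (fun w : ℂ => w - h) h := by fun_prop
    simpa [ContinuousAt] using this
  have hev : (fun w => wp w τ) =ᶠ[𝓝 h] fun _ => wp h τ := by
    filter_upwards [hsub.eventually hconst'] with w hw
    rwa [sub_add_cancel] at hw
  have hEq := han1.eqOn_of_preconnected_of_eventuallyEq analyticOnNhd_const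
    (isPreconnected_compl_lattice τ) h1 hev
  obtain ⟨z, hz, hgt⟩ := exists_norm_wp_gt hτ ‖wp h τ‖
  have := hEq hz
  simp only at this
  rw [this] at hgt
  exact lt_irrefl _ hgt

theorem wp'_add_half (hτ : 0 < τ.im) (h1 : h ∉ (per τ).lattice) (h2 : 2 * h ∈ (per τ).lattice)
    {z : ℂ} (hz : z ∉ (per τ).lattice) (hzh : z + h ∉ (per τ).lattice) :
    wp' (z + h) τ * (wp z τ - wp h τ) + (wp (z + h) τ - wp h τ) * wp' z τ = 0 := by
  have hd := (((hasDerivAt_wp hzh).comp_add_const z h).sub_const (wp h τ)).mul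
      ((hasDerivAt_wp hz).sub_const (wp h τ))
  have hopen : IsOpen {w : ℂ | w + h ∉ (per τ).lattice} :=
    (per τ).isClosed_lattice.isOpen_compl.preimage (by fun_prop : Continuous fun w : ℂ => w + h)
  refine hd.unique ((hasDerivAt_const z (3 * wp h τ ^ 2 - g2 τ / 4)).congr_of_eventuallyEq ?_)
  filter_upwards [(per τ).isClosed_lattice.isOpen_compl.mem_nhds hz, hopen.mem_nhds hzh]
    with w hw1 hw2
  exact wp_add_half hτ h1 h2 hw1 hw2

end HalfPeriod

/-- If w were omitted, 1/(℘ - w) would be elliptic without poles, hence constant, contradicting the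
unboundedness of ℘. -/
theorem exists_wp_eq {τ : ℂ} (hτ : 0 < τ.im) (w : ℂ) : ∃ z ∉ (per τ).lattice, wp z τ = w := by
  by_contra! hne
  have hlim : Tendsto (fun z => (wp z τ - w)⁻¹) (𝓝[≠] 0) (𝓝 0) := by
    have t2 : Tendsto (fun z : ℂ => z ^ 2 * w) (𝓝[≠] 0) (𝓝 0) :=
      tendsto_nhdsNE_of_continuousAt (by fun_prop) (by simp)
    have t3 : Tendsto (fun z : ℂ => z ^ 2) (𝓝[≠] 0) (𝓝 0) :=
      tendsto_nhdsNE_of_continuousAt (by fun_prop) (by simp)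
    have t4 := t3.mul (((tendsto_sq_mul_wp hτ).sub t2).inv₀ (by norm_num))
    rw [zero_mul] at t4
    refine t4.congr' ?_
    filter_upwards [self_mem_nhdsWithin] with z hz
    have hz : z ≠ 0 := hz
    rw [← mul_sub, mul_inv, mul_inv_cancel_left₀ (pow_ne_zero 2 hz)]
  obtain ⟨c, hc⟩ := elliptic_eq_const hτ (f := fun z => (wp z τ - w)⁻¹)
    (fun z hz => (((hasDerivAt_wp hz).sub_const w).fun_inv
      (sub_ne_zero.mpr (hne z hz))).differentiableAt)
    (fun z _ => by rw [wp_add (one_mem_lattice τ)])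
    (fun z _ => by rw [wp_add (tau_mem_lattice hτ)]) ⟨0, hlim⟩
  obtain ⟨z, hz, hgt⟩ := exists_norm_wp_gt hτ ‖wp (1 / 2) τ‖
  have h1 := (hc z hz).trans (hc (1 / 2) (half_mem_wpDomain hτ).2).symm
  have h2 : wp z τ = wp (1 / 2) τ := sub_left_injective (inv_injective h1)
  rw [h2] at hgt
  exact lt_irrefl _ hgt

/-! ### The values `e_k` -/

theorem halfPeriod_one (τ : ℂ) : halfPeriod 1 τ = 1 / 2 := rfl

theorem halfPeriod_two (τ : ℂ) : halfPeriod 2 τ = τ / 2 := rfl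

theorem halfPeriod_three (τ : ℂ) : halfPeriod 3 τ = (1 + τ) / 2 := rfl

theorem halfPeriod_notMem {τ : ℂ} (hτ : 0 < τ.im) {k : Fin 4} (hk : k ≠ 0) :
    halfPeriod k τ ∉ (per τ).lattice := by
  fin_cases k
  · exact absurd rfl hk
  · exact (half_mem_wpDomain hτ).2
  · exact (tau_half_mem_wpDomain hτ).2
  · have := ((per τ).mul_ω₁_add_mul_ω₂_mem_lattice (α := 1 / 2) (β := 1 / 2)).not.mpr (by norm_num)
    rw [per_omega1, per_omega2 hτ] at this
    have h3 : halfPeriod 3 τ = ((1 / 2 : ℚ) : ℂ) * 1 + ((1 / 2 : ℚ) : ℂ) * τ := by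
      rw [halfPeriod_three]; push_cast; ring
    rw [← h3] at this
    exact this

theorem two_mul_halfPeriod_mem {τ : ℂ} (hτ : 0 < τ.im) (k : Fin 4) :
    2 * halfPeriod k τ ∈ (per τ).lattice := by
  rw [halfPeriod, mul_div_cancel₀ _ two_ne_zero]
  fin_cases k
  · exact zero_mem _
  · exact one_mem_lattice τ
  · exact tau_mem_lattice hτ
  · exact add_mem (one_mem_lattice τ) (tau_mem_lattice hτ)

theorem wp_half_ne {τ h h' : ℂ} (hτ : 0 < τ.im) (h1 : h ∉ (per τ).lattice)
    (h2 : 2 * h ∈ (per τ).lattice) (h1' : h' ∉ (per τ).lattice) (hadd : h' + h ∉ (per τ).lattice) :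
    wp h' τ ≠ wp h τ := by
  intro heq
  have := wp_add_half hτ h1 h2 h1' hadd
  rw [heq, sub_self, mul_zero] at this
  exact wp_half_double_root hτ h1 h2 this.symm

theorem e_ne {τ : ℂ} (hτ : 0 < τ.im) : e 2 τ ≠ e 1 τ ∧ e 3 τ ≠ e 1 τ ∧ e 3 τ ≠ e 2 τ := by
  have n1 := halfPeriod_notMem hτ (show (1 : Fin 4) ≠ 0 by decide)
  have n2 := halfPeriod_notMem hτ (show (2 : Fin 4) ≠ 0 by decide)
  have n3 := halfPeriod_notMem hτ (show (3 : Fin 4) ≠ 0 by decide)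
  have h1 := two_mul_halfPeriod_mem hτ 1
  have h2 := two_mul_halfPeriod_mem hτ 2
  refine ⟨wp_half_ne hτ n1 h1 n2 ?_, wp_half_ne hτ n1 h1 n3 ?_, wp_half_ne hτ n2 h2 n3 ?_⟩
  · rw [show halfPeriod 2 τ + halfPeriod 1 τ = halfPeriod 3 τ by
      rw [halfPeriod_one, halfPeriod_two, halfPeriod_three]; ring]
    exact n3
  · intro hm
    refine n2 ?_
    have := sub_mem hm h1
    rwa [show halfPeriod 3 τ + halfPeriod 1 τ - 2 * halfPeriod 1 τ = halfPeriod 2 τ by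
      rw [halfPeriod_one, halfPeriod_two, halfPeriod_three]; ring] at this
  · intro hm
    refine n1 ?_
    have := sub_mem hm h2
    rwa [show halfPeriod 3 τ + halfPeriod 2 τ - 2 * halfPeriod 2 τ = halfPeriod 1 τ by
      rw [halfPeriod_one, halfPeriod_two, halfPeriod_three]; ring] at this

/-- The cubic polynomial `4 W³ - g₂ W - g₃`. -/
def cubic (W τ : ℂ) : ℂ := 4 * W ^ 3 - g2 τ * W - g3 τ

/-- The derivative `12 W² - g₂` of the cubic polynomial. -/
def cubic' (W τ : ℂ) : ℂ := 12 * W ^ 2 - g2 τ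

theorem cubic_e {τ : ℂ} (hτ : 0 < τ.im) {k : Fin 4} (hk : k ≠ 0) : cubic (e k τ) τ = 0 := by
  have := wp'_sq (halfPeriod_notMem hτ hk)
  rw [wp'_half (two_mul_halfPeriod_mem hτ k)] at this
  rw [cubic, e]
  linear_combination -this

theorem vieta {τ : ℂ} (hτ : 0 < τ.im) : e 3 τ = -e 1 τ - e 2 τ ∧
    g2 τ = 4 * (e 1 τ ^ 2 + e 1 τ * e 2 τ + e 2 τ ^ 2) ∧
    g3 τ = -4 * e 1 τ * e 2 τ * (e 1 τ + e 2 τ) := by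
  obtain ⟨h21, h31, h32⟩ := e_ne hτ
  have c1 := cubic_e hτ (show (1 : Fin 4) ≠ 0 by decide)
  have c2 := cubic_e hτ (show (2 : Fin 4) ≠ 0 by decide)
  have c3 := cubic_e hτ (show (3 : Fin 4) ≠ 0 by decide)
  rw [cubic] at c1 c2 c3
  -- The cubic minus 4(W - e₁)(W - e₂)(W - e₃) is a quadratic with the three distinct zeros e_k.
  obtain ⟨ha, hb, hd⟩ := quadratic_eq_zero (x := e 1 τ) (y := e 2 τ) (w := e 3 τ)
    (a := 4 * (e 1 τ + e 2 τ + e 3 τ))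
    (b := -g2 τ - 4 * (e 1 τ * e 2 τ + e 1 τ * e 3 τ + e 2 τ * e 3 τ))
    (d := -g3 τ + 4 * e 1 τ * e 2 τ * e 3 τ) h21.symm h31.symm h32.symm
    (by linear_combination c1) (by linear_combination c2) (by linear_combination c3)
  have h3 : e 3 τ = -e 1 τ - e 2 τ := by linear_combination ha / 4
  refine ⟨h3, ?_, ?_⟩
  · rw [h3] at hb; linear_combination -hb
  · rw [h3] at hd; linear_combination -hd

theorem cubic_eq {τ : ℂ} (hτ : 0 < τ.im) (W : ℂ) :
    cubic W τ = 4 * (W - e 1 τ) * (W - e 2 τ) * (W - e 3 τ) := by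
  obtain ⟨h3, h2, h1⟩ := vieta hτ
  rw [cubic, h3, h2, h1]; ring

/-- The cubic polynomial has no double root. -/
theorem cubic'_ne_zero {W τ : ℂ} (hτ : 0 < τ.im) (h : cubic W τ = 0) : cubic' W τ ≠ 0 := by
  obtain ⟨h21, h31, h32⟩ := e_ne hτ
  obtain ⟨v3, v2, v1⟩ := vieta hτ
  have hder : cubic' W τ = 4 * ((W - e 2 τ) * (W - e 3 τ) + (W - e 1 τ) * (W - e 3 τ)
      + (W - e 1 τ) * (W - e 2 τ)) := by
    rw [cubic', v3, v2]; ring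
  rw [cubic_eq hτ, mul_eq_zero, mul_eq_zero, mul_eq_zero] at h
  rw [hder]
  rcases h with ((h | h) | h) | h
  · norm_num at h
  · rw [h, sub_eq_zero.mp h]
    have := mul_ne_zero (sub_ne_zero.mpr h21.symm) (sub_ne_zero.mpr h31.symm)
    simpa using this
  · rw [h, sub_eq_zero.mp h]
    have := mul_ne_zero (sub_ne_zero.mpr h21) (sub_ne_zero.mpr h32.symm)
    simpa using this
  · rw [h, sub_eq_zero.mp h]
    have := mul_ne_zero (sub_ne_zero.mpr h31) (sub_ne_zero.mpr h32)
    simpa using this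

theorem notMem_of_two_mul_notMem {z τ : ℂ} (h : 2 * z ∉ (per τ).lattice) :
    z ∉ (per τ).lattice := fun hz => h (by rw [two_mul]; exact add_mem hz hz)

theorem add_halfPeriod_notMem {z τ : ℂ} (hτ : 0 < τ.im) (h : 2 * z ∉ (per τ).lattice)
    (k : Fin 4) : z + halfPeriod k τ ∉ (per τ).lattice := by
  intro hm
  refine h ?_
  have := sub_mem (add_mem hm hm) (two_mul_halfPeriod_mem hτ k)
  rwa [show z + halfPeriod k τ + (z + halfPeriod k τ) - 2 * halfPeriod k τ = 2 * z by ring] at this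

theorem wp_ne_e {z τ : ℂ} (hτ : 0 < τ.im) (h : 2 * z ∉ (per τ).lattice) {k : Fin 4} (hk : k ≠ 0) :
    wp z τ ≠ e k τ := by
  intro heq
  have hn := halfPeriod_notMem hτ hk
  have h2 := two_mul_halfPeriod_mem hτ k
  have := wp_add_half hτ hn h2 (notMem_of_two_mul_notMem h) (add_halfPeriod_notMem hτ h k)
  rw [heq, e, sub_self, mul_zero] at this
  exact wp_half_double_root hτ hn h2 this.symm

theorem wp'_ne_zero {z τ : ℂ} (hτ : 0 < τ.im) (h : 2 * z ∉ (per τ).lattice) : wp' z τ ≠ 0 := by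
  intro h0
  have := wp'_sq (notMem_of_two_mul_notMem h)
  have h1 : cubic (wp z τ) τ = 0 := by rw [cubic, ← this, h0]; ring
  rw [cubic_eq hτ] at h1
  have n1 := sub_ne_zero.mpr (wp_ne_e hτ h (show (1 : Fin 4) ≠ 0 by decide))
  have n2 := sub_ne_zero.mpr (wp_ne_e hτ h (show (2 : Fin 4) ≠ 0 by decide))
  have n3 := sub_ne_zero.mpr (wp_ne_e hτ h (show (3 : Fin 4) ≠ 0 by decide))
  exact mul_ne_zero (mul_ne_zero (mul_ne_zero (by norm_num : (4 : ℂ) ≠ 0) n1) n2) n3 h1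

/-- ℘' vanishes at the half periods, so their motion with τ does not contribute. -/
theorem hasDerivAt_e {τ : ℂ} (hτ : 0 < τ.im) {k : Fin 4} (hk : k ≠ 0) :
    HasDerivAt (e k) (heatC * (-4 * e k τ ^ 2 + 4 * eta1 τ * e k τ + 2 / 3 * g2 τ)) τ := by
  have hd : DifferentiableAt ℂ (fun t => halfPeriod k t) τ := by
    unfold halfPeriod
    fin_cases k <;> simp
    fun_prop
  have := hasDerivAt_wp_curve (a := fun t => halfPeriod k t) ⟨hτ, halfPeriod_notMem hτ hk⟩
    hd.hasDerivAt
  rw [wp'_half (two_mul_halfPeriod_mem hτ k), zero_mul, zero_add] at this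
  exact this

/-! ### The functions `℘(r+sτ|τ)`, `℘'(r+sτ|τ)` and `Z_{r,s}(τ)` -/

/-- `℘(r+sτ|τ)`. -/
def wpRS (r s τ : ℂ) : ℂ := wp (r + s * τ) τ

/-- `℘'(r+sτ|τ)`. -/
def wpRS' (r s τ : ℂ) : ℂ := wp' (r + s * τ) τ

/-- The Legendre relation trades η₂ for η₁. The added 2πis turns the velocity s into part of -2cZ,
so the derivatives of Z, ℘, ℘' along r + sτ no longer mention s. -/
theorem Z_eq {τ : ℂ} (hτ : 0 < τ.im) (r s : ℂ) :
    Z r s τ = psi (r + s * τ) τ + 2 * Real.pi * Complex.I * s := by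
  rw [Z, psi]
  linear_combination s * legendre hτ

section Curve

variable {r s τ : ℂ}

theorem hasDerivAt_line (r s τ : ℂ) : HasDerivAt (fun t => r + s * t) s τ := by
  simpa using ((hasDerivAt_id τ).const_mul s).const_add r

theorem hasDerivAt_Z (hp : (r + s * τ, τ) ∈ wpDomain) : HasDerivAt (Z r s)
    (heatC * (2 * Z r s τ * (wpRS r s τ + eta1 τ) + wpRS' r s τ)) τ := by
  have h1 := (hasDerivAt_psi_curve hp (hasDerivAt_line r s τ)).add_const
    (2 * Real.pi * Complex.I * s)
  refine (h1.congr_of_eventuallyEq ?_).congr_deriv ?_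
  · filter_upwards [eventually_curve_mem isOpen_wpDomain
      (hasDerivAt_line r s τ).continuousAt hp] with t ht
    exact Z_eq ht.1 r s
  · rw [Z_eq hp.1, wpRS, wpRS']
    linear_combination -(wp (r + s * τ) τ + eta1 τ) * s * heatC_mul

theorem hasDerivAt_wpRS (hp : (r + s * τ, τ) ∈ wpDomain) : HasDerivAt (wpRS r s)
    (heatC * (-4 * wpRS r s τ ^ 2 + 4 * eta1 τ * wpRS r s τ + 2 / 3 * g2 τ
      - 2 * Z r s τ * wpRS' r s τ)) τ := by
  refine (hasDerivAt_wp_curve hp (hasDerivAt_line r s τ)).congr_deriv ?_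
  rw [Z_eq hp.1, wpRS, wpRS']
  linear_combination wp' (r + s * τ) τ * s * heatC_mul

theorem hasDerivAt_wpRS' (hp : (r + s * τ, τ) ∈ wpDomain) : HasDerivAt (wpRS' r s)
    (heatC * (6 * (eta1 τ - wpRS r s τ) * wpRS' r s τ
      - 2 * Z r s τ * (6 * wpRS r s τ ^ 2 - g2 τ / 2))) τ := by
  refine (hasDerivAt_wp'_curve hp (hasDerivAt_line r s τ)).congr_deriv ?_
  rw [Z_eq hp.1, wpRS, wpRS']
  linear_combination (6 * wp (r + s * τ) τ ^ 2 - g2 τ / 2) * s * heatC_mul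

/-- If `(r, s)` is not a pair of integers, then `r + sτ ∉ Λ_τ` outside a discrete set. -/
theorem eventually_line_mem_wpDomain (hrs : ¬∃ m n : ℤ, r = m ∧ s = n) (hτ : 0 < τ.im) :
    ∀ᶠ t in 𝓝[≠] τ, (r + s * t, t) ∈ wpDomain := by
  by_cases hp : (r + s * τ, τ) ∈ wpDomain
  · exact nhdsWithin_le_nhds (eventually_curve_mem isOpen_wpDomain
      (hasDerivAt_line r s τ).continuousAt hp)
  · have hmem : r + s * τ ∈ (per τ).lattice := by
      by_contra h
      exact hp ⟨hτ, h⟩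
    obtain ⟨m, n, hmn⟩ := (mem_lattice_iff hτ).mp hmem
    have hz : (r - m + (s - n) * τ) = 0 := by linear_combination -hmn
    have h1 := eventually_curve_mem (V := nearDomain) isOpen_nearDomain
      (hasDerivAt_line (r - m) (s - n) τ).continuousAt (by rw [hz]; exact zero_mem_nearDomain hτ)
    filter_upwards [nhdsWithin_le_nhds h1, self_mem_nhdsWithin] with t ht htne
    have hne : r - m + (s - n) * t ≠ 0 := by
      intro h0
      have h2 : (s - n) * (t - τ) = 0 := by linear_combination h0 - hz
      have h3 : s - n = 0 := (mul_eq_zero.mp h2).resolve_right (sub_ne_zero.mpr htne)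
      rw [h3, zero_mul, add_zero] at hz
      exact hrs ⟨m, n, sub_eq_zero.mp hz, sub_eq_zero.mp h3⟩
    have h4 : (r - m + (s - n) * t, t) ∈ wpDomain := by
      rw [wpDomain_eq]; exact ⟨ht, hne⟩
    have := add_mem_wpDomain h4 ((mem_lattice_iff ht.1).mpr ⟨m, n, rfl⟩)
    rwa [show r - m + (s - n) * t + (m + n * t) = r + s * t by ring] at this

end Curve

/-! ### Meromorphy in τ of ℘, ℘' and Z along r + sτ. -/

theorem analyticAt_curve {F : ℂ × ℂ → ℂ} {V : Set (ℂ × ℂ)} {a : ℂ → ℂ} {τ : ℂ} (hV : IsOpen V)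
    (hF : ContDiffOn ℂ ∞ F V) (ha : AnalyticAt ℂ a τ) (h : (a τ, τ) ∈ V) :
    AnalyticAt ℂ (fun t => F (a t, t)) τ := by
  refine Complex.analyticAt_iff_eventually_differentiableAt.mpr ?_
  filter_upwards [eventually_curve_mem hV ha.continuousAt h, ha.eventually_analyticAt]
    with t ht ha'
  exact (hasDerivAt_curve (ContDiffOn.diffAt hV hF ht)
    ha'.differentiableAt.hasDerivAt).differentiableAt

theorem analyticAt_line (r s τ : ℂ) : AnalyticAt ℂ (fun t => r + s * t) τ := by fun_prop

/-- Where r + sτ meets a lattice point m + nτ, periodicity translates the argument to (r - m) + (s -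
n)τ, near 0. There F = k/z^j + G, with an affine z that is not identically zero. -/
theorem meromorphicAt_curve {F G : ℂ × ℂ → ℂ} {k : ℂ} {j : ℕ} {r s τ : ℂ}
    (hF : ContDiffOn ℂ ∞ F wpDomain) (hG : ContDiffOn ℂ ∞ G nearDomain)
    (hper : ∀ z t, ∀ l ∈ (per t).lattice, F (z + l, t) = F (z, t))
    (hFG : ∀ p ∈ wpDomain, F p = k / p.1 ^ j + G p)
    (hrs : ¬∃ m n : ℤ, r = m ∧ s = n) (hτ : 0 < τ.im) :
    MeromorphicAt (fun t => F (r + s * t, t)) τ := by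
  by_cases hp : (r + s * τ, τ) ∈ wpDomain
  · exact (analyticAt_curve isOpen_wpDomain hF (analyticAt_line r s τ) hp).meromorphicAt
  · have hmem : r + s * τ ∈ (per τ).lattice := by
      by_contra h
      exact hp ⟨hτ, h⟩
    obtain ⟨m, n, hmn⟩ := (mem_lattice_iff hτ).mp hmem
    have hz : (r - m + (s - n) * τ) = 0 := by linear_combination -hmn
    have h1 := analyticAt_curve isOpen_nearDomain hG (analyticAt_line (r - m) (s - n) τ)
      (by rw [hz]; exact zero_mem_nearDomain hτ)
    have h2 : MeromorphicAt (fun t => k / (r - m + (s - n) * t) ^ j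
        + G (r - m + (s - n) * t, t)) τ :=
      ((MeromorphicAt.const k τ).fun_div
        ((analyticAt_line (r - m) (s - n) τ).meromorphicAt.fun_pow j)).fun_add h1.meromorphicAt
    refine h2.congr ?_
    filter_upwards [eventually_line_mem_wpDomain hrs hτ] with t ht
    have hl : (-(m + n * t) : ℂ) ∈ (per t).lattice :=
      neg_mem ((mem_lattice_iff ht.1).mpr ⟨m, n, rfl⟩)
    have h3 := hper (r + s * t) t _ hl
    have h4 := hFG _ (add_mem_wpDomain ht hl)
    rw [h3] at h4
    rw [h4]
    simp only
    rw [show r + s * t + -(m + n * t) = r - m + (s - n) * t by ring]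

section Meromorphic

variable {r s τ : ℂ}

theorem meromorphicAt_wpRS (hrs : ¬∃ m n : ℤ, r = m ∧ s = n) (hτ : 0 < τ.im) :
    MeromorphicAt (wpRS r s) τ :=
  meromorphicAt_curve (F := fun p => wp p.1 p.2) (G := fun p => -dz zetaReg p) (k := 1) (j := 2)
    contDiffOn_wp (contDiffOn_dz isOpen_nearDomain contDiffOn_zetaReg).neg
    (fun _ _ _ hl => wp_add hl)
    (fun p hp => by rw [wp_eq_near (z := p.1) (τ := p.2) hp, sub_eq_add_neg]) hrs hτ

theorem meromorphicAt_wpRS' (hrs : ¬∃ m n : ℤ, r = m ∧ s = n) (hτ : 0 < τ.im) :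
    MeromorphicAt (wpRS' r s) τ :=
  meromorphicAt_curve (F := fun p => wp' p.1 p.2) (G := fun p => -dz (dz zetaReg) p)
    (k := -2) (j := 3) contDiffOn_wp'
    (contDiffOn_dz isOpen_nearDomain (contDiffOn_dz isOpen_nearDomain contDiffOn_zetaReg)).neg
    (fun _ _ _ hl => wp'_add hl)
    (fun p hp => by rw [wp'_eq_near (z := p.1) (τ := p.2) hp, sub_eq_add_neg]) hrs hτ

theorem analyticAt_eta1 (hτ : 0 < τ.im) : AnalyticAt ℂ eta1 τ :=
  Complex.analyticAt_iff_eventually_differentiableAt.mpr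
    (((isOpen_lt continuous_const Complex.continuous_im).eventually_mem hτ).mono
      fun _ => differentiableAt_eta1)

theorem analyticAt_g2 (hτ : 0 < τ.im) : AnalyticAt ℂ g2 τ :=
  Complex.analyticAt_iff_eventually_differentiableAt.mpr
    (((isOpen_lt continuous_const Complex.continuous_im).eventually_mem hτ).mono
      fun _ => differentiableAt_g2)

theorem analyticAt_g3 (hτ : 0 < τ.im) : AnalyticAt ℂ g3 τ :=
  Complex.analyticAt_iff_eventually_differentiableAt.mpr
    (((isOpen_lt continuous_const Complex.continuous_im).eventually_mem hτ).mono
      fun _ => differentiableAt_g3)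

theorem not_int_of_not_half_int (hrs : ¬∃ m n : ℤ, r = (m : ℂ) / 2 ∧ s = (n : ℂ) / 2) :
    ¬∃ m n : ℤ, r = m ∧ s = n := by
  rintro ⟨m, n, rfl, rfl⟩
  exact hrs ⟨2 * m, 2 * n, by push_cast; ring, by push_cast; ring⟩

/-- If `(r, s)` is not a pair of half integers, then `2(r + sτ) ∉ Λ_τ` outside a discrete set. -/
theorem eventually_two_mul_line_notMem
    (hrs : ¬∃ m n : ℤ, r = (m : ℂ) / 2 ∧ s = (n : ℂ) / 2) (hτ : 0 < τ.im) :
    ∀ᶠ t in 𝓝[≠] τ, 0 < t.im ∧ 2 * (r + s * t) ∉ (per t).lattice := by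
  have : ¬∃ m n : ℤ, 2 * r = m ∧ 2 * s = n := by
    rintro ⟨m, n, hm, hn⟩
    exact hrs ⟨m, n, by rw [← hm]; ring, by rw [← hn]; ring⟩
  filter_upwards [eventually_line_mem_wpDomain this hτ] with t ht
  refine ⟨ht.1, fun h => ht.2 ?_⟩
  simp only
  rwa [show 2 * r + 2 * s * t = 2 * (r + s * t) by ring]

/-- The formula for the derivative of ℘(r + sτ) is solved for Z. This needs ℘' ≠ 0 off a discrete
set, which is where (r, s) ∉ ½ℤ² enters. -/
theorem meromorphicAt_Z (hrs : ¬∃ m n : ℤ, r = (m : ℂ) / 2 ∧ s = (n : ℂ) / 2) (hτ : 0 < τ.im) :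
    MeromorphicAt (Z r s) τ := by
  have hP := meromorphicAt_wpRS (not_int_of_not_half_int hrs) hτ
  have hQ := meromorphicAt_wpRS' (not_int_of_not_half_int hrs) hτ
  have h1 := (analyticAt_eta1 hτ).meromorphicAt
  have h2 := (analyticAt_g2 hτ).meromorphicAt
  have h3 := hP.deriv
  have : MeromorphicAt (fun t => (-4 * wpRS r s t ^ 2 + 4 * eta1 t * wpRS r s t + 2 / 3 * g2 t
      - deriv (wpRS r s) t / heatC) / (2 * wpRS' r s t)) τ := by
    fun_prop
  refine this.congr ?_
  filter_upwards [eventually_two_mul_line_notMem hrs hτ] with t ht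
  have hd := (hasDerivAt_wpRS (r := r) (s := s) ⟨ht.1, notMem_of_two_mul_notMem ht.2⟩).deriv
  have hQ0 : wpRS' r s t ≠ 0 := wp'_ne_zero ht.1 ht.2
  have hc := heatC_ne_zero
  rw [hd]
  field_simp
  ring

end Meromorphic

/-! ### The Hamiltonian system of Painlevé VI in the variable `τ` -/

/-- The pair `W = e₁ + (e₂ - e₁) λ`, `M = μ / (e₂ - e₁)` is meromorphic at `x` and solves the
Hamiltonian system of Painlevé VI with `θ₁ = θ₂ = θ₃ = θ` and `ρ = 4 θ₀ (θ₀ + θ₄)`, written in the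
variable `τ`. -/
structure SolvesHam (θ ρ : ℂ) (W M : ℂ → ℂ) (x : ℂ) : Prop where
  merW : MeromorphicAt W x
  merM : MeromorphicAt M x
  im_pos : 0 < x.im
  ev : ∀ᶠ τ in 𝓝[≠] x, 0 < τ.im ∧
    HasDerivAt W (heatC * (4 * eta1 τ * W τ + 2 / 3 * g2 τ - 4 * W τ ^ 2
      - 2 * cubic (W τ) τ * M τ + θ * cubic' (W τ) τ)) τ ∧
    HasDerivAt M (heatC * (-4 * eta1 τ * M τ + 8 * W τ * M τ + cubic' (W τ) τ * M τ ^ 2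
      - 24 * θ * W τ * M τ + ρ)) τ

theorem eventually_deriv_eq_zero {F D : ℂ → ℂ} {x : ℂ} (h0 : ∀ᶠ τ in 𝓝[≠] x, F τ = 0)
    (hD : ∀ᶠ τ in 𝓝[≠] x, HasDerivAt F (D τ) τ) : ∀ᶠ τ in 𝓝[≠] x, D τ = 0 := by
  have h1 := eventually_eventually_nhdsWithin.mpr h0
  filter_upwards [h1, hD, self_mem_nhdsWithin] with τ ht hd hne
  have hne : τ ≠ x := hne
  rw [hne.nhdsWithin_compl_singleton] at ht
  exact hd.unique ((hasDerivAt_const τ (0 : ℂ)).congr_of_eventuallyEq ht)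

/-- A meromorphic function vanishes identically near x or nowhere on a punctured neighbourhood; the
first case would force D = 0 at its zeros. -/
theorem MeromorphicAt.eventually_ne_zero_of_deriv {F D : ℂ → ℂ} {x : ℂ} (hF : MeromorphicAt F x)
    (hD : ∀ᶠ τ in 𝓝[≠] x, HasDerivAt F (D τ) τ)
    (h : ∀ᶠ τ in 𝓝[≠] x, F τ = 0 → D τ ≠ 0) : ∀ᶠ τ in 𝓝[≠] x, F τ ≠ 0 := by
  refine hF.eventually_eq_zero_or_eventually_ne_zero.resolve_left fun h0 => ?_
  obtain ⟨τ, h1, h2, h3⟩ := ((eventually_deriv_eq_zero h0 hD).and (h.and h0)).exists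
  exact h2 h3 h1

theorem eventually_im_pos {x : ℂ} (hx : 0 < x.im) : ∀ᶠ τ in 𝓝[≠] x, 0 < τ.im :=
  nhdsWithin_le_nhds ((isOpen_lt continuous_const Complex.continuous_im).eventually_mem hx)

theorem hasDerivAt_cubic {W : ℂ → ℂ} {W' τ : ℂ} (hτ : 0 < τ.im) (hW : HasDerivAt W W' τ) :
    HasDerivAt (fun t => cubic (W t) t) (cubic' (W τ) τ * W'
      - heatC * (8 * eta1 τ * g2 τ - 12 * g3 τ) * W τ
      - heatC * (12 * eta1 τ * g3 τ - 2 / 3 * g2 τ ^ 2)) τ := by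
  have := (((hW.fun_pow 3).const_mul 4).sub ((hasDerivAt_g2 hτ).mul hW)).sub (hasDerivAt_g3 hτ)
  refine this.congr_deriv ?_
  rw [cubic']
  push_cast
  ring

theorem hasDerivAt_cubic' {W : ℂ → ℂ} {W' τ : ℂ} (hτ : 0 < τ.im) (hW : HasDerivAt W W' τ) :
    HasDerivAt (fun t => cubic' (W t) t) (24 * W τ * W'
      - heatC * (8 * eta1 τ * g2 τ - 12 * g3 τ)) τ := by
  have := ((hW.fun_pow 2).const_mul 12).sub (hasDerivAt_g2 hτ)
  refine this.congr_deriv ?_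
  push_cast
  ring

namespace SolvesHam

variable {θ ρ x : ℂ} {W M : ℂ → ℂ}

theorem merCubic (h : SolvesHam θ ρ W M x) : MeromorphicAt (fun τ => cubic (W τ) τ) x := by
  have h1 := h.merW
  have h2 := (analyticAt_g2 h.im_pos).meromorphicAt
  have h3 := (analyticAt_g3 h.im_pos).meromorphicAt
  unfold cubic
  fun_prop

theorem merCubic' (h : SolvesHam θ ρ W M x) : MeromorphicAt (fun τ => cubic' (W τ) τ) x := by
  have h1 := h.merW
  have h2 := (analyticAt_g2 h.im_pos).meromorphicAt
  unfold cubic'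
  fun_prop

theorem eventually_M_ne_zero (h : SolvesHam θ ρ W M x) (hρ : ρ ≠ 0) :
    ∀ᶠ τ in 𝓝[≠] x, M τ ≠ 0 := by
  refine MeromorphicAt.eventually_ne_zero_of_deriv h.merM (h.ev.mono fun _ ht => ht.2.2)
    (Eventually.of_forall fun τ h0 => ?_)
  rw [h0]
  simpa using ⟨heatC_ne_zero, hρ⟩

/-- Each e_k obeys the W-equation with θ = 0. On f(W) = 0 only the θ-term therefore survives, and
the derivative of f(W) is cθf'(W)², nonzero because the roots are simple. -/
theorem eventually_cubic_ne_zero (h : SolvesHam θ ρ W M x) (hθ : θ ≠ 0) :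
    ∀ᶠ τ in 𝓝[≠] x, cubic (W τ) τ ≠ 0 := by
  refine MeromorphicAt.eventually_ne_zero_of_deriv h.merCubic
    (h.ev.mono fun τ ht => hasDerivAt_cubic ht.1 ht.2.1) (h.ev.mono fun τ ht h0 => ?_)
  have hne := cubic'_ne_zero ht.1 h0
  have : cubic' (W τ) τ * (heatC * (4 * eta1 τ * W τ + 2 / 3 * g2 τ - 4 * W τ ^ 2
      - 2 * cubic (W τ) τ * M τ + θ * cubic' (W τ) τ))
      - heatC * (8 * eta1 τ * g2 τ - 12 * g3 τ) * W τ
      - heatC * (12 * eta1 τ * g3 τ - 2 / 3 * g2 τ ^ 2)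
      = heatC * θ * cubic' (W τ) τ ^ 2 := by
    have h0' := h0
    rw [cubic] at h0'
    rw [h0]
    simp only [cubic']
    linear_combination heatC * (12 * eta1 τ - 12 * W τ) * h0'
  rw [this]
  exact mul_ne_zero (mul_ne_zero heatC_ne_zero hθ) (pow_ne_zero 2 hne)

/-- The Okamoto transformation `κ₀`. -/
theorem kappa0 (h : SolvesHam θ ρ W M x) (hM : ∀ᶠ τ in 𝓝[≠] x, M τ ≠ 0) (θ₀ : ℂ)
    (hρ : ρ = 4 * θ₀ * (1 - θ₀ - 3 * θ)) :
    SolvesHam (θ + θ₀) (-4 * θ₀ * (1 - 2 * θ₀ - 3 * θ)) (fun τ => W τ + θ₀ / M τ) M x := by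
  -- Since 2θ₀ + 3θ + θ₄ = 1, the factor 1 - θ₀ - 3θ is θ₀ + θ₄. Thus ρ determines θ₀ only up to the
  -- exchange with θ₀ + θ₄, which is κ₄.
  refine ⟨h.merW.fun_add ((MeromorphicAt.const θ₀ x).fun_div h.merM), h.merM, h.im_pos, ?_⟩
  filter_upwards [h.ev, hM] with τ ht hM0
  obtain ⟨hτ, hW, hM'⟩ := ht
  refine ⟨hτ, (hW.add ((hasDerivAt_const τ θ₀).div hM' hM0)).congr_deriv ?_,
    hM'.congr_deriv ?_⟩
  · simp only [cubic, cubic', hρ]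
    field_simp
    ring
  · simp only [cubic', hρ]
    field_simp
    ring

/-- The composition `κ₃ κ₂ κ₁` of Okamoto transformations. -/
theorem kappa123 (h : SolvesHam θ ρ W M x) (hf : ∀ᶠ τ in 𝓝[≠] x, cubic (W τ) τ ≠ 0) (θ₀ : ℂ)
    (hρ : ρ = 4 * θ₀ * (1 - θ₀ - 3 * θ)) :
    SolvesHam (-θ) (4 * (θ₀ + 3 * θ) * (1 - θ₀)) W
      (fun τ => M τ - θ * cubic' (W τ) τ / cubic (W τ) τ) x := by
  refine ⟨h.merW, h.merM.fun_sub (((MeromorphicAt.const θ x).fun_mul h.merCubic').fun_div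
    h.merCubic), h.im_pos, ?_⟩
  filter_upwards [h.ev, hf] with τ ht hf0
  obtain ⟨hτ, hW, hM'⟩ := ht
  refine ⟨hτ, hW.congr_deriv ?_, ?_⟩
  · field_simp
    ring
  · have hd := hM'.sub (((hasDerivAt_cubic' hτ hW).const_mul θ).div (hasDerivAt_cubic hτ hW) hf0)
    refine hd.congr_deriv ?_
    -- Trading g₂, g₃ for the values f and f' makes the claim a rational identity in independent
    -- quantities.
    have h1 : g3 τ = 4 * W τ ^ 3 - g2 τ * W τ - cubic (W τ) τ := by rw [cubic]; ring
    have h2 : g2 τ = 12 * W τ ^ 2 - cubic' (W τ) τ := by rw [cubic']; ring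
    generalize cubic (W τ) τ = f at *
    generalize cubic' (W τ) τ = f' at *
    rw [h1, h2, hρ]
    field_simp
    ring

end SolvesHam

/-! ### The chain of Okamoto transformations -/

section Algebra

variable {X P Q g g' : ℂ}

/-- The first half of the chain of transformations, in terms of `X = Z`, `P = ℘`, `Q = ℘'`. -/
theorem chain_first (hg' : g' = 4 * P ^ 3 - g * P - Q ^ 2) (hX : X ≠ 0) (hQ : Q ≠ 0)
    {W₀ M₁ W₁ : ℂ} (hW₀ : W₀ = P + 1 / 2 / (X / Q))
    (hf₀ : 4 * W₀ ^ 3 - g * W₀ - g' ≠ 0)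
    (hM₁ : M₁ = X / Q - 1 / 2 * (12 * W₀ ^ 2 - g) / (4 * W₀ ^ 3 - g * W₀ - g'))
    (hM₁0 : M₁ ≠ 0) (hW₁ : W₁ = W₀ + 3 / 2 / M₁) :
    2 * Q * X ^ 3 + (12 * P ^ 2 - g) * X ^ 2 + 6 * P * Q * X + Q ^ 2 ≠ 0 ∧
    X ^ 3 - 3 * P * X - Q ≠ 0 ∧
    M₁ = 2 * X * (X ^ 3 - 3 * P * X - Q)
      / (2 * Q * X ^ 3 + (12 * P ^ 2 - g) * X ^ 2 + 6 * P * Q * X + Q ^ 2) ∧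
    W₁ = (4 * P * X ^ 4 + 8 * Q * X ^ 3 + (24 * P ^ 2 - 3 * g) * X ^ 2 + 8 * P * Q * X + Q ^ 2)
      / (4 * X * (X ^ 3 - 3 * P * X - Q)) := by
  have hW₀' : W₀ = (2 * P * X + Q) / (2 * X) := by rw [hW₀]; field_simp
  have hfe : 4 * W₀ ^ 3 - g * W₀ - g'
      = Q * (2 * Q * X ^ 3 + (12 * P ^ 2 - g) * X ^ 2 + 6 * P * Q * X + Q ^ 2) / (2 * X ^ 3) := by
    rw [hW₀', hg']; field_simp; ring
  have hA0 : 2 * Q * X ^ 3 + (12 * P ^ 2 - g) * X ^ 2 + 6 * P * Q * X + Q ^ 2 ≠ 0 := by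
    intro h0
    rw [h0] at hfe
    exact hf₀ (by rw [hfe]; simp)
  have hM₁e : M₁ = 2 * X * (X ^ 3 - 3 * P * X - Q)
      / (2 * Q * X ^ 3 + (12 * P ^ 2 - g) * X ^ 2 + 6 * P * Q * X + Q ^ 2) := by
    obtain ⟨A, hA⟩ : ∃ A, A = 2 * Q * X ^ 3 + (12 * P ^ 2 - g) * X ^ 2 + 6 * P * Q * X + Q ^ 2 :=
      ⟨_, rfl⟩
    rw [hM₁, hfe, hW₀']
    rw [← hA] at hA0 ⊢
    field_simp
    rw [hA]
    ring
  have hZ20 : X ^ 3 - 3 * P * X - Q ≠ 0 := by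
    intro h0
    rw [h0] at hM₁e
    exact hM₁0 (by rw [hM₁e]; simp)
  refine ⟨hA0, hZ20, hM₁e, ?_⟩
  obtain ⟨A, hA⟩ : ∃ A, A = 2 * Q * X ^ 3 + (12 * P ^ 2 - g) * X ^ 2 + 6 * P * Q * X + Q ^ 2 :=
    ⟨_, rfl⟩
  obtain ⟨Z₂, hZ₂⟩ : ∃ Z₂, Z₂ = X ^ 3 - 3 * P * X - Q := ⟨_, rfl⟩
  have key : 4 * P * X ^ 4 + 8 * Q * X ^ 3 + (24 * P ^ 2 - 3 * g) * X ^ 2 + 8 * P * Q * X + Q ^ 2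
      = 2 * (2 * P * X + Q) * Z₂ + 3 * A := by
    rw [hA, hZ₂]; ring
  rw [hW₁, hM₁e, hW₀', key]
  rw [← hA] at hA0 ⊢
  rw [← hZ₂] at hZ20 ⊢
  field_simp
  ring

/-- The second half of the chain of transformations. -/
theorem chain_second (hg' : g' = 4 * P ^ 3 - g * P - Q ^ 2) (hX : X ≠ 0)
    {M₁ W₁ M₂ W₂ Z₃ Ξ A Z₂ N : ℂ}
    (hA : A = 2 * Q * X ^ 3 + (12 * P ^ 2 - g) * X ^ 2 + 6 * P * Q * X + Q ^ 2)
    (hZ₂ : Z₂ = X ^ 3 - 3 * P * X - Q)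
    (hN : N = 4 * P * X ^ 4 + 8 * Q * X ^ 3 + (24 * P ^ 2 - 3 * g) * X ^ 2 + 8 * P * Q * X + Q ^ 2)
    (hZ₃ : Z₃ = X ^ 6 - 15 * P * X ^ 4 - 20 * Q * X ^ 3 + (27 / 4 * g - 45 * P ^ 2) * X ^ 2
      - 12 * P * Q * X - 5 / 4 * Q ^ 2)
    (hΞ : Ξ = 28 * Q * X ^ 6 + (288 * P ^ 2 - 24 * g) * X ^ 5 + 300 * P * Q * X ^ 4
      + (640 * P ^ 3 - 88 * g * P - 52 * g') * X ^ 3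
      + (180 * P ^ 2 - 3 * g) * Q * X ^ 2 + 24 * P * Q ^ 2 * X + Q ^ 3)
    (hA0 : A ≠ 0) (hZ₂0 : Z₂ ≠ 0) (hM₁ : M₁ = 2 * X * Z₂ / A) (hW₁ : W₁ = N / (4 * X * Z₂))
    (hf₁ : 4 * W₁ ^ 3 - g * W₁ - g' ≠ 0)
    (hM₂ : M₂ = M₁ - 1 * (12 * W₁ ^ 2 - g) / (4 * W₁ ^ 3 - g * W₁ - g'))
    (hM₂0 : M₂ ≠ 0) (hW₂ : W₂ = W₁ + 3 / 2 / M₂) :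
    Z₃ ≠ 0 ∧ W₂ = P + Ξ / (8 * X * Z₃) := by
  obtain ⟨F, hF⟩ : ∃ F, F = 12 * N ^ 2 - 16 * g * X ^ 2 * Z₂ ^ 2 := ⟨_, rfl⟩
  obtain ⟨C, hC⟩ : ∃ C, C = 2 * F + 16 * A * Z₃ := ⟨_, rfl⟩
  -- The factor A, the denominator of M₁, divides the numerator of f(W₁). With C = 2F + 16AZ₃ this
  -- cancels A from M₂ and leaves Z₃ in its numerator.
  have hB : 4 * N ^ 3 - 16 * g * N * X ^ 2 * Z₂ ^ 2 - 64 * g' * X ^ 3 * Z₂ ^ 3 = A * C := by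
    rw [hC, hF, hA, hN, hZ₂, hZ₃, hg']; ring
  have hfe : 4 * W₁ ^ 3 - g * W₁ - g' = A * C / (64 * X ^ 3 * Z₂ ^ 3) := by
    rw [← hB, hW₁]; field_simp; ring
  have hfe' : 12 * W₁ ^ 2 - g = F / (16 * X ^ 2 * Z₂ ^ 2) := by
    rw [hF, hW₁]; field_simp; ring
  have hC0 : C ≠ 0 := by
    intro h0
    rw [h0] at hfe
    exact hf₁ (by rw [hfe]; simp)
  have hM₂e : M₂ = 32 * X * Z₂ * Z₃ / C := by
    rw [hM₂, hfe, hfe', hM₁]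
    have hFC : F = (C - 16 * A * Z₃) / 2 := by rw [hC]; ring
    rw [hFC]
    field_simp
    ring
  have hZ₃0 : Z₃ ≠ 0 := by
    intro h0
    rw [h0] at hM₂e
    exact hM₂0 (by rw [hM₂e]; simp)
  refine ⟨hZ₃0, ?_⟩
  -- The numerator of W₂ - P is divisible by Z₂, and the quotient is Ξ up to a constant factor.
  have key : 2 * (N - 4 * P * X * Z₂) * Z₃ * 16 + 6 * C = 16 * Z₂ * Ξ := by
    rw [hC, hF, hA, hN, hZ₂, hZ₃, hΞ, hg']; ring
  rw [hW₂, hM₂e, hW₁]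
  field_simp
  linear_combination 16 * key

end Algebra

/-- Equality of θ₁, θ₂, θ₃ persists, so one formula covers both factors of the square in κ₅. -/
theorem kappa321_kappa0 (t a b f l m : ℂ) :
    (kappa3 t ∘ kappa2 ∘ kappa1 ∘ kappa0) ⟨![a, b, b, b, f], l, m⟩ =
      ⟨![-a + (b + a) + (b + a) + (b + a), -(b + a), -(b + a), -(b + a), f + a], l + a / m,
        m - (b + a) / (l + a / m) - (b + a) / (l + a / m - 1) - (b + a) / (l + a / m - t)⟩ :=
  rfl

/-- The `λ`-component of `κ₅` applied to a solution with parameter `θ⁰`. -/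
theorem kappa5_l (t l m m₁ l₁ m₂ : ℂ)
    (hm₁ : m₁ = m - 1 / 2 / l - 1 / 2 / (l - 1) - 1 / 2 / (l - t)) (hl₁ : l₁ = l + 3 / 2 / m₁)
    (hm₂ : m₂ = m₁ - 1 / l₁ - 1 / (l₁ - 1) - 1 / (l₁ - t)) :
    (kappa5 t ⟨theta0, l, m⟩).l = l₁ + 3 / 2 / m₂ := by
  have h4 : kappa4 ⟨theta0, l, m⟩
      = ⟨![-(1 / 2) + 1 / 2, 1 / 2, 1 / 2, 1 / 2, -(1 / 2)], l, m⟩ := rfl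
  -- After κ₄ one has θ₀ = 0, so the first κ₀ leaves λ unchanged. After each of the two blocks θ₀ is
  -- 3/2, which gives both numerators 3/2.
  have e0 : (-(1 / 2) + 1 / 2 : ℂ) = 0 := by norm_num
  have e1 : (-0 + (1 / 2 + 0) + (1 / 2 + 0) + (1 / 2 + 0) : ℂ) = 3 / 2 := by norm_num
  have e2 : (-(1 / 2 + 0) + 3 / 2 : ℂ) = 1 := by norm_num
  have e3 : (-(3 / 2) + 1 + 1 + 1 : ℂ) = 3 / 2 := by norm_num
  rw [kappa5, Function.comp_apply, Function.comp_apply, h4, e0, Function.iterate_succ_apply,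
    Function.iterate_one, kappa321_kappa0, e1, kappa321_kappa0, e2, e3, zero_div, add_zero, add_zero,
    add_zero, ← hm₁, ← hl₁, ← hm₂]
  rfl

/-- This is the logarithmic derivative of the cubic. It makes the product κ₃κ₂κ₁ symmetric in the
e_k. -/
theorem sum_inv_eq {τ W : ℂ} (hτ : 0 < τ.im) (hf : cubic W τ ≠ 0) :
    1 / (W - e 1 τ) + 1 / (W - e 2 τ) + 1 / (W - e 3 τ) = cubic' W τ / cubic W τ := by
  rw [cubic_eq hτ] at hf ⊢
  obtain ⟨h3, h2, -⟩ := vieta hτ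
  simp only [ne_eq, mul_eq_zero, not_or] at hf
  obtain ⟨⟨⟨-, n1⟩, n2⟩, n3⟩ := hf
  rw [cubic', h2]
  rw [h3] at n3 ⊢
  field_simp
  ring

/-! ### Passage between (λ, μ, t) and (W, M, τ). -/

section Rescale

variable {τ : ℂ}

/-- λ, λ - 1 and λ - t are (W - e_k)/(e₂ - e₁) for k = 1, 2, 3. -/
theorem mul_inv_sub (hτ : 0 < τ.im) (θ W : ℂ) (hf : cubic W τ ≠ 0) :
    θ / ((W - e 1 τ) / (e 2 τ - e 1 τ)) + θ / ((W - e 1 τ) / (e 2 τ - e 1 τ) - 1)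
      + θ / ((W - e 1 τ) / (e 2 τ - e 1 τ) - tOf τ)
      = (e 2 τ - e 1 τ) * (θ * cubic' W τ / cubic W τ) := by
  rw [mul_div_assoc θ, ← sum_inv_eq hτ hf, tOf]
  rw [cubic_eq hτ] at hf
  simp only [ne_eq, mul_eq_zero, not_or] at hf
  obtain ⟨⟨⟨-, n1⟩, n2⟩, n3⟩ := hf
  have hD : e 2 τ - e 1 τ ≠ 0 := sub_ne_zero.mpr (e_ne hτ).1
  have h1 : (W - e 1 τ) / (e 2 τ - e 1 τ) - 1 = (W - e 2 τ) / (e 2 τ - e 1 τ) := by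
    field_simp; ring
  have h2 : (W - e 1 τ) / (e 2 τ - e 1 τ) - (e 3 τ - e 1 τ) / (e 2 τ - e 1 τ)
      = (W - e 3 τ) / (e 2 τ - e 1 τ) := by
    field_simp; ring
  rw [h1, h2]
  field_simp

/-- `κ₅` in the variables `W = e₁ + (e₂ - e₁) λ`, `M = μ / (e₂ - e₁)`. -/
theorem kappa5_rescaled (hτ : 0 < τ.im) {W₀ M₀ M₁ W₁ M₂ W₂ : ℂ} (hf₀ : cubic W₀ τ ≠ 0)
    (hf₁ : cubic W₁ τ ≠ 0)
    (hM₁ : M₁ = M₀ - 1 / 2 * cubic' W₀ τ / cubic W₀ τ) (hW₁ : W₁ = W₀ + 3 / 2 / M₁)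
    (hM₂ : M₂ = M₁ - 1 * cubic' W₁ τ / cubic W₁ τ) (hW₂ : W₂ = W₁ + 3 / 2 / M₂) :
    e 1 τ + (e 2 τ - e 1 τ) * (kappa5 (tOf τ) ⟨theta0, (W₀ - e 1 τ) / (e 2 τ - e 1 τ),
      (e 2 τ - e 1 τ) * M₀⟩).l = W₂ := by
  have hD : e 2 τ - e 1 τ ≠ 0 := sub_ne_zero.mpr (e_ne hτ).1
  have k0 := mul_inv_sub hτ (1 / 2) W₀ hf₀
  have k1 := mul_inv_sub hτ 1 W₁ hf₁
  have hdiv : ∀ m : ℂ, 3 / 2 / m / (e 2 τ - e 1 τ) = 3 / 2 / ((e 2 τ - e 1 τ) * m) := fun m => by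
    rw [div_div, mul_comm m]
  rw [kappa5_l (tOf τ) _ _ ((e 2 τ - e 1 τ) * M₁) ((W₁ - e 1 τ) / (e 2 τ - e 1 τ))
    ((e 2 τ - e 1 τ) * M₂), ← hdiv, hW₂]
  · field_simp
    ring
  · rw [hM₁]; linear_combination k0
  · rw [← hdiv, hW₁]; ring
  · rw [hM₂]; linear_combination k1

theorem hasDerivAt_tOf (hτ : 0 < τ.im) : HasDerivAt tOf
    (-4 * heatC * tOf τ * (tOf τ - 1) * (e 2 τ - e 1 τ)) τ := by
  have hD : e 2 τ - e 1 τ ≠ 0 := sub_ne_zero.mpr (e_ne hτ).1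
  have h1 := hasDerivAt_e hτ (show (1 : Fin 4) ≠ 0 by decide)
  have h2 := hasDerivAt_e hτ (show (2 : Fin 4) ≠ 0 by decide)
  have h3 := hasDerivAt_e hτ (show (3 : Fin 4) ≠ 0 by decide)
  refine ((h3.sub h1).div (h2.sub h1) hD).congr_deriv ?_
  simp only [tOf, Pi.sub_apply]
  obtain ⟨v3, v2, -⟩ := vieta hτ
  rw [v3]
  field_simp
  ring

end Rescale

theorem lam0_eq (r s τ : ℂ) :
    lam0 r s τ = (wpRS r s τ + 1 / 2 / (Z r s τ / wpRS' r s τ) - e 1 τ) / (e 2 τ - e 1 τ) := by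
  have : wp' (r + s * τ) τ / (2 * Z r s τ) = 1 / 2 / (Z r s τ / wpRS' r s τ) := by
    rw [wpRS', div_div_eq_mul_div, mul_comm 2, ← div_div, div_right_comm]; ring
  rw [lam0, this, wpRS]

/-- The chain rule for λ = (W - e₁)/(e₂ - e₁) and the value of dt/dτ turn the first Hamiltonian
equation in t into the one in τ; the terms with η₁ cancel. -/
theorem muOf_algebra {W m c D e₁ e₂ η t : ℂ} (hD : e₂ - e₁ ≠ 0) (hc : c ≠ 0)
    (hDe : D = e₂ - e₁) (ht : t = (-e₁ - e₂ - e₁) / D) (ht0 : t ≠ 0) (ht1 : t - 1 ≠ 0)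
    (n1 : W - e₁ ≠ 0) (n2 : W - e₂ ≠ 0) (n3 : W - (-e₁ - e₂) ≠ 0) :
    muOf theta0 ((W - e₁) / D)
      (((c * (4 * η * W + 2 / 3 * (4 * (e₁ ^ 2 + e₁ * e₂ + e₂ ^ 2)) - 4 * W ^ 2
          - 2 * (4 * (W - e₁) * (W - e₂) * (W - (-e₁ - e₂))) * m
          + 1 / 2 * (12 * W ^ 2 - 4 * (e₁ ^ 2 + e₁ * e₂ + e₂ ^ 2)))
        - c * (-4 * e₁ ^ 2 + 4 * η * e₁ + 2 / 3 * (4 * (e₁ ^ 2 + e₁ * e₂ + e₂ ^ 2)))) * D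
        - (W - e₁) * (c * (-4 * e₂ ^ 2 + 4 * η * e₂ + 2 / 3 * (4 * (e₁ ^ 2 + e₁ * e₂ + e₂ ^ 2)))
          - c * (-4 * e₁ ^ 2 + 4 * η * e₁ + 2 / 3 * (4 * (e₁ ^ 2 + e₁ * e₂ + e₂ ^ 2))))) / D ^ 2
        / (-4 * c * t * (t - 1) * D)) t
      = D * m := by
  rw [← hDe] at hD
  have h1 : (W - e₁) / D - 1 = (W - e₂) / D := by rw [hDe] at hD ⊢; field_simp; ring
  have h2 : (W - e₁) / D - t = (W - (-e₁ - e₂)) / D := by rw [ht]; field_simp; ring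
  have hth : theta0 1 = 1 / 2 ∧ theta0 2 = 1 / 2 ∧ theta0 3 - 1 = -(1 / 2) := by
    refine ⟨rfl, rfl, ?_⟩
    change (1 / 2 : ℂ) - 1 = _
    norm_num
  rw [muOf, hth.1, hth.2.1, hth.2.2, h1, h2]
  have key : t * (t - 1) * (((c * (4 * η * W + 2 / 3 * (4 * (e₁ ^ 2 + e₁ * e₂ + e₂ ^ 2))
          - 4 * W ^ 2 - 2 * (4 * (W - e₁) * (W - e₂) * (W - (-e₁ - e₂))) * m
          + 1 / 2 * (12 * W ^ 2 - 4 * (e₁ ^ 2 + e₁ * e₂ + e₂ ^ 2)))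
        - c * (-4 * e₁ ^ 2 + 4 * η * e₁ + 2 / 3 * (4 * (e₁ ^ 2 + e₁ * e₂ + e₂ ^ 2)))) * D
        - (W - e₁) * (c * (-4 * e₂ ^ 2 + 4 * η * e₂ + 2 / 3 * (4 * (e₁ ^ 2 + e₁ * e₂ + e₂ ^ 2)))
          - c * (-4 * e₁ ^ 2 + 4 * η * e₁ + 2 / 3 * (4 * (e₁ ^ 2 + e₁ * e₂ + e₂ ^ 2))))) / D ^ 2
        / (-4 * c * t * (t - 1) * D))
      = ((W - e₁) * (W - e₂) + 2 * (W - e₁) * (W - e₂) * (W - (-e₁ - e₂)) * m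
        - 1 / 8 * (12 * W ^ 2 - 4 * (e₁ ^ 2 + e₁ * e₂ + e₂ ^ 2))) / D ^ 2 := by
    field_simp
    rw [hDe]
    ring
  rw [key]
  field_simp
  ring

/-! ### Picard's solution, Hitchin's solution and its image under κ₅. -/

section

variable {r s x : ℂ}

/-- Picard's solution of Painlevé VI. -/
theorem solvesHam_picard (hrs : ¬∃ m n : ℤ, r = (m : ℂ) / 2 ∧ s = (n : ℂ) / 2) (hx : 0 < x.im) :
    SolvesHam 0 1 (wpRS r s) (fun τ => Z r s τ / wpRS' r s τ) x := by
  have hint := not_int_of_not_half_int hrs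
  refine ⟨meromorphicAt_wpRS hint hx, (meromorphicAt_Z hrs hx).fun_div
    (meromorphicAt_wpRS' hint hx), hx, ?_⟩
  filter_upwards [eventually_line_mem_wpDomain hint hx, eventually_two_mul_line_notMem hrs hx]
    with τ hp h2
  have hQ : wpRS' r s τ ≠ 0 := wp'_ne_zero h2.1 h2.2
  have hsq : cubic (wpRS r s τ) τ = wpRS' r s τ ^ 2 :=
    (wp'_sq (notMem_of_two_mul_notMem h2.2)).symm
  refine ⟨h2.1, (hasDerivAt_wpRS hp).congr_deriv ?_,
    ((hasDerivAt_Z hp).div (hasDerivAt_wpRS' hp) hQ).congr_deriv ?_⟩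
  · rw [hsq]
    field_simp
    ring
  · simp only [cubic']
    field_simp
    ring

/-- The first Hamiltonian equation determines μ, so any M satisfying it together with Hitchin's W
must be the rescaled μ. -/
theorem mu0_eq {τ : ℂ} {M : ℂ} (hτ : 0 < τ.im)
    (hW : HasDerivAt (fun τ => wpRS r s τ + 1 / 2 / (Z r s τ / wpRS' r s τ))
      (heatC * (4 * eta1 τ * (wpRS r s τ + 1 / 2 / (Z r s τ / wpRS' r s τ)) + 2 / 3 * g2 τ
        - 4 * (wpRS r s τ + 1 / 2 / (Z r s τ / wpRS' r s τ)) ^ 2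
        - 2 * cubic (wpRS r s τ + 1 / 2 / (Z r s τ / wpRS' r s τ)) τ * M
        + 1 / 2 * cubic' (wpRS r s τ + 1 / 2 / (Z r s τ / wpRS' r s τ)) τ)) τ)
    (hf : cubic (wpRS r s τ + 1 / 2 / (Z r s τ / wpRS' r s τ)) τ ≠ 0) :
    mu0 r s τ = (e 2 τ - e 1 τ) * M := by
  have hD : e 2 τ - e 1 τ ≠ 0 := sub_ne_zero.mpr (e_ne hτ).1
  have h1 := hasDerivAt_e hτ (show (1 : Fin 4) ≠ 0 by decide)
  have h2 := hasDerivAt_e hτ (show (2 : Fin 4) ≠ 0 by decide)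
  have hl := (hW.sub h1).div (h2.sub h1) hD
  have hlam : HasDerivAt (lam0 r s) _ τ :=
    hl.congr_of_eventuallyEq (Eventually.of_forall (lam0_eq r s))
  obtain ⟨v3, v2, -⟩ := vieta hτ
  have ht : tOf τ = (-e 1 τ - e 2 τ - e 1 τ) / (e 2 τ - e 1 τ) := by rw [tOf, v3]
  have ht0 : tOf τ ≠ 0 := div_ne_zero (sub_ne_zero.mpr (e_ne hτ).2.1) hD
  have ht1 : tOf τ - 1 ≠ 0 := by
    rw [tOf, div_sub_one hD, sub_sub_sub_cancel_right]
    exact div_ne_zero (sub_ne_zero.mpr (e_ne hτ).2.2) hD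
  rw [mu0, hlam.deriv, (hasDerivAt_tOf hτ).deriv, lam0_eq]
  rw [cubic_eq hτ] at hf ⊢
  simp only [Pi.sub_apply, cubic']
  generalize wpRS r s τ + 1 / 2 / (Z r s τ / wpRS' r s τ) = W at *
  rw [v3] at hf ⊢
  rw [v2]
  simp only [ne_eq, mul_eq_zero, not_or] at hf
  exact muOf_algebra hD heatC_ne_zero rfl ht ht0 ht1 hf.1.1.2 hf.1.2 hf.2

/-- The result of applying `κ₅` to Hitchin's solution. -/
theorem exists_solvesHam (hrs : ¬∃ m n : ℤ, r = (m : ℂ) / 2 ∧ s = (n : ℂ) / 2) (hx : 0 < x.im) :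
    ∃ W M : ℂ → ℂ, SolvesHam (1 / 2) (-6) W M x ∧ ∀ᶠ τ in 𝓝[≠] x,
      τ ∈ rhs2Domain r s ∧ W τ = rhs2 r s τ ∧ W τ = wpP2 r s τ := by
  have hP := solvesHam_picard hrs hx
  have hM0 := hP.eventually_M_ne_zero one_ne_zero
  obtain ⟨W₀, hW₀⟩ : ∃ W₀ : ℂ → ℂ,
    W₀ = fun τ => wpRS r s τ + 1 / 2 / (Z r s τ / wpRS' r s τ) := ⟨_, rfl⟩
  -- For θ = 0 and ρ = 1 the parameter is θ₀ = 1/2, so κ₀ adds ℘'/(2Z) to ℘.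
  have h0 : SolvesHam (1 / 2) 0 W₀ (fun τ => Z r s τ / wpRS' r s τ) x := by
    rw [hW₀]
    convert hP.kappa0 hM0 (1 / 2) (by norm_num) using 1 <;> norm_num
  have hf0 := h0.eventually_cubic_ne_zero (by norm_num)
  obtain ⟨M₁, hM₁⟩ : ∃ M₁ : ℂ → ℂ, M₁ = fun τ => Z r s τ / wpRS' r s τ
    - 1 / 2 * cubic' (W₀ τ) τ / cubic (W₀ τ) τ := ⟨_, rfl⟩
  -- Here ρ = 0 allows θ₀ = -1/2 or 0. Choosing 0 amounts to applying κ₄, which changes neither W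
  -- nor M.
  have h1 : SolvesHam (-(1 / 2)) 6 W₀ M₁ x := by
    rw [hM₁]
    convert h0.kappa123 hf0 0 (by norm_num) using 1
    norm_num
  have hM1 := h1.eventually_M_ne_zero (by norm_num)
  obtain ⟨W₁, hW₁⟩ : ∃ W₁ : ℂ → ℂ, W₁ = fun τ => W₀ τ + 3 / 2 / M₁ τ := ⟨_, rfl⟩
  have h2 : SolvesHam 1 3 W₁ M₁ x := by
    rw [hW₁]
    convert h1.kappa0 hM1 (3 / 2) (by norm_num) using 1 <;> norm_num
  have hf1 := h2.eventually_cubic_ne_zero one_ne_zero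
  obtain ⟨M₂, hM₂⟩ : ∃ M₂ : ℂ → ℂ, M₂ = fun τ => M₁ τ
    - 1 * cubic' (W₁ τ) τ / cubic (W₁ τ) τ := ⟨_, rfl⟩
  have h3 : SolvesHam (-1) 15 W₁ M₂ x := by
    rw [hM₂]
    convert h2.kappa123 hf1 (-(3 / 2)) (by norm_num) using 1
    norm_num
  have hM2 := h3.eventually_M_ne_zero (by norm_num)
  refine ⟨fun τ => W₁ τ + 3 / 2 / M₂ τ, M₂, ?_, ?_⟩
  · convert h3.kappa0 hM2 (3 / 2) (by norm_num) using 1 <;> norm_num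
  filter_upwards [h0.ev, hM0, hf0, hM1, hf1, hM2, eventually_two_mul_line_notMem hrs hx]
    with τ hd0 hM0 hf0 hM1 hf1 hM2 hn
  obtain ⟨hτ, hn⟩ := hn
  have hnot := notMem_of_two_mul_notMem hn
  have hQ : wpRS' r s τ ≠ 0 := wp'_ne_zero hτ hn
  have hX : Z r s τ ≠ 0 := fun h => hM0 (by rw [h, zero_div])
  have hg' : g3 τ = 4 * wpRS r s τ ^ 3 - g2 τ * wpRS r s τ - wpRS' r s τ ^ 2 := by
    rw [wpRS', wp'_sq hnot, wpRS]; ring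
  have eW₀ := congrFun hW₀ τ
  have eM₁ := congrFun hM₁ τ
  have eW₁ := congrFun hW₁ τ
  have eM₂ := congrFun hM₂ τ
  have emu : mu0 r s τ = (e 2 τ - e 1 τ) * (Z r s τ / wpRS' r s τ) := by
    refine mu0_eq hτ ?_ ?_
    · have := hd0.2.1
      rwa [hW₀] at this
    · rwa [eW₀] at hf0
  have elam : lam0 r s τ = (W₀ τ - e 1 τ) / (e 2 τ - e 1 τ) := by rw [lam0_eq, eW₀]
  obtain ⟨hA0, hZ₂0, eM₁', eW₁'⟩ := chain_first hg' hX hQ eW₀ hf0 eM₁ hM1 eW₁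
  obtain ⟨hZ₃, hW₂⟩ := chain_second hg' hX rfl rfl rfl rfl rfl hA0 hZ₂0 eM₁' eW₁' hf1 eM₂ hM2 rfl
  refine ⟨⟨hτ, hnot, hX, hZ₃⟩, hW₂, ?_⟩
  rw [wpP2, lam2, emu, elam]
  exact (kappa5_rescaled hτ hf0 hf1 eM₁ eW₁ eM₂ rfl).symm

end

/-! ### Local existence of lifts along `℘` -/

theorem analyticAt_wp_curve {p : ℂ → ℂ} {τ : ℂ} (hp : AnalyticAt ℂ p τ)
    (h : (p τ, τ) ∈ wpDomain) : AnalyticAt ℂ (fun t => wp (p t) t) τ :=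
  analyticAt_curve isOpen_wpDomain contDiffOn_wp hp h

theorem exists_implicit {G : ℂ × ℂ → ℂ} {τ z a : ℂ} (hG : ContDiffAt ℂ 1 G (τ, z))
    (hd : HasDerivAt (fun w => G (τ, w)) a z) (ha : a ≠ 0) : ∃ p : ℂ → ℂ, p τ = z ∧
      (∀ᶠ t in 𝓝 τ, G (t, p t) = G (τ, z)) ∧ ContDiffAt ℂ 1 p τ := by
  have hderiv : fderiv ℂ G (τ, z) (0, 1) = a :=
    ((hG.differentiableAt one_ne_zero).hasFDerivAt.comp_hasDerivAt z
      ((hasDerivAt_const z τ).prodMk (hasDerivAt_id z))).unique hd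
  have hinv : (fderiv ℂ G (τ, z) ∘L .inr ℂ ℂ ℂ).IsInvertible := by
    refine ⟨ContinuousLinearEquiv.unitsEquivAut ℂ (Units.mk0 a ha), ?_⟩
    ext
    simp [hderiv]
  exact ⟨hG.implicitFunction one_ne_zero hinv, hG.implicitFunction_apply_self one_ne_zero hinv,
    hG.eventually_apply_implicitFunction one_ne_zero hinv,
    hG.contDiffAt_implicitFunction one_ne_zero hinv⟩

theorem contDiffAt_wp_swap {τ z : ℂ} (h : (z, τ) ∈ wpDomain) :
    ContDiffAt ℂ 1 (fun v : ℂ × ℂ => wp v.2 v.1) (τ, z) :=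
  ContDiffAt.comp (τ, z) (g := fun p : ℂ × ℂ => wp p.1 p.2) (f := Prod.swap)
    ((contDiffOn_wp.contDiffAt (isOpen_wpDomain.mem_nhds h)).of_le (by simp))
    (contDiff_snd.prodMk contDiff_fst).contDiffAt

/-- Surjectivity of ℘ gives the value at τ. Since ℘'² is the nonvanishing cubic there, the implicit
function theorem continues it, and 2z avoids the lattice because ℘' vanishes at half periods. -/
theorem exists_isWpLift {F : ℂ → ℂ} {τ : ℂ} (hτ : 0 < τ.im) (hF : AnalyticAt ℂ F τ)
    (hf : cubic (F τ) τ ≠ 0) : ∃ (U : Set ℂ) (p : ℂ → ℂ), τ ∈ U ∧ IsWpLift F U p := by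
  obtain ⟨z, hz, hzF⟩ := exists_wp_eq hτ (F τ)
  have hsq : wp' z τ ^ 2 = cubic (F τ) τ := by rw [← hzF]; exact wp'_sq hz
  have hQ : wp' z τ ≠ 0 := fun h => hf (by rw [← hsq, h, zero_pow two_ne_zero])
  have h2z : 2 * z ∉ (per τ).lattice := fun h => hQ (wp'_half h)
  have hFc : ContDiffAt ℂ 1 (fun v : ℂ × ℂ => F v.1) (τ, z) :=
    hF.contDiffAt.comp (τ, z) contDiffAt_fst
  obtain ⟨p, hpz, hpG, hpd⟩ := exists_implicit ((contDiffAt_wp_swap ⟨hτ, hz⟩).sub hFc)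
    ((hasDerivAt_wp hz).sub_const (F τ)) hQ
  have h2 : ∀ᶠ t in 𝓝 τ, (2 * p t, t) ∈ wpDomain :=
    eventually_curve_mem isOpen_wpDomain (continuousAt_const.mul hpd.continuousAt)
      ⟨hτ, by rwa [hpz]⟩
  obtain ⟨U, hU, hUo, hτU⟩ := eventually_nhds_iff.mp
    ((h2.and hpG).and (hpd.eventually (by simp)))
  refine ⟨U, p, hτU, hUo, fun t ht => (hU t ht).1.1.1, fun t ht =>
    ((hU t ht).2.differentiableAt one_ne_zero).differentiableWithinAt,
    fun t ht => (hU t ht).1.1.2, ?_⟩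
  filter_upwards [self_mem_codiscreteWithin U] with t ht
  have := (hU t ht).1.2
  simp only [hzF, sub_self] at this
  exact sub_eq_zero.mp this

namespace IsWpLift

variable {F p : ℂ → ℂ} {U : Set ℂ} {τ : ℂ}

theorem analyticAt (h : IsWpLift F U p) (hτ : τ ∈ U) : AnalyticAt ℂ p τ :=
  h.holo.analyticAt (h.isOpen.mem_nhds hτ)

theorem mem_wpDomain (h : IsWpLift F U p) (hτ : τ ∈ U) : (p τ, τ) ∈ wpDomain :=
  ⟨h.subset hτ, notMem_of_two_mul_notMem (h.avoid τ hτ)⟩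

theorem eventually_eq (h : IsWpLift F U p) (hτ : τ ∈ U) :
    ∀ᶠ t in 𝓝[≠] τ, t ∈ U ∧ wp (p t) t = F t := by
  have h1 := mem_codiscreteWithin_iff_forall_mem_nhdsNE.mp h.wp_eq τ hτ
  filter_upwards [h1, nhdsWithin_le_nhds (h.isOpen.mem_nhds hτ)] with t ht htU
  exact ⟨htU, ht.resolve_right (not_not_intro htU)⟩

end IsWpLift

theorem eq_of_eventuallyEq_nhdsNE {f g : ℂ → ℂ} {x : ℂ} (hf : ContinuousAt f x)
    (hg : ContinuousAt g x) (h : ∀ᶠ t in 𝓝[≠] x, f t = g t) : f x = g x :=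
  tendsto_nhds_unique_of_eventuallyEq (hf.mono_left nhdsWithin_le_nhds)
    (hg.mono_left nhdsWithin_le_nhds) h

theorem continuousAt_rhs2 {r s τ : ℂ} (hτ : τ ∈ rhs2Domain r s) : ContinuousAt (rhs2 r s) τ := by
  obtain ⟨him, hnot, hZ, hZ3⟩ := hτ
  have hd : (r + s * τ, τ) ∈ wpDomain := ⟨him, hnot⟩
  have hP : ContinuousAt (fun t => wp (r + s * t) t) τ := (hasDerivAt_wpRS hd).continuousAt
  have hQ : ContinuousAt (fun t => wp' (r + s * t) t) τ := (hasDerivAt_wpRS' hd).continuousAt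
  have hX : ContinuousAt (fun t => Z r s t) τ := (hasDerivAt_Z hd).continuousAt
  have h2 : ContinuousAt (fun t => g2 t) τ := (analyticAt_g2 him).continuousAt
  have h3 : ContinuousAt (fun t => g3 t) τ := (analyticAt_g3 him).continuousAt
  have hXi : ContinuousAt (fun t => Xi2 r s t (Z r s t)) τ := by
    simp only [Xi2]
    fun_prop
  have hZ3c : ContinuousAt (fun t => Z3 r s t) τ := by
    simp only [Z3]
    fun_prop
  exact hP.add (hXi.div ((continuousAt_const.mul hX).mul hZ3c)
    (mul_ne_zero (mul_ne_zero (by norm_num) hZ) hZ3))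

/-! ### The elliptic form of Painlevé VI -/

/-- The numerators are f'(e_k)/4; summing the partial fractions removes the individual e_k. -/
theorem sum_div_sq {τ W : ℂ} (hτ : 0 < τ.im) (hf : cubic W τ ≠ 0) :
    (3 * e 1 τ ^ 2 - g2 τ / 4) / (W - e 1 τ) ^ 2 + (3 * e 2 τ ^ 2 - g2 τ / 4) / (W - e 2 τ) ^ 2
      + (3 * e 3 τ ^ 2 - g2 τ / 4) / (W - e 3 τ) ^ 2
      = 9 - 12 * W * cubic' W τ / cubic W τ + cubic' W τ ^ 3 / (4 * cubic W τ ^ 2) := by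
  rw [cubic_eq hτ] at hf ⊢
  obtain ⟨h3, h2, -⟩ := vieta hτ
  simp only [ne_eq, mul_eq_zero, not_or] at hf
  obtain ⟨⟨⟨-, n1⟩, n2⟩, n3⟩ := hf
  rw [cubic', h2]
  rw [h3] at n3 ⊢
  field_simp
  ring

/-- Differentiate the constant product of `wp_add_half` and eliminate ℘(z + ω_k/2). -/
theorem wp'_add_halfPeriod {τ z : ℂ} (hτ : 0 < τ.im) (hz : 2 * z ∉ (per τ).lattice) {k : Fin 4}
    (hk : k ≠ 0) : wp' (z + halfPeriod k τ) τ
      = -wp' z τ * ((3 * e k τ ^ 2 - g2 τ / 4) / (wp z τ - e k τ) ^ 2) := by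
  have hne := sub_ne_zero.mpr (wp_ne_e hτ hz hk)
  have h1 := wp_add_half hτ (halfPeriod_notMem hτ hk) (two_mul_halfPeriod_mem hτ k)
    (notMem_of_two_mul_notMem hz) (add_halfPeriod_notMem hτ hz k)
  have h2 := wp'_add_half hτ (halfPeriod_notMem hτ hk) (two_mul_halfPeriod_mem hτ k)
    (notMem_of_two_mul_notMem hz) (add_halfPeriod_notMem hτ hz k)
  rw [← e] at h1 h2
  field_simp
  linear_combination 4 * (wp z τ - e k τ) * h2 - 4 * wp' z τ * h1

theorem sum_epvi {τ z : ℂ} (hτ : 0 < τ.im) (hz : 2 * z ∉ (per τ).lattice) :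
    ∑ k : Fin 4, (![25 / 8, 1 / 8, 1 / 8, 1 / 8] : Fin 4 → ℂ) k * wp' (z + halfPeriod k τ) τ
      = wp' z τ * (2 + 3 / 2 * (wp z τ * cubic' (wp z τ) τ) / cubic (wp z τ) τ
        - cubic' (wp z τ) τ ^ 3 / (32 * cubic (wp z τ) τ ^ 2)) := by
  have hf : cubic (wp z τ) τ ≠ 0 := by
    rw [cubic, ← wp'_sq (notMem_of_two_mul_notMem hz)]
    exact pow_ne_zero 2 (wp'_ne_zero hτ hz)
  have hs := sum_div_sq hτ hf
  have h0 : z + halfPeriod 0 τ = z := by simp [halfPeriod]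
  have hv : (![25 / 8, 1 / 8, 1 / 8, 1 / 8] : Fin 4 → ℂ) 0 = 25 / 8 ∧
    (![25 / 8, 1 / 8, 1 / 8, 1 / 8] : Fin 4 → ℂ) 1 = 1 / 8 ∧
    (![25 / 8, 1 / 8, 1 / 8, 1 / 8] : Fin 4 → ℂ) 2 = 1 / 8 ∧
    (![25 / 8, 1 / 8, 1 / 8, 1 / 8] : Fin 4 → ℂ) 3 = 1 / 8 := ⟨rfl, rfl, rfl, rfl⟩
  rw [Fin.sum_univ_four, hv.1, hv.2.1, hv.2.2.1, hv.2.2.2, h0,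
    wp'_add_halfPeriod hτ hz (k := 1) (by decide), wp'_add_halfPeriod hτ hz (k := 2) (by decide),
    wp'_add_halfPeriod hτ hz (k := 3) (by decide)]
  linear_combination -(1 / 8) * wp' z τ * hs

/-- A lift of a solution of the Hamiltonian system with `θ = 1/2`, `ρ = -6` satisfies a first order
equation. -/
theorem deriv_lift {τ M a : ℂ} {p : ℂ → ℂ} (hp : 2 * p τ ∉ (per τ).lattice) (hτ : 0 < τ.im)
    (hd : HasDerivAt p a τ)
    (hW : HasDerivAt (fun t => wp (p t) t) (heatC * (4 * eta1 τ * wp (p τ) τ + 2 / 3 * g2 τ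
      - 4 * wp (p τ) τ ^ 2 - 2 * cubic (wp (p τ) τ) τ * M + 1 / 2 * cubic' (wp (p τ) τ) τ)) τ) :
    a = 2 * heatC * (psi (p τ) τ
      - (wp' (p τ) τ * M - cubic' (wp (p τ) τ) τ / (4 * wp' (p τ) τ))) := by
  have hn := notMem_of_two_mul_notMem hp
  have hQ := wp'_ne_zero hτ hp
  have h := hW.unique (hasDerivAt_wp_curve ⟨hτ, hn⟩ hd)
  have hc : cubic (wp (p τ) τ) τ = wp' (p τ) τ ^ 2 := (wp'_sq hn).symm
  rw [hc] at h
  refine mul_left_cancel₀ hQ ?_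
  field_simp
  linear_combination -4 * h

/-- Differentiating the first-order equation of `deriv_lift` brings in p' and M'. After both are
replaced, all terms containing M or ψ cancel. -/
theorem deriv_deriv_lift {τ : ℂ} {p M : ℂ → ℂ} (hp : 2 * p τ ∉ (per τ).lattice) (hτ : 0 < τ.im)
    (ha : AnalyticAt ℂ p τ)
    (hW : ∀ᶠ t in 𝓝 τ, HasDerivAt (fun t => wp (p t) t) (heatC * (4 * eta1 t * wp (p t) t
      + 2 / 3 * g2 t - 4 * wp (p t) t ^ 2 - 2 * cubic (wp (p t) t) t * M t
      + 1 / 2 * cubic' (wp (p t) t) t)) t)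
    (hM : HasDerivAt M (heatC * (-4 * eta1 τ * M τ + 8 * wp (p τ) τ * M τ
      + cubic' (wp (p τ) τ) τ * M τ ^ 2 - 24 * (1 / 2) * wp (p τ) τ * M τ + -6)) τ) :
    deriv (deriv p) τ = 4 * heatC ^ 2 *
      (wp' (p τ) τ * (2 + 3 / 2 * (wp (p τ) τ * cubic' (wp (p τ) τ) τ) / cubic (wp (p τ) τ) τ
        - cubic' (wp (p τ) τ) τ ^ 3 / (32 * cubic (wp (p τ) τ) τ ^ 2))) := by
  have hn := notMem_of_two_mul_notMem hp
  have hQ := wp'_ne_zero hτ hp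
  have h2 := eventually_curve_mem isOpen_wpDomain (continuousAt_const.mul ha.continuousAt)
    (show (2 * p τ, τ) ∈ wpDomain from ⟨hτ, hp⟩)
  have hd1 : ∀ᶠ t in 𝓝 τ, deriv p t = 2 * heatC * (psi (p t) t
      - (wp' (p t) t * M t - cubic' (wp (p t) t) t / (4 * wp' (p t) t))) := by
    filter_upwards [hW, h2, ha.eventually_analyticAt] with t ht h2 ha
    exact deriv_lift h2.2 h2.1 ha.differentiableAt.hasDerivAt ht
  have e1 := hd1.self_of_nhds
  have hpd := ha.differentiableAt.hasDerivAt
  have hmem : (p τ, τ) ∈ wpDomain := ⟨hτ, hn⟩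
  have hQd := hasDerivAt_wp'_curve hmem hpd
  have hD := ((hasDerivAt_psi_curve hmem hpd).sub ((hQd.mul hM).sub
    ((hasDerivAt_cubic' hτ hW.self_of_nhds).div (hQd.const_mul 4)
      (mul_ne_zero (by norm_num) hQ)))).const_mul (2 * heatC)
  have hD2 := (hD.congr_of_eventuallyEq hd1).deriv
  rw [hD2]
  have hc : cubic (wp (p τ) τ) τ = wp' (p τ) τ ^ 2 := (wp'_sq hn).symm
  have h3 : g3 τ = 4 * wp (p τ) τ ^ 3 - g2 τ * wp (p τ) τ - wp' (p τ) τ ^ 2 := by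
    rw [← hc, cubic]; ring
  have h2 : g2 τ = 12 * wp (p τ) τ ^ 2 - cubic' (wp (p τ) τ) τ := by rw [cubic']; ring
  rw [hc, e1, h3, h2]
  generalize cubic' (wp (p τ) τ) τ = f'
  generalize wp' (p τ) τ = Q at *
  field_simp
  ring

/-! ### Existence of lifts, the formula, and EPVI. -/

section

theorem eventually_codiscreteWithin_of_nhdsNE {S : Set ℂ} {q : ℂ → Prop}
    (h : ∀ x ∈ S, ∀ᶠ τ in 𝓝[≠] x, q τ) : ∀ᶠ τ in codiscreteWithin S, q τ :=
  mem_codiscreteWithin_iff_forall_mem_nhdsNE.mpr fun x hx =>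
    mem_of_superset (h x hx) Set.subset_union_left

variable {r s : ℂ}

/-- Off a discrete set the meromorphic W is analytic and avoids the e_k, because f(W) ≠ 0;
`exists_isWpLift` then applies. -/
theorem eventually_exists_isP2 (hrs : ¬∃ m n : ℤ, r = (m : ℂ) / 2 ∧ s = (n : ℂ) / 2) {x : ℂ}
    (hx : 0 < x.im) : ∀ᶠ τ in 𝓝[≠] x, ∃ (U : Set ℂ) (p : ℂ → ℂ), τ ∈ U ∧ IsP2 r s U p := by
  obtain ⟨W, M, hWM, hev⟩ := exists_solvesHam hrs hx
  have hW : W =ᶠ[𝓝[≠] x] wpP2 r s := hev.mono fun τ h => h.2.2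
  filter_upwards [(hWM.merW.congr hW).eventually_analyticAt, hWM.eventually_cubic_ne_zero
    (by norm_num), hW, eventually_im_pos hx] with τ han hf hWτ hτ
  rw [hWτ] at hf
  exact exists_isWpLift hτ han hf

theorem IsP2.wp_eq_rhs2 (hrs : ¬∃ m n : ℤ, r = (m : ℂ) / 2 ∧ s = (n : ℂ) / 2) {U : Set ℂ}
    {p : ℂ → ℂ} (h : IsP2 r s U p) {τ : ℂ} (hU : τ ∈ U) (hτ : τ ∈ rhs2Domain r s) :
    wp (p τ) τ = rhs2 r s τ := by
  obtain ⟨W, M, -, hev⟩ := exists_solvesHam hrs hτ.1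
  refine eq_of_eventuallyEq_nhdsNE (f := fun t => wp (p t) t)
    (analyticAt_wp_curve (h.analyticAt hU) (h.mem_wpDomain hU)).continuousAt
    (continuousAt_rhs2 hτ) ?_
  filter_upwards [h.eventually_eq hU, hev] with t h1 h2
  rw [h1.2, ← h2.2.2, h2.2.1]

/-- EPVI is verified on a punctured neighbourhood of each point. Both sides are continuous at the
centre, since p avoids the half periods, so it holds there as well. -/
theorem IsWpLift.solvesEPVI (hrs : ¬∃ m n : ℤ, r = (m : ℂ) / 2 ∧ s = (n : ℂ) / 2) {U : Set ℂ}
    {p : ℂ → ℂ} (h : IsWpLift (rhs2 r s) U p) : SolvesEPVI ![25 / 8, 1 / 8, 1 / 8, 1 / 8] U p := by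
  refine ⟨h.holo, h.avoid, fun x hxU => ?_⟩
  have hx : 0 < x.im := h.subset hxU
  obtain ⟨W, M, hWM, hev⟩ := exists_solvesHam hrs hx
  have han := h.analyticAt hxU
  refine eq_of_eventuallyEq_nhdsNE (f := deriv (deriv p)) (g := fun τ =>
    -1 / (4 * (Real.pi : ℂ) ^ 2) * ∑ k : Fin 4, (![25 / 8, 1 / 8, 1 / 8, 1 / 8] : Fin 4 → ℂ) k *
      wp' (p τ + halfPeriod k τ) τ) han.deriv.deriv.continuousAt ?_ ?_
  · refine continuousAt_const.mul (tendsto_finsetSum _ fun k _ => continuousAt_const.mul ?_)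
    have hk : AnalyticAt ℂ (fun τ => halfPeriod k τ) x := by
      unfold halfPeriod
      fin_cases k <;> simp <;> fun_prop
    exact (analyticAt_curve isOpen_wpDomain contDiffOn_wp' (han.add hk)
      ⟨hx, add_halfPeriod_notMem hx (h.avoid x hxU) k⟩).continuousAt
  · have hWp : ∀ᶠ τ in 𝓝[≠] x, τ ∈ U ∧ wp (p τ) τ = W τ := by
      filter_upwards [h.eventually_eq hxU, hev] with t h1 h2
      exact ⟨h1.1, by rw [h1.2, h2.2.1]⟩
    filter_upwards [eventually_eventually_nhdsWithin.mpr hWp,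
      eventually_eventually_nhdsWithin.mpr hWM.ev, self_mem_nhdsWithin] with τ h1 h2 hne
    have hne : τ ≠ x := hne
    -- Away from x the punctured neighbourhoods of x are full neighbourhoods of τ, so the identities
    -- may be differentiated at τ.
    rw [hne.nhdsWithin_compl_singleton] at h1 h2
    have hτU := h1.self_of_nhds.1
    have hWτ := h1.self_of_nhds.2
    have hτ := h.subset hτU
    have h3 : ∀ᶠ t in 𝓝 τ, wp (p t) t = W t := h1.mono fun t ht => ht.2
    rw [deriv_deriv_lift (M := M) (h.avoid τ hτU) hτ (h.analyticAt hτU) ?_ ?_,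
      sum_epvi hτ (h.avoid τ hτU), heatC_sq]
    · ring
    · filter_upwards [h2, eventually_eventually_nhds.mpr h3] with t h4 h5
      have := h4.2.1.congr_of_eventuallyEq h5
      rwa [← h5.self_of_nhds] at this
    · rw [hWτ]
      exact h2.self_of_nhds.2.2

end

end LamePVI

end

theorem mainTheorem12 (r s : ℂ)
    (hrs : ¬ ∃ m n : ℤ, r = (m : ℂ) / 2 ∧ s = (n : ℂ) / 2) :
    -- the right-hand side is well defined outside a discrete subset of the upper half plane
    (∀ᶠ τ in Filter.codiscreteWithin {τ : ℂ | 0 < τ.im}, τ ∈ LamePVI.rhs2Domain r s) ∧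
    -- the function `p^{(2)}_{r,s}` exists locally, outside a discrete subset
    (∀ᶠ τ in Filter.codiscreteWithin {τ : ℂ | 0 < τ.im},
      ∃ (U : Set ℂ) (p : ℂ → ℂ), τ ∈ U ∧ LamePVI.IsP2 r s U p) ∧
    -- the formula for `℘(p^{(2)}_{r,s}(τ)|τ)`
    (∀ (U : Set ℂ) (p : ℂ → ℂ), LamePVI.IsP2 r s U p →
      ∀ τ ∈ U ∩ LamePVI.rhs2Domain r s,
        LamePVI.wp (p τ) τ =
          LamePVI.wp (r + s * τ) τ +
            LamePVI.Xi2 r s τ (LamePVI.Z r s τ) /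
              (8 * LamePVI.Z r s τ * LamePVI.Z3 r s τ)) ∧
    -- the formula gives solutions of EPVI(25/8, 1/8, 1/8, 1/8)
    (∀ (U : Set ℂ) (p : ℂ → ℂ), LamePVI.IsWpLift (LamePVI.rhs2 r s) U p →
      LamePVI.SolvesEPVI ![25 / 8, 1 / 8, 1 / 8, 1 / 8] U p) := by
  refine ⟨LamePVI.eventually_codiscreteWithin_of_nhdsNE fun x hx => ?_,
    LamePVI.eventually_codiscreteWithin_of_nhdsNE fun x hx =>
      LamePVI.eventually_exists_isP2 hrs hx,
    fun U p h τ hτ => LamePVI.IsP2.wp_eq_rhs2 hrs h hτ.1 hτ.2,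
    fun U p h => LamePVI.IsWpLift.solvesEPVI hrs h⟩
  obtain ⟨W, M, -, hev⟩ := LamePVI.exists_solvesHam hrs hx
  exact hev.mono fun τ h => h.1
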